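/- Let $(\Sigma,g)$ be a connected complete Riemannian manifold (i.e. all geodesics are defined on $\mathbb{R}$) of dimension $n\ge 1$ without boundary, with unit tangent bundle $S\Sigma$ and geodesic flow $\varphi^g$, and let $\Omega\subset\Sigma$ be a closed subset that is an $n$-dimensional smooth submanifold with boundary $\partial\Omega$ and interior $\mathring\Omega$. Put $M=S\Sigma|_{\Sigma\setminus\mathring\Omega}$, $\mathring M=S\Sigma|_{\Sigma\setminus\Omega}$, $\partial M=S\Sigma|_{\partial\Omega}$. For $x\in\partial\Omega$ let $n_x$ be the unit normal pointing into $\Omega$; a vector $(x,v)\in\partial M$ is grazing, inward or outward if $g_x(v,n_x)$ is $0$, positive or negative, and $(x,v')$ with $v'=v-2g_x(v,n_x)n_x$ is its reflection. Let $\partial_{\mathrm g}M$ be the set of grazing vectors. The non-grazing billiard flow $\varphi$ on $M\setminus\partial_{\mathrm g}M$ is defined as follows: $\varphi_0=\mathrm{id}$; for $t>0$ the trajectory of $(x,v)$ follows the geodesic flow, starting from $(x,v')$ instead of $(x,v)$ if $(x,v)$ is inward, up to the first positive time at which it hits $\Omega$. If there is no hit it continues forever; if the hit is grazing the trajectory ends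 there (this time being excluded); otherwise the value of $\varphi$ at the hitting time is the (inward) incoming vector, and the trajectory is continued from this vector by the same rule. For $t<0$ the definition is the same in backward time with "inward" and "outward" exchanged. Let $(T_{\min}(x,v),T_{\max}(x,v))\ni 0$ be the resulting maximal interval of existence (the hitting times may accumulate at a finite endpoint) and $D=\{(t,x,v): (x,v)\in M\setminus\partial_{\mathrm g}M,\ T_{\min}(x,v)<t<T_{\max}(x,v)\}$ the domain of $\varphi$. A smooth model for $\varphi$ is a triple $(\mathcal M,\pi,\phi)$ of a smooth manifold $\mathcal M$, a smooth surjection $\pi:M\setminus\partial_{\mathrm g}M\to\mathcal M$ such that $\mathcal D:=(\mathrm{id}_{\mathbb R}\times\pi)(D)$ is open in $\mathbb R\times\mathcal M$, and a smooth flow $\phi:\mathcal D\to\mathcal M$, such that $\pi|_{\mathring M}$ is a diffeomorphism onto an open subset of $\mathcal M$ and $\phi_t(\pi(x,v))=\pi(\varphi_t(x,v))$ for all $(t,x,v)\in D$. The trapped set $K$ of $\varphi$ is the set of $(x,v)\in M\setminus\partial_{\mathrm g}M$ with $\mathbb R\times\{(x,v)\}\subset D$ for which $\varphi(\mathbb R\times\{(x,v)\})$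 is contained in a compact subset of $M\setminus\partial_{\mathrm g}M$; the trapped set $\mathcal K$ of $\phi$ is the set of $p\in\mathcal M$ with $\mathbb R\times\{p\}\subset\mathcal D$ for which $\phi(\mathbb R\times\{p\})$ is contained in a compact subset of $\mathcal M$. A closed trajectory of $\varphi$ (resp. $\phi$) with period $T>0$ is a pair $(T,\gamma)$, where $\gamma$ is the set of all points on the trajectory of a point $q$ such that the flow for time $T$ is defined at $q$ and maps $q$ to $q$; $T$ is the primitive period if moreover the flow at times $t\in(0,T)$ does not map $q$ to $q$. **Proposition.** Let $(\mathcal M,\pi,\phi)$ be a smooth model for $\varphi$. Then $\mathcal K=\pi(K)$ and $\pi^{-1}(\mathcal K)=K$. Moreover $(T,\gamma)\mapsto(T,\pi(\gamma))$ is a bijection from the closed trajectories of $\varphi$ to the closed trajectories of $\phi$, and also from those with primitive period $T$ to those with primitive period $T$. More precisely: (i) If $p\in\mathcal M$ and $T>0$ satisfy $\phi_T(p)=p$ and $\phi_t(p)\ne p$ for all $t\in(0,T)$, then there is $(x,v)\in M\setminus\partial_{\mathrm g}M$ with $\varphi_T(x,v)=(x,v)$, $\varphi_t(x,v)\neq(x,v)$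 for all $t\in(0,T)$, and $\pi(x,v)=p$. (ii) If $(x,v)\in M\setminus\partial_{\mathrm g}M$ and $T>0$ satisfy $\varphi_T(x,v)=(x,v)$ and $\varphi_t(x,v)\ne(x,v)$ for all $t\in(0,T)$, then $\pi(x,v)\in\mathcal K$, $\phi_T(\pi(x,v))=\pi(x,v)$, and $\phi_t(\pi(x,v))\ne\pi(x,v)$ for all $t\in(0,T)$. -/

import Mathlib

open scoped Manifold ContDiff ENNReal Topology

/-! ### Abstract (partially defined) flows: trapped sets and closed trajectories

A partially defined flow on a set `S` is given by a domain `D` of pairs `(t, p)` and a map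
`φ : ℝ → P → P`, of which only the values `φ t p` with `(t, p) ∈ D` are meaningful. -/

namespace PartialFlow

/-- The points of `S` whose trajectory is defined for all times and stays in a compact
subset of `S`. -/
def trappedSet {P : Type*} [TopologicalSpace P] (S : Set P) (D : Set (ℝ × P)) (φ : ℝ → P → P) :
    Set P :=
  {p | p ∈ S ∧ (∀ t : ℝ, (t, p) ∈ D) ∧ ∃ W : Set P, IsCompact W ∧ W ⊆ S ∧ ∀ t : ℝ, φ t p ∈ W}

/-- The trajectory of `p`, as a set of points. -/
def trajectory {P : Type*} (D : Set (ℝ × P)) (φ : ℝ → P → P) (p : P) : Set P :=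
  {q | ∃ t : ℝ, (t, p) ∈ D ∧ φ t p = q}

/-- `T > 0` is a period of `p`. -/
def IsPeriod {P : Type*} (D : Set (ℝ × P)) (φ : ℝ → P → P) (T : ℝ) (p : P) : Prop :=
  0 < T ∧ (T, p) ∈ D ∧ φ T p = p

/-- `T > 0` is the primitive (smallest) period of `p`. -/
def IsPrimitivePeriod {P : Type*} (D : Set (ℝ × P)) (φ : ℝ → P → P) (T : ℝ) (p : P) : Prop :=
  IsPeriod D φ T p ∧ ∀ t ∈ Set.Ioo (0 : ℝ) T, φ t p ≠ p

/-- Closed trajectories `γ`, together with a (not necessarily primitive) period `T`,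
encoded as pairs `(T, γ)`. -/
def closedTrajectories {P : Type*} (D : Set (ℝ × P)) (φ : ℝ → P → P) : Set (ℝ × Set P) :=
  {c | ∃ p : P, IsPeriod D φ c.1 p ∧ c.2 = trajectory D φ p}

/-- Closed trajectories `γ` together with their primitive period `T`, as pairs `(T, γ)`. -/
def primitiveClosedTrajectories {P : Type*} (D : Set (ℝ × P)) (φ : ℝ → P → P) :
    Set (ℝ × Set P) :=
  {c | ∃ p : P, IsPrimitivePeriod D φ c.1 p ∧ c.2 = trajectory D φ p}

end PartialFlow

/-! ### Riemannian metrics and geodesics -/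

/-- Smooth Riemannian metrics on the `n`-dimensional manifold `X`. -/
abbrev SmoothMetric (n : ℕ) (X : Type*) [TopologicalSpace X]
    [ChartedSpace (EuclideanSpace ℝ (Fin n)) X] [IsManifold (𝓡 n) ∞ X] : Type _ :=
  Bundle.ContMDiffRiemannianMetric (𝓡 n) ∞ (EuclideanSpace ℝ (Fin n))
    (fun x : X => TangentSpace (𝓡 n) x)

noncomputable section

namespace SmoothMetric

/-- The coefficients of the metric in the chart around `x₀`: at the point with coordinates `z`,
the value of the metric on the tangent vectors with coordinates `a` and `b`. -/
def coeff {n : ℕ} {X : Type*} [TopologicalSpace X]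
    [ChartedSpace (EuclideanSpace ℝ (Fin n)) X] [IsManifold (𝓡 n) ∞ X] (g : SmoothMetric n X)
    (x₀ : X) (z a b : EuclideanSpace ℝ (Fin n)) : ℝ :=
  g.inner ((extChartAt (𝓡 n) x₀).symm z)
    (mfderiv (𝓡 n) (𝓡 n) (extChartAt (𝓡 n) x₀).symm z a)
    (mfderiv (𝓡 n) (𝓡 n) (extChartAt (𝓡 n) x₀).symm z b)

/-- `γ : ℝ → X` is a geodesic: it is smooth and satisfies the geodesic equation in charts,
written with Christoffel symbols of the first kind. In coordinates `c` of `γ` it reads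
`g_c(c'', w) + (∂_{c'} g)_c(c', w) - (1/2) (∂_w g)_c(c', c') = 0` for all vectors `w`. -/
def IsGeodesic {n : ℕ} {X : Type*} [TopologicalSpace X]
    [ChartedSpace (EuclideanSpace ℝ (Fin n)) X] [IsManifold (𝓡 n) ∞ X] (g : SmoothMetric n X)
    (γ : ℝ → X) : Prop :=
  ContMDiff 𝓘(ℝ, ℝ) (𝓡 n) ∞ γ ∧
  ∀ (x₀ : X) (t : ℝ), γ t ∈ (extChartAt (𝓡 n) x₀).source →
    let c : ℝ → EuclideanSpace ℝ (Fin n) := fun s => extChartAt (𝓡 n) x₀ (γ s)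
    ∀ w : EuclideanSpace ℝ (Fin n),
      g.coeff x₀ (c t) (deriv (deriv c) t) w
        + fderiv ℝ (fun z => g.coeff x₀ z (deriv c t) w) (c t) (deriv c t)
        - (1 / 2) * fderiv ℝ (fun z => g.coeff x₀ z (deriv c t) (deriv c t)) (c t) w = 0

/-- The curve `t ↦ (γ(t), γ'(t))` in the tangent bundle. -/
def velocity {n : ℕ} {X : Type*} [TopologicalSpace X]
    [ChartedSpace (EuclideanSpace ℝ (Fin n)) X] (γ : ℝ → X) (t : ℝ) : TangentBundle (𝓡 n) X :=
  ⟨γ t, mfderiv 𝓘(ℝ, ℝ) (𝓡 n) γ t (1 : ℝ)⟩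

/-- Completeness of the Riemannian manifold: every tangent vector is the initial velocity of a
geodesic defined on all of `ℝ`. -/
def IsComplete {n : ℕ} {X : Type*} [TopologicalSpace X]
    [ChartedSpace (EuclideanSpace ℝ (Fin n)) X] [IsManifold (𝓡 n) ∞ X] (g : SmoothMetric n X) :
    Prop :=
  ∀ q : TangentBundle (𝓡 n) X, ∃ γ : ℝ → X, g.IsGeodesic γ ∧ velocity γ 0 = q

open Classical in
/-- The geodesic flow on the tangent bundle: `(t, q)` is mapped to the velocity at time `t` of
the geodesic with initial velocity `q` (the value is `q` if there is no such geodesic on `ℝ`). -/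
def geodesicFlow {n : ℕ} {X : Type*} [TopologicalSpace X]
    [ChartedSpace (EuclideanSpace ℝ (Fin n)) X] [IsManifold (𝓡 n) ∞ X] (g : SmoothMetric n X)
    (t : ℝ) (q : TangentBundle (𝓡 n) X) : TangentBundle (𝓡 n) X :=
  if h : ∃ γ : ℝ → X, g.IsGeodesic γ ∧ velocity γ 0 = q then velocity h.choose t else q

end SmoothMetric

/-! ### Obstacles -/

/-- `f` is a local defining function at `x` of a set `Ω` with smooth boundary: near `x` it is
smooth and `Ω` is the sublevel set `{f ≤ 0}`, with `f x = 0` and `df_x ≠ 0`. -/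
def IsLocalDefiningFunction {n : ℕ} {X : Type*} [TopologicalSpace X]
    [ChartedSpace (EuclideanSpace ℝ (Fin n)) X] (Ω : Set X) (x : X) (f : X → ℝ) : Prop :=
  f x = 0 ∧ mfderiv (𝓡 n) 𝓘(ℝ, ℝ) f x ≠ 0 ∧
  ∃ U : Set X, IsOpen U ∧ x ∈ U ∧ ContMDiffOn (𝓡 n) 𝓘(ℝ, ℝ) ∞ f U ∧
    ∀ y ∈ U, y ∈ Ω ↔ f y ≤ 0

/-- `Ω` is a closed subset of `X` which is an `n`-dimensional smooth submanifold with boundary.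
Its manifold boundary is then its topological frontier, and its manifold interior is its
topological interior. -/
def IsObstacle (n : ℕ) {X : Type*} [TopologicalSpace X]
    [ChartedSpace (EuclideanSpace ℝ (Fin n)) X] (Ω : Set X) : Prop :=
  IsClosed Ω ∧ ∀ x ∈ frontier Ω, ∃ f : X → ℝ, IsLocalDefiningFunction (n := n) Ω x f

/-- A geodesic billiard system on the `n`-dimensional manifold `X`. -/
structure GeodesicBilliard (n : ℕ) (X : Type*) [TopologicalSpace X]
    [ChartedSpace (EuclideanSpace ℝ (Fin n)) X] [IsManifold (𝓡 n) ∞ X] where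
  /-- the Riemannian metric -/
  g : SmoothMetric n X
  /-- the metric is complete -/
  complete : g.IsComplete
  /-- the union of all obstacles -/
  Ω : Set X
  /-- the obstacles form a closed submanifold with boundary of full dimension -/
  obstacle : IsObstacle n Ω

/-- The differential of a real function at `x`, with values in `ℝ`. -/
def differential {n : ℕ} {X : Type*} [TopologicalSpace X]
    [ChartedSpace (EuclideanSpace ℝ (Fin n)) X] (f : X → ℝ) (x : X)
    (w : TangentSpace (𝓡 n) x) : ℝ :=
  mfderiv (𝓡 n) 𝓘(ℝ, ℝ) f x w

namespace GeodesicBilliard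

section

variable {n : ℕ} {X : Type*} [TopologicalSpace X]
  [ChartedSpace (EuclideanSpace ℝ (Fin n)) X] [IsManifold (𝓡 n) ∞ X]

/-- `ν` is the inward unit normal at the boundary point `x`: it has unit length, is orthogonal
to the tangent space `ker df_x` of the boundary, and points into `Ω = {f ≤ 0}`. -/
def IsInwardUnitNormal (B : GeodesicBilliard n X) (x : X) (ν : TangentSpace (𝓡 n) x) : Prop :=
  B.g.inner x ν ν = 1 ∧
  ∃ f : X → ℝ, IsLocalDefiningFunction (n := n) B.Ω x f ∧
    (∀ w : TangentSpace (𝓡 n) x, differential f x w = 0 → B.g.inner x ν w = 0) ∧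
    differential f x ν < 0

open Classical in
/-- The inward unit normal at `x ∈ ∂Ω` (and `0` at all other points). -/
def normal (B : GeodesicBilliard n X) (x : X) : TangentSpace (𝓡 n) x :=
  if h : ∃ ν, B.IsInwardUnitNormal x ν then h.choose else 0

/-- The inward normal component `g_x(v, n_x)` of `q = (x, v)`. -/
def normalComponent (B : GeodesicBilliard n X) (q : TangentBundle (𝓡 n) X) : ℝ :=
  B.g.inner q.1 q.2 (B.normal q.1)

/-- The phase space `M`: unit tangent vectors over the complement of the interior of `Ω`. -/
def phaseSpace (B : GeodesicBilliard n X) : Set (TangentBundle (𝓡 n) X) :=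
  {q | B.g.inner q.1 q.2 q.2 = 1 ∧ q.1 ∉ interior B.Ω}

/-- The interior of `M`: unit tangent vectors over the complement of `Ω`. -/
def interiorPhase (B : GeodesicBilliard n X) : Set (TangentBundle (𝓡 n) X) :=
  {q | B.g.inner q.1 q.2 q.2 = 1 ∧ q.1 ∉ B.Ω}

/-- The boundary `∂M`: unit tangent vectors over `∂Ω`. -/
def boundaryPhase (B : GeodesicBilliard n X) : Set (TangentBundle (𝓡 n) X) :=
  {q | B.g.inner q.1 q.2 q.2 = 1 ∧ q.1 ∈ frontier B.Ω}

/-- The grazing boundary: unit vectors over `∂Ω` tangent to `∂Ω`. -/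
def grazing (B : GeodesicBilliard n X) : Set (TangentBundle (𝓡 n) X) :=
  {q | q ∈ B.boundaryPhase ∧ B.normalComponent q = 0}

/-- `M` without the grazing boundary: the space on which the billiard flow lives. -/
def nonGrazing (B : GeodesicBilliard n X) : Set (TangentBundle (𝓡 n) X) :=
  B.phaseSpace \ B.grazing

/-- The tangential reflection `(x, v) ↦ (x, v')`, `v' = v - 2 g(v, n_x) n_x`. -/
def reflect (B : GeodesicBilliard n X) (q : TangentBundle (𝓡 n) X) : TangentBundle (𝓡 n) X :=
  ⟨q.1, q.2 - (2 * B.normalComponent q) • B.normal q.1⟩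

/-! Below, `ε = 1` describes the motion in forward time and `ε = -1` the motion in backward time;
the elapsed time `s` is always nonnegative, so that the true time is `ε * s`. -/

open Classical in
/-- The vector from which the geodesic motion in time direction `ε` starts. A boundary vector is
first reflected if the geodesic motion in this time direction would enter `Ω`, that is, if the
vector is inward and `ε = 1`, or if it is outward and `ε = -1`. -/
def depart (B : GeodesicBilliard n X) (ε : ℝ) (q : TangentBundle (𝓡 n) X) :
    TangentBundle (𝓡 n) X :=
  if q ∈ B.boundaryPhase ∧ 0 < ε * B.normalComponent q then B.reflect q else q

/-- The time elapsed until the obstacle is hit for the first time: this is `t₊` for `ε = 1`, and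
`-t₋` for `ε = -1`. -/
def hitTime (B : GeodesicBilliard n X) (ε : ℝ) (q : TangentBundle (𝓡 n) X) : ℝ≥0∞ :=
  ⨅ (s : ℝ) (_ : 0 < s ∧ (B.g.geodesicFlow (ε * s) (B.depart ε q)).1 ∈ B.Ω), ENNReal.ofReal s

/-- The vector with which the obstacle is hit for the first time, if it is hit. -/
def hitPoint (B : GeodesicBilliard n X) (ε : ℝ) (q : TangentBundle (𝓡 n) X) :
    TangentBundle (𝓡 n) X :=
  B.g.geodesicFlow (ε * (B.hitTime ε q).toReal) (B.depart ε q)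

/-- The obstacle is hit, and it is hit in a non-grazing way. -/
def Bounces (B : GeodesicBilliard n X) (ε : ℝ) (q : TangentBundle (𝓡 n) X) : Prop :=
  B.hitTime ε q ≠ ⊤ ∧ B.hitPoint ε q ∉ B.grazing

open Classical in
/-- The time elapsed until the collision number `k + 1`, or until the last collision if the
motion has fewer collisions because it escapes (the value is then `∞`) or grazes. -/
def collisionTime (B : GeodesicBilliard n X) (ε : ℝ) : ℕ → TangentBundle (𝓡 n) X → ℝ≥0∞
  | 0, q => B.hitTime ε q
  | k + 1, q =>
      if B.Bounces ε q then B.hitTime ε q + collisionTime B ε k (B.hitPoint ε q)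
      else B.hitTime ε q

/-- The maximal existence time: `T_max` for `ε = 1`, and `-T_min` for `ε = -1`. -/
def maxTime (B : GeodesicBilliard n X) (ε : ℝ) (q : TangentBundle (𝓡 n) X) : ℝ≥0∞ :=
  ⨆ k : ℕ, B.collisionTime ε k q

open Classical in
/-- The position after elapsed time `s > 0`, allowing for at most `k` reflections. At a collision
time it is the incoming vector, before the reflection. -/
def advance (B : GeodesicBilliard n X) (ε : ℝ) :
    ℕ → TangentBundle (𝓡 n) X → ℝ → TangentBundle (𝓡 n) X
  | 0, q, s => B.g.geodesicFlow (ε * s) (B.depart ε q)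
  | k + 1, q, s =>
      if ENNReal.ofReal s ≤ B.hitTime ε q then B.g.geodesicFlow (ε * s) (B.depart ε q)
      else advance B ε k (B.hitPoint ε q) (s - (B.hitTime ε q).toReal)

/-- The number of reflections needed to reach the elapsed time `s`. -/
def reflectionsBefore (B : GeodesicBilliard n X) (ε : ℝ) (q : TangentBundle (𝓡 n) X) (s : ℝ) :
    ℕ :=
  sInf {k : ℕ | ENNReal.ofReal s ≤ B.collisionTime ε k q}

/-- The domain `D` of the non-grazing billiard flow: `T_min < t < T_max`. -/
def flowDomain (B : GeodesicBilliard n X) : Set (ℝ × TangentBundle (𝓡 n) X) :=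
  {p | p.2 ∈ B.nonGrazing ∧ ENNReal.ofReal p.1 < B.maxTime 1 p.2 ∧
    ENNReal.ofReal (-p.1) < B.maxTime (-1) p.2}

/-- The non-grazing billiard flow. -/
def flow (B : GeodesicBilliard n X) (t : ℝ) (q : TangentBundle (𝓡 n) X) :
    TangentBundle (𝓡 n) X :=
  if t = 0 then q
  else if 0 < t then B.advance 1 (B.reflectionsBefore 1 q t) q t
  else B.advance (-1) (B.reflectionsBefore (-1) q (-t)) q (-t)

/-- The trapped set `K` of the billiard flow. -/
def trapped (B : GeodesicBilliard n X) : Set (TangentBundle (𝓡 n) X) :=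
  PartialFlow.trappedSet B.nonGrazing B.flowDomain B.flow

/-- The domain `(id × π)(D)` of a model flow. -/
def modelDomain (B : GeodesicBilliard n X) {N : Type*} (π : TangentBundle (𝓡 n) X → N) :
    Set (ℝ × N) :=
  (fun p : ℝ × TangentBundle (𝓡 n) X => (p.1, π p.2)) '' B.flowDomain

/-- `(N, π, φ)` is a smooth model for the non-grazing billiard flow. Only the values of `π` on
`B.nonGrazing` and the values of `φ` on `B.modelDomain π` are meaningful. Smoothness of `π` on
the submanifold with boundary `B.nonGrazing` of the tangent bundle is smoothness on this set. -/
structure IsSmoothModel (B : GeodesicBilliard n X) {m : ℕ} {N : Type*} [TopologicalSpace N]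
    [ChartedSpace (EuclideanSpace ℝ (Fin m)) N]
    (π : TangentBundle (𝓡 n) X → N) (φ : ℝ → N → N) : Prop where
  smooth_proj : ContMDiffOn (𝓡 n).tangent (𝓡 m) ∞ π B.nonGrazing
  surjective : π '' B.nonGrazing = Set.univ
  isOpen_domain : IsOpen (B.modelDomain π)
  smooth_flow : ContMDiffOn (𝓘(ℝ, ℝ).prod (𝓡 m)) (𝓡 m) ∞ (fun p : ℝ × N => φ p.1 p.2)
    (B.modelDomain π)
  flow_zero : ∀ p : N, φ 0 p = p
  flow_add : ∀ (s t : ℝ) (p : N), (s, p) ∈ B.modelDomain π → (t, φ s p) ∈ B.modelDomain π →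
    (t + s, p) ∈ B.modelDomain π → φ t (φ s p) = φ (t + s) p
  /-- `π` restricts to a diffeomorphism from the interior of `M` onto an open subset of `N`. -/
  isOpen_image : IsOpen (π '' B.interiorPhase)
  diffeo : ∃ σ : N → TangentBundle (𝓡 n) X,
    ContMDiffOn (𝓡 m) (𝓡 n).tangent ∞ σ (π '' B.interiorPhase) ∧
    ∀ q ∈ B.interiorPhase, σ (π q) = q
  /-- `π` intertwines the billiard flow and the model flow. -/
  intertwines : ∀ (t : ℝ) (q : TangentBundle (𝓡 n) X), (t, q) ∈ B.flowDomain →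
    φ t (π q) = π (B.flow t q)

/-- The trapped set of a model flow. -/
def modelTrapped (B : GeodesicBilliard n X) {N : Type*} [TopologicalSpace N]
    (π : TangentBundle (𝓡 n) X → N) (φ : ℝ → N → N) : Set N :=
  PartialFlow.trappedSet Set.univ (B.modelDomain π) φ

end

end GeodesicBilliard

end

/-! The fibres of `π` are controlled by the departing vectors. For a short positive time the
billiard flow is the geodesic flow of the departing vector and runs in the interior, where `π` is
injective. If `π q = π r`, intertwining makes the two trajectories agree at such a time, and the
geodesic flow carries the equality back to time zero (`depart_eq`). So a fibre consists at most of a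
boundary vector and its reflection. Since the forward departing vector determines the backward one,
existence times and positions at nonzero times are constant on fibres.

The billiard is reversible up to this ambiguity: following a trajectory for a time `s` shifts the
existence times in the two directions by `s`, in opposite senses. This is the relation `Reaches`,
proved by induction over the collisions. It shows that periodic trajectories exist for all times.

A boundary vector reached in positive time is inward, one reached in negative time is outward. A
lift of a periodic point of the model may therefore return only to its reflection, but the vector
reached after one period is itself periodic (`exists_isPeriod`). Conversely, a closed billiard
trajectory, run in both time directions, contains every fibre that it meets (`mem_trajectory`), so
its projection determines it.

For the trapped sets, `π` must be proper (`exists_nhds_isCompact`). Near interior points this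
follows from the diffeomorphism. A boundary point is pushed by the flow for a short time into the
interior. Vectors close to the point reached there run backward transversally to the boundary,
Rolle's theorem excludes a second collision, and what they reach lies in a compact set of
transversal, hence non-grazing, vectors. This needs joint continuity of the geodesic flow, which is
obtained from the Picard–Lindelöf theorem in charts. -/

noncomputable section

/-! ### Coordinates and topology of the tangent bundle. -/

namespace TangentBundle

variable {n : ℕ} {X : Type*} [TopologicalSpace X] [ChartedSpace (EuclideanSpace ℝ (Fin n)) X]

/-- Coordinates on the tangent bundle over the domain of the chart at `x₀`. -/
def coord (x₀ : X) (q : TangentBundle (𝓡 n) X) :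
    EuclideanSpace ℝ (Fin n) × EuclideanSpace ℝ (Fin n) :=
  (extChartAt (𝓡 n) x₀ q.1, mfderiv (𝓡 n) (𝓡 n) (extChartAt (𝓡 n) x₀) q.1 q.2)

/-- The tangent vector with given coordinates in the chart at `x₀`. -/
def ofCoord (x₀ : X) (z : EuclideanSpace ℝ (Fin n) × EuclideanSpace ℝ (Fin n)) :
    TangentBundle (𝓡 n) X :=
  ⟨(extChartAt (𝓡 n) x₀).symm z.1, mfderiv (𝓡 n) (𝓡 n) (extChartAt (𝓡 n) x₀).symm z.1 z.2⟩

variable [IsManifold (𝓡 n) ∞ X]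

theorem coord_ofCoord {x₀ : X} {z : EuclideanSpace ℝ (Fin n) × EuclideanSpace ℝ (Fin n)}
    (hz : z.1 ∈ (extChartAt (𝓡 n) x₀).target) : coord x₀ (ofCoord x₀ z) = z := by
  have : IsManifold (𝓡 n) 1 X := IsManifold.of_le (n := ∞) (by norm_num)
  have h := mfderiv_extChartAt_comp_mfderivWithin_extChartAt_symm (I := 𝓡 n) hz
  have h2 := congrArg (fun L => L z.2) h
  simp only [ModelWithCorners.range_eq_univ, mfderivWithin_univ] at h2
  refine Prod.ext ((extChartAt (𝓡 n) x₀).right_inv hz) h2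

theorem ofCoord_coord {x₀ : X} {q : TangentBundle (𝓡 n) X}
    (hq : q.1 ∈ (extChartAt (𝓡 n) x₀).source) : ofCoord x₀ (coord x₀ q) = q := by
  have : IsManifold (𝓡 n) 1 X := IsManifold.of_le (n := ∞) (by norm_num)
  have h := mfderivWithin_extChartAt_symm_comp_mfderiv_extChartAt' (I := 𝓡 n) hq
  obtain ⟨x, v⟩ := q
  have h2 := congrArg (fun L => L v) h
  simp only [ModelWithCorners.range_eq_univ, mfderivWithin_univ] at h2
  have h1 : (extChartAt (𝓡 n) x₀).symm (extChartAt (𝓡 n) x₀ x) = x :=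
    (extChartAt (𝓡 n) x₀).left_inv hq
  refine Bundle.TotalSpace.ext h1 (heq_of_eq h2)

/-- The topology of the tangent bundle comes from its trivializations, whereas `SmoothMetric.coeff`
uses derivatives of charts. This identification transfers continuity and smoothness from the former
to the latter. -/
theorem coord_eq_trivialization {x₀ : X} {q : TangentBundle (𝓡 n) X}
    (hq : q.1 ∈ (extChartAt (𝓡 n) x₀).source) :
    coord x₀ q = (extChartAt (𝓡 n) x₀ q.1,
      (trivializationAt (EuclideanSpace ℝ (Fin n)) (TangentSpace (𝓡 n)) x₀ q).2) := by
  have : IsManifold (𝓡 n) 1 X := IsManifold.of_le (n := ∞) (by norm_num)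
  rw [extChartAt_source] at hq
  have h := TangentBundle.continuousLinearMapAt_trivializationAt (I := 𝓡 n) hq
  refine Prod.ext rfl ?_
  refine (congrArg (fun L : EuclideanSpace ℝ (Fin n) →L[ℝ] EuclideanSpace ℝ (Fin n) => L q.2)
    h.symm).trans ?_
  exact congrFun (Bundle.Trivialization.coe_linearMapAt_of_mem
    (trivializationAt (EuclideanSpace ℝ (Fin n)) (TangentSpace (𝓡 n)) x₀) (by simpa using hq)) q.2

theorem ofCoord_eq_trivialization {x₀ : X}
    {z : EuclideanSpace ℝ (Fin n) × EuclideanSpace ℝ (Fin n)}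
    (hz : z.1 ∈ (extChartAt (𝓡 n) x₀).target) :
    ofCoord x₀ z = (trivializationAt (EuclideanSpace ℝ (Fin n)) (TangentSpace (𝓡 n)) x₀).toOpenPartialHomeomorph.symm
      ((extChartAt (𝓡 n) x₀).symm z.1, z.2) := by
  have hs := (extChartAt (𝓡 n) x₀).map_target hz
  have hs' : (ofCoord x₀ z).1 ∈ (extChartAt (𝓡 n) x₀).source := hs
  have h1 := coord_eq_trivialization hs'
  rw [coord_ofCoord hz] at h1
  have h2 : (trivializationAt (EuclideanSpace ℝ (Fin n)) (TangentSpace (𝓡 n)) x₀) (ofCoord x₀ z)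
      = ((extChartAt (𝓡 n) x₀).symm z.1, z.2) :=
    Prod.ext (TangentBundle.trivializationAt_fst x₀ _) (congrArg Prod.snd h1).symm
  rw [← h2]
  refine (OpenPartialHomeomorph.left_inv _ ?_).symm
  rw [extChartAt_source] at hs'
  exact (Bundle.Trivialization.mem_source _).2 (by simpa using hs')

theorem isOpen_preimage_source (x₀ : X) :
    IsOpen {q : TangentBundle (𝓡 n) X | q.1 ∈ (extChartAt (𝓡 n) x₀).source} :=
  (isOpen_extChartAt_source x₀).preimage (FiberBundle.continuous_proj _ _)

theorem continuous_proj : Continuous fun q : TangentBundle (𝓡 n) X => q.1 :=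
  FiberBundle.continuous_proj _ _

theorem continuousOn_coord (x₀ : X) :
    ContinuousOn (coord x₀) {q : TangentBundle (𝓡 n) X | q.1 ∈ (extChartAt (𝓡 n) x₀).source} := by
  refine ContinuousOn.congr ?_ fun q hq => coord_eq_trivialization hq
  refine ContinuousOn.prodMk ?_ ?_
  · exact (continuousOn_extChartAt x₀).comp continuous_proj.continuousOn fun q hq => hq
  · refine continuous_snd.comp_continuousOn ((Bundle.Trivialization.continuousOn _).mono ?_)
    intro q hq
    have hq' : q.1 ∈ (extChartAt (𝓡 n) x₀).source := hq
    rw [extChartAt_source] at hq'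
    exact (Bundle.Trivialization.mem_source _).2 (by simpa using hq')

theorem contMDiffOn_ofCoord (x₀ : X) (a : EuclideanSpace ℝ (Fin n)) :
    ContMDiffOn (𝓡 n) (𝓡 n).tangent ∞ (fun z => ofCoord x₀ (z, a))
      (extChartAt (𝓡 n) x₀).target := by
  refine ContMDiffOn.congr (f := fun z => (trivializationAt (EuclideanSpace ℝ (Fin n))
    (TangentSpace (𝓡 n)) x₀).toOpenPartialHomeomorph.symm ((extChartAt (𝓡 n) x₀).symm z, a)) ?_
    fun z hz => ofCoord_eq_trivialization hz
  have : ContMDiffVectorBundle ∞ (EuclideanSpace ℝ (Fin n)) (TangentSpace (𝓡 n) : X → Type _)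
    (𝓡 n) := inferInstance
  refine ((trivializationAt (EuclideanSpace ℝ (Fin n))
    (TangentSpace (𝓡 n)) x₀).contMDiffOn_symm (IB := 𝓡 n) (n := ∞)).comp
    (ContMDiffOn.prodMk (contMDiffOn_extChartAt_symm x₀) contMDiffOn_const) ?_
  intro z hz
  have := (extChartAt (𝓡 n) x₀).map_target hz
  rw [extChartAt_source] at this
  exact (Bundle.Trivialization.mem_target (trivializationAt (EuclideanSpace ℝ (Fin n))
    (TangentSpace (𝓡 n)) x₀)).2 (by simpa using this)

theorem continuousOn_ofCoord (x₀ : X) :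
    ContinuousOn (ofCoord x₀) {z | z.1 ∈ (extChartAt (𝓡 n) x₀).target} := by
  refine ContinuousOn.congr ?_ fun z hz => ofCoord_eq_trivialization hz
  refine (OpenPartialHomeomorph.continuousOn_symm _).comp
    (((continuousOn_extChartAt_symm x₀).comp continuousOn_fst fun z hz => hz).prodMk
      continuousOn_snd) ?_
  intro z hz
  have := (extChartAt (𝓡 n) x₀).map_target hz
  rw [extChartAt_source] at this
  exact (Bundle.Trivialization.mem_target _).2 (by simpa using this)

/-- Vectors over different points are separated in the base, vectors over the same point in the
coordinates of one chart. -/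
theorem t2Space [T2Space X] : T2Space (TangentBundle (𝓡 n) X) := by
  refine ⟨fun q r hqr => ?_⟩
  by_cases h : q.1 = r.1
  · have hq : q.1 ∈ (extChartAt (𝓡 n) q.1).source := mem_extChartAt_source q.1
    have hr : r.1 ∈ (extChartAt (𝓡 n) q.1).source := h ▸ hq
    have hne : coord q.1 q ≠ coord q.1 r := fun he => hqr <| by
      rw [← ofCoord_coord hq, he, ofCoord_coord hr]
    obtain ⟨u, v, hu, hv, hqu, hrv, huv⟩ := t2_separation hne
    have ho := isOpen_preimage_source (n := n) q.1
    refine ⟨_, _, (continuousOn_coord q.1).isOpen_inter_preimage ho hu,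
      (continuousOn_coord q.1).isOpen_inter_preimage ho hv, ⟨hq, hqu⟩, ⟨hr, hrv⟩, ?_⟩
    exact (huv.preimage (coord q.1)).mono Set.inter_subset_right Set.inter_subset_right
  · obtain ⟨u, v, hu, hv, hqu, hrv, huv⟩ := t2_separation h
    exact ⟨_, _, hu.preimage continuous_proj, hv.preimage continuous_proj, hqu, hrv,
      huv.preimage _⟩

end TangentBundle

/-! ### The metric in a chart. -/

namespace SmoothMetric

variable {n : ℕ} {X : Type*} [TopologicalSpace X] [ChartedSpace (EuclideanSpace ℝ (Fin n)) X]
  [IsManifold (𝓡 n) ∞ X] (g : SmoothMetric n X)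

/-- The metric in the chart around `x₀`, as a bilinear form depending on the coordinates. -/
def gram (x₀ : X) (z : EuclideanSpace ℝ (Fin n)) :
    EuclideanSpace ℝ (Fin n) →L[ℝ] EuclideanSpace ℝ (Fin n) →L[ℝ] ℝ :=
  let S : EuclideanSpace ℝ (Fin n) →L[ℝ] EuclideanSpace ℝ (Fin n) →L[ℝ] ℝ :=
    g.inner ((extChartAt (𝓡 n) x₀).symm z)
  let D : EuclideanSpace ℝ (Fin n) →L[ℝ] EuclideanSpace ℝ (Fin n) :=
    mfderiv (𝓡 n) (𝓡 n) (extChartAt (𝓡 n) x₀).symm z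
  S.bilinearComp D D

theorem gram_apply (x₀ : X) (z a b : EuclideanSpace ℝ (Fin n)) :
    g.gram x₀ z a b = g.coeff x₀ z a b := rfl

theorem coeff_eq_inner_ofCoord (x₀ : X) (z a b : EuclideanSpace ℝ (Fin n)) :
    g.coeff x₀ z a b = g.inner _ (TangentBundle.ofCoord x₀ (z, a)).2
      (TangentBundle.ofCoord x₀ (z, b)).2 := rfl

theorem gram_symm (x₀ : X) (z a b : EuclideanSpace ℝ (Fin n)) :
    g.gram x₀ z a b = g.gram x₀ z b a := g.symm _ _ _

/-- Each entry is the smooth metric evaluated on two vector fields that are constant in the chart,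
hence smooth. -/
theorem contDiffOn_gram (x₀ : X) : ContDiffOn ℝ ∞ (g.gram x₀) (extChartAt (𝓡 n) x₀).target := by
  rw [contDiffOn_clm_apply]
  intro a
  rw [contDiffOn_clm_apply]
  intro b
  rw [← contMDiffOn_iff_contDiffOn]
  have h := ContMDiffOn.clm_bundle_apply₂ (n := ∞) (IM := 𝓡 n) (IB := 𝓡 n)
    (E₁ := fun x : X => TangentSpace (𝓡 n) x) (E₂ := fun x : X => TangentSpace (𝓡 n) x)
    (E₃ := fun _ : X => ℝ) (F₃ := ℝ)
    (s := (extChartAt (𝓡 n) x₀).target)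
    (b := fun z => (extChartAt (𝓡 n) x₀).symm z)
    (ψ := fun z => g.inner ((extChartAt (𝓡 n) x₀).symm z))
    (v := fun z => (TangentBundle.ofCoord x₀ (z, a)).2)
    (w := fun z => (TangentBundle.ofCoord x₀ (z, b)).2)
    (g.contMDiff.comp_contMDiffOn (contMDiffOn_extChartAt_symm x₀))
    (TangentBundle.contMDiffOn_ofCoord x₀ a) (TangentBundle.contMDiffOn_ofCoord x₀ b)
  intro z hz
  exact (Bundle.contMDiffWithinAt_totalSpace.1 (h z hz)).2

theorem inner_eq_gram {x₀ : X} {q : TangentBundle (𝓡 n) X}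
    (hq : q.1 ∈ (extChartAt (𝓡 n) x₀).source) :
    g.inner q.1 q.2 q.2 = g.gram x₀ (TangentBundle.coord x₀ q).1 (TangentBundle.coord x₀ q).2
      (TangentBundle.coord x₀ q).2 := by
  rw [gram_apply, coeff_eq_inner_ofCoord, Prod.mk.eta]
  rw [TangentBundle.ofCoord_coord hq]

theorem gram_pos {x₀ : X} {z a : EuclideanSpace ℝ (Fin n)}
    (hz : z ∈ (extChartAt (𝓡 n) x₀).target) (ha : a ≠ 0) : 0 < g.gram x₀ z a a := by
  refine g.pos _ _ fun h => ha ?_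
  have h2 := TangentBundle.coord_ofCoord (x₀ := x₀) (z := (z, a)) hz
  have h3 : (TangentBundle.coord x₀ (TangentBundle.ofCoord x₀ (z, a))).2
    = mfderiv (𝓡 n) (𝓡 n) (extChartAt (𝓡 n) x₀) _
      (mfderiv (𝓡 n) (𝓡 n) (extChartAt (𝓡 n) x₀).symm z a) := rfl
  rw [h2] at h3
  exact h3.trans ((congrArg (mfderiv (𝓡 n) (𝓡 n) (extChartAt (𝓡 n) x₀) _) h).trans (map_zero _))

end SmoothMetric

end

noncomputable section

set_option maxSynthPendingDepth 3

theorem one_add_one_le_infty : (1 : WithTop ℕ∞) + 1 ≤ ((⊤ : ℕ∞) : WithTop ℕ∞) := by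
  rw [one_add_one_eq_two]
  exact WithTop.coe_le_coe.2 le_top

/-! ### The geodesic equation on a normed space -/

namespace GeodesicEquation

variable {E : Type*} [NormedAddCommGroup E] [NormedSpace ℝ E]

/-- The covector `w ↦ (∂_v G)(v, w) - (1/2) (∂_w G)(v, v)` at the point `z`. -/
def force (G : E → E →L[ℝ] E →L[ℝ] ℝ) (z v : E) : E →L[ℝ] ℝ :=
  fderiv ℝ G z v v - (1 / 2 : ℝ) • ((fderiv ℝ G z).flip v).flip v

theorem force_apply (G : E → E →L[ℝ] E →L[ℝ] ℝ) (z v w : E) :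
    force G z v w = fderiv ℝ G z v v w - (1 / 2 : ℝ) * fderiv ℝ G z w v v := rfl

/-- The geodesic vector field of the metric `G`. -/
def spray (G : E → E →L[ℝ] E →L[ℝ] ℝ) (p : E × E) : E × E :=
  (p.2, -(G p.1).inverse (force G p.1 p.2))

theorem fderiv_apply_apply {G : E → E →L[ℝ] E →L[ℝ] ℝ} {z : E} (hG : DifferentiableAt ℝ G z)
    (a b w : E) : fderiv ℝ (fun z => G z a b) z w = fderiv ℝ G z w a b := by
  have h := (hG.hasFDerivAt.clm_apply (hasFDerivAt_const a z)).clm_apply (hasFDerivAt_const b z)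
  rw [h.fderiv]
  simp

variable [FiniteDimensional ℝ E]

/-- Positivity gives injectivity, and a finite-dimensional space has the dimension of its dual. This
solves the geodesic equation for the acceleration and later produces gradients. -/
theorem exists_equiv {G : E →L[ℝ] E →L[ℝ] ℝ} (hG : ∀ a, a ≠ 0 → 0 < G a a) :
    ∃ e : E ≃L[ℝ] (E →L[ℝ] ℝ), (e : E →L[ℝ] E →L[ℝ] ℝ) = G := by
  have hinj : Function.Injective G.toLinearMap := by
    rw [← LinearMap.ker_eq_bot, LinearMap.ker_eq_bot']
    intro a ha
    by_contra hne
    have := hG a hne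
    have h2 : G a = 0 := ha
    rw [h2] at this
    exact lt_irrefl _ this
  have hdim : Module.finrank ℝ E = Module.finrank ℝ (E →L[ℝ] ℝ) := by
    rw [← (LinearMap.toContinuousLinearMap (𝕜 := ℝ) (E := E) (F' := ℝ)).finrank_eq]
    exact (Subspace.dual_finrank_eq (K := ℝ) (V := E)).symm
  refine ⟨(LinearMap.linearEquivOfInjective _ hinj hdim).toContinuousLinearEquiv, ?_⟩
  ext a b
  rfl

/-- Inversion of operators is smooth at invertible ones, and the force involves one derivative of
the metric. Order one is all that Picard–Lindelöf requires. -/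
theorem contDiffOn_spray {G : E → E →L[ℝ] E →L[ℝ] ℝ} {s : Set E} (hs : IsOpen s)
    (hG : ContDiffOn ℝ ∞ G s) (hpos : ∀ z ∈ s, ∀ a, a ≠ 0 → 0 < G z a a) :
    ContDiffOn ℝ 1 (spray G) {p | p.1 ∈ s} := by
  have : CompleteSpace E := FiniteDimensional.complete ℝ E
  have hG1 : ContDiffOn ℝ 1 (fun p : E × E => G p.1) {p | p.1 ∈ s} :=
    (hG.of_le (by norm_num)).comp contDiffOn_fst fun p hp => hp
  have hD : ContDiffOn ℝ 1 (fun p : E × E => fderiv ℝ G p.1) {p | p.1 ∈ s} :=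
    ((hG.fderiv_of_isOpen hs (m := 1) one_add_one_le_infty)).comp contDiffOn_fst fun p hp => hp
  have hv : ContDiffOn ℝ 1 (fun p : E × E => p.2) {p | p.1 ∈ s} := contDiffOn_snd
  refine hv.prodMk (ContDiffOn.neg (ContDiffOn.clm_apply ?_ ?_))
  · intro p hp
    obtain ⟨e, he⟩ := exists_equiv (hpos p.1 hp)
    have h := contDiffAt_map_inverse (𝕜 := ℝ) (n := 1) e
    rw [he] at h
    exact h.comp_contDiffWithinAt (f := fun p : E × E => G p.1) p (hG1 p hp)
  · rw [contDiffOn_clm_apply]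
    intro w
    simp only [force_apply]
    exact (((hD.clm_apply hv).clm_apply hv).clm_apply contDiffOn_const).sub
      (contDiffOn_const.mul (((hD.clm_apply contDiffOn_const).clm_apply hv).clm_apply hv))

theorem eq_neg_inverse_force {G : E → E →L[ℝ] E →L[ℝ] ℝ} {z v a : E}
    (hpos : ∀ a, a ≠ 0 → 0 < G z a a) (h : ∀ w, G z a w + force G z v w = 0) :
    a = -(G z).inverse (force G z v) := by
  obtain ⟨e, he⟩ := exists_equiv hpos
  have h3 : G z a = -force G z v := by
    ext w
    have := h w
    rw [neg_apply]
    linarith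
  rw [← he] at h3 ⊢
  rw [ContinuousLinearMap.inverse_equiv, ← map_neg, ← h3]
  simp

omit [FiniteDimensional ℝ E] in
-- By symmetry of the metric, the derivative of the squared speed is twice the geodesic equation
-- tested on the velocity itself.
theorem hasDerivAt_speed {G : E → E →L[ℝ] E →L[ℝ] ℝ} {c v : ℝ → E} {a : E} {t : ℝ}
    (hG : DifferentiableAt ℝ G (c t)) (hsymm : ∀ a b, G (c t) a b = G (c t) b a)
    (hc : HasDerivAt c (v t) t) (hv : HasDerivAt v a t)
    (h : ∀ w, G (c t) a w + force G (c t) (v t) w = 0) :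
    HasDerivAt (fun s => G (c s) (v s) (v s)) 0 t := by
  have h1 := ((hG.hasFDerivAt.comp_hasDerivAt t hc).clm_apply hv).clm_apply hv
  refine h1.congr_deriv ?_
  have h2 := h (v t)
  rw [force_apply] at h2
  have h3 := hsymm (v t) a
  simp only [Function.comp_apply, add_apply] at h2 h3 ⊢
  linarith

end GeodesicEquation

/-! ### Geodesics in charts -/

namespace SmoothMetric

variable {n : ℕ} {X : Type*} [TopologicalSpace X] [ChartedSpace (EuclideanSpace ℝ (Fin n)) X]
  [IsManifold (𝓡 n) ∞ X] (g : SmoothMetric n X)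

theorem contDiffOn_spray (x₀ : X) :
    ContDiffOn ℝ 1 (GeodesicEquation.spray (g.gram x₀))
      {p | p.1 ∈ (extChartAt (𝓡 n) x₀).target} :=
  GeodesicEquation.contDiffOn_spray (isOpen_extChartAt_target x₀) (g.contDiffOn_gram x₀)
    fun _ hz _ ha => g.gram_pos hz ha

theorem differentiableAt_gram {x₀ : X} {z : EuclideanSpace ℝ (Fin n)}
    (hz : z ∈ (extChartAt (𝓡 n) x₀).target) : DifferentiableAt ℝ (g.gram x₀) z :=
  ((g.contDiffOn_gram x₀).contDiffAt ((isOpen_extChartAt_target x₀).mem_nhds hz)).differentiableAt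
    (by norm_num)

theorem hasDerivAt_chart {γ : ℝ → X} {t : ℝ} (hγ : MDifferentiableAt 𝓘(ℝ, ℝ) (𝓡 n) γ t) {x₀ : X}
    (h : γ t ∈ (extChartAt (𝓡 n) x₀).source) :
    HasDerivAt (F := EuclideanSpace ℝ (Fin n)) (fun s => extChartAt (𝓡 n) x₀ (γ s)) (TangentBundle.coord x₀ (velocity γ t)).2 t := by
  have : IsManifold (𝓡 n) 1 X := IsManifold.of_le (n := ∞) (by norm_num)
  rw [extChartAt_source] at h
  have h1 := (mdifferentiableAt_extChartAt (I := 𝓡 n) h).hasMFDerivAt.comp t hγ.hasMFDerivAt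
  -- The tangent spaces are the model spaces only by definitional unfolding, so the composite is
  -- given the plain type before the manifold derivative is read as a Fréchet derivative.
  obtain ⟨L, hL⟩ : ∃ L : ℝ →L[ℝ] EuclideanSpace ℝ (Fin n), L =
    (mfderiv (𝓡 n) (𝓡 n) (extChartAt (𝓡 n) x₀) (γ t)).comp (mfderiv 𝓘(ℝ, ℝ) (𝓡 n) γ t) := ⟨_, rfl⟩
  have h2 : HasFDerivAt (fun s => extChartAt (𝓡 n) x₀ (γ s)) L t := by
    rw [hL]
    exact hasMFDerivAt_iff_hasFDerivAt.1 h1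
  refine h2.hasDerivAt.congr_deriv ?_
  rw [hL]
  rfl

variable {g}

theorem IsGeodesic.mdifferentiable {γ : ℝ → X} (hγ : g.IsGeodesic γ) (t : ℝ) :
    MDifferentiableAt 𝓘(ℝ, ℝ) (𝓡 n) γ t :=
  (hγ.1 t).mdifferentiableAt (by norm_num)

theorem IsGeodesic.eventually_source {γ : ℝ → X} (hγ : g.IsGeodesic γ) {t : ℝ} {x₀ : X}
    (h : γ t ∈ (extChartAt (𝓡 n) x₀).source) :
    ∀ᶠ s in 𝓝 t, γ s ∈ (extChartAt (𝓡 n) x₀).source :=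
  hγ.1.continuous.continuousAt.eventually ((isOpen_extChartAt_source x₀).mem_nhds h)

theorem IsGeodesic.coord_velocity {γ : ℝ → X} (hγ : g.IsGeodesic γ) {t : ℝ} {x₀ : X}
    (h : γ t ∈ (extChartAt (𝓡 n) x₀).source) :
    TangentBundle.coord x₀ (velocity γ t) =
      (extChartAt (𝓡 n) x₀ (γ t), deriv (fun s => extChartAt (𝓡 n) x₀ (γ s)) t) :=
  Prod.ext rfl (hasDerivAt_chart (hγ.mdifferentiable t) h).deriv.symm

theorem IsGeodesic.hasDerivAt_deriv {γ : ℝ → X} (hγ : g.IsGeodesic γ) {t : ℝ} {x₀ : X}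
    (h : γ t ∈ (extChartAt (𝓡 n) x₀).source) :
    let c : ℝ → EuclideanSpace ℝ (Fin n) := fun s => extChartAt (𝓡 n) x₀ (γ s)
    HasDerivAt c (deriv c t) t ∧ HasDerivAt (deriv c) (deriv (deriv c) t) t := by
  set c : ℝ → EuclideanSpace ℝ (Fin n) := fun s => extChartAt (𝓡 n) x₀ (γ s) with hc
  have hcd : ContDiffAt ℝ ∞ c t := by
    rw [← contMDiffAt_iff_contDiffAt]
    rw [extChartAt_source] at h
    exact (contMDiffAt_extChartAt' (I := 𝓡 n) (n := ∞) h).comp t (hγ.1 t)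
  have hd1 : HasDerivAt c (deriv c t) t := (hcd.differentiableAt (by norm_num)).hasDerivAt
  have hd2 : HasDerivAt (deriv c) (deriv (deriv c) t) t := by
    have : ContDiffAt ℝ 1 (deriv c) t := hcd.derivWithin (m := 1) one_add_one_le_infty
    exact (this.differentiableAt (by norm_num)).hasDerivAt
  exact ⟨hd1, hd2⟩

theorem IsGeodesic.geodesic_equation {γ : ℝ → X} (hγ : g.IsGeodesic γ) {t : ℝ} {x₀ : X}
    (h : γ t ∈ (extChartAt (𝓡 n) x₀).source) (w : EuclideanSpace ℝ (Fin n)) :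
    let c : ℝ → EuclideanSpace ℝ (Fin n) := fun s => extChartAt (𝓡 n) x₀ (γ s)
    g.gram x₀ (c t) (deriv (deriv c) t) w
      + GeodesicEquation.force (g.gram x₀) (c t) (deriv c t) w = 0 := by
  have hG := g.differentiableAt_gram ((extChartAt (𝓡 n) x₀).map_source h)
  have heq := hγ.2 x₀ t h w
  simp only [← gram_apply, GeodesicEquation.fderiv_apply_apply hG] at heq
  intro c
  rw [GeodesicEquation.force_apply, ← add_sub_assoc]
  exact heq

/-- The second-order equation becomes a first-order autonomous one for position and velocity, to
which existence and uniqueness of solutions apply. -/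
theorem IsGeodesic.hasDerivAt_coord {γ : ℝ → X} (hγ : g.IsGeodesic γ) {t : ℝ} {x₀ : X}
    (h : γ t ∈ (extChartAt (𝓡 n) x₀).source) :
    HasDerivAt (fun s => TangentBundle.coord x₀ (velocity γ s))
      (GeodesicEquation.spray (g.gram x₀) (TangentBundle.coord x₀ (velocity γ t))) t := by
  have hz := (extChartAt (𝓡 n) x₀).map_source h
  obtain ⟨hd1, hd2⟩ := hγ.hasDerivAt_deriv h
  have hacc := GeodesicEquation.eq_neg_inverse_force (fun a ha => g.gram_pos hz ha)
    (hγ.geodesic_equation h)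
  rw [hγ.coord_velocity h]
  refine HasDerivAt.congr_of_eventuallyEq ((hd1.prodMk hd2).congr_deriv (Prod.ext rfl hacc)) ?_
  filter_upwards [hγ.eventually_source h] with s hs
  exact hγ.coord_velocity hs

theorem IsGeodesic.continuous_velocity {γ : ℝ → X} (hγ : g.IsGeodesic γ) :
    Continuous (velocity (n := n) γ) := by
  rw [continuous_iff_continuousAt]
  intro t
  have h : γ t ∈ (extChartAt (𝓡 n) (γ t)).source := mem_extChartAt_source _
  have hz : (TangentBundle.coord (γ t) (velocity γ t)).1 ∈ (extChartAt (𝓡 n) (γ t)).target :=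
    (extChartAt (𝓡 n) (γ t)).map_source h
  have h1 : ContinuousAt (TangentBundle.ofCoord (γ t)) (TangentBundle.coord (γ t) (velocity γ t)) :=
    (TangentBundle.continuousOn_ofCoord (γ t)).continuousAt
      (((isOpen_extChartAt_target (γ t)).preimage continuous_fst).mem_nhds hz)
  have h2 := h1.comp (f := fun s => TangentBundle.coord (γ t) (velocity γ s))
    (hγ.hasDerivAt_coord h).continuousAt
  refine h2.congr ?_
  filter_upwards [hγ.eventually_source h] with s hs
  exact TangentBundle.ofCoord_coord (q := velocity γ s) hs

theorem IsGeodesic.velocity_comp_add {γ : ℝ → X} (hγ : g.IsGeodesic γ) (a t : ℝ) :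
    velocity (n := n) (fun s => γ (s + a)) t = velocity γ (t + a) := by
  have h1 : HasMFDerivAt 𝓘(ℝ, ℝ) 𝓘(ℝ, ℝ) (fun s : ℝ => s + a) t (ContinuousLinearMap.id ℝ ℝ) :=
    ((hasFDerivAt_id t).add_const a).hasMFDerivAt
  have h2 := (hγ.mdifferentiable (t + a)).hasMFDerivAt.comp t h1
  exact congrArg (Bundle.TotalSpace.mk (γ (t + a)))
    (congrArg (fun L => L (1 : ℝ)) h2.mfderiv)

theorem IsGeodesic.comp_add {γ : ℝ → X} (hγ : g.IsGeodesic γ) (a : ℝ) :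
    g.IsGeodesic fun s => γ (s + a) := by
  refine ⟨hγ.1.comp (contDiff_id.add contDiff_const).contMDiff, fun x₀ t ht w => ?_⟩
  have := hγ.2 x₀ (t + a) ht w
  have h1 : deriv (fun s => extChartAt (𝓡 n) x₀ (γ (s + a))) =
      fun s => deriv (fun s => extChartAt (𝓡 n) x₀ (γ s)) (s + a) := by
    ext1 s
    exact deriv_comp_add_const (fun s => extChartAt (𝓡 n) x₀ (γ s)) a s
  simp only [h1, deriv_comp_add_const (deriv fun s => extChartAt (𝓡 n) x₀ (γ s))]
  exact this

/-- Geodesics have constant speed. -/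
theorem IsGeodesic.inner_velocity {γ : ℝ → X} (hγ : g.IsGeodesic γ) (t : ℝ) :
    g.inner (γ t) (velocity γ t).2 (velocity γ t).2 =
      g.inner (γ 0) (velocity γ 0).2 (velocity γ 0).2 := by
  have hd : ∀ t, HasDerivAt (fun t => g.inner (γ t) (velocity γ t).2 (velocity γ t).2) 0 t := by
    intro t
    have h : γ t ∈ (extChartAt (𝓡 n) (γ t)).source := mem_extChartAt_source _
    have hz := (extChartAt (𝓡 n) (γ t)).map_source h
    obtain ⟨hd1, hd2⟩ := hγ.hasDerivAt_deriv h
    refine (GeodesicEquation.hasDerivAt_speed (g.differentiableAt_gram hz)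
      (g.gram_symm (γ t) _) hd1 hd2 (hγ.geodesic_equation h)).congr_of_eventuallyEq ?_
    filter_upwards [hγ.eventually_source h] with s hs
    refine (g.inner_eq_gram (q := velocity γ s) hs).trans ?_
    rw [hγ.coord_velocity hs]
  exact is_const_of_deriv_eq_zero (f := fun t => g.inner (γ t) (velocity γ t).2 (velocity γ t).2)
    (fun s => (hd s).differentiableAt) (fun s => (hd s).deriv) t 0

end SmoothMetric

end

/-! ### Uniqueness of geodesics and continuity of the geodesic flow. -/

noncomputable section

set_option maxSynthPendingDepth 3

/-- The interior of the coincidence set is open, and also relatively closed: at a limit point the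
two maps agree because the target is Hausdorff, and `hloc` spreads the agreement. Connectedness
concludes. -/
theorem eqOn_of_eventually_eq {Y : Type*} [TopologicalSpace Y] [T2Space Y] {f h : ℝ → Y}
    {s : Set ℝ} (hs : IsOpen s) (hs' : IsPreconnected s) (hf : ContinuousOn f s)
    (hh : ContinuousOn h s) {t₀ : ℝ} (ht₀ : t₀ ∈ s) (h₀ : f t₀ = h t₀)
    (hloc : ∀ t ∈ s, f t = h t → ∀ᶠ r in 𝓝 t, f r = h r) : Set.EqOn f h s := by
  have hsub : s ⊆ interior {t | f t = h t} := by
    refine hs'.subset_of_closure_inter_subset isOpen_interior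
      ⟨t₀, ht₀, mem_interior_iff_mem_nhds.2 (hloc t₀ ht₀ h₀)⟩ ?_
    rintro t ⟨htc, hts⟩
    refine mem_interior_iff_mem_nhds.2 (hloc t hts ?_)
    refine tendsto_nhds_unique_of_frequently_eq (hf.continuousAt (hs.mem_nhds hts))
      (hh.continuousAt (hs.mem_nhds hts)) ?_
    exact (mem_closure_iff_frequently.1 htc).mono fun r hr =>
      interior_subset (s := {t | f t = h t}) hr
  exact fun t ht => interior_subset (s := {t | f t = h t}) (hsub ht)

namespace SmoothMetric

variable {n : ℕ} {X : Type*} [TopologicalSpace X] [ChartedSpace (EuclideanSpace ℝ (Fin n)) X]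
  [IsManifold (𝓡 n) ∞ X] {g : SmoothMetric n X}

open Set Filter

/-- Around every tangent vector, the velocity of a geodesic for short times depends continuously
on its initial velocity only. -/
theorem exists_local_flow [T2Space X] (g : SmoothMetric n X) (q₀ : TangentBundle (𝓡 n) X) :
    ∃ δ > 0, ∃ V : Set (TangentBundle (𝓡 n) X), IsOpen V ∧ q₀ ∈ V ∧
      ∃ β : ℝ × TangentBundle (𝓡 n) X → TangentBundle (𝓡 n) X,
        ContinuousOn β (Ioo (-δ) δ ×ˢ V) ∧
        ∀ γ, g.IsGeodesic γ → velocity γ 0 ∈ V → ∀ t ∈ Ioo (-δ) δ,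
          velocity γ t = β (t, velocity γ 0) := by
  have : T2Space (TangentBundle (𝓡 n) X) := TangentBundle.t2Space
  set x₀ := q₀.1
  set F := GeodesicEquation.spray (g.gram x₀) with hF
  set O : Set (EuclideanSpace ℝ (Fin n) × EuclideanSpace ℝ (Fin n)) :=
    {p | p.1 ∈ (extChartAt (𝓡 n) x₀).target} with hO
  have hOo : IsOpen O := (isOpen_extChartAt_target x₀).preimage continuous_fst
  set z₀ := TangentBundle.coord x₀ q₀
  have hz₀ : z₀ ∈ O := (extChartAt (𝓡 n) x₀).map_source (mem_extChartAt_source x₀)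
  have hFd : ContDiffAt ℝ 1 F z₀ := (g.contDiffOn_spray x₀).contDiffAt (hOo.mem_nhds hz₀)
  obtain ⟨K, S₀, hS₀, hlip₀⟩ := hFd.exists_lipschitzOnWith
  obtain ⟨S, hSS₀, hSo, hS⟩ := mem_nhds_iff.1 hS₀
  have hlip := hlip₀.mono hSS₀
  -- One time `ε` and one radius `r` serve all initial values near `z₀`, and the solution `α`
  -- depends jointly continuously on initial value and time.
  obtain ⟨ε, hε, a, r, L, K', hr, hPL⟩ := IsPicardLindelof.of_contDiffAt_one hFd
  obtain ⟨α, hα, hαc⟩ := (hPL 0).exists_forall_mem_closedBall_eq_hasDerivWithinAt_continuousOn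
  simp only [zero_sub, zero_add] at hα hαc
  have hr' : (0 : ℝ) < r := hr
  have hα0 : α (z₀, 0) = z₀ := (hα z₀ (Metric.mem_closedBall_self hr'.le)).1
  have hcα : ContinuousAt α (z₀, 0) := hαc.continuousAt
    (prod_mem_nhds (Metric.closedBall_mem_nhds _ hr') (Icc_mem_nhds (neg_lt_zero.2 hε) hε))
  -- After shrinking, solutions stay in `S`, where the spray is Lipschitz, and in `O`, where
  -- coordinates represent tangent vectors.
  have hSO : ∀ᶠ p in 𝓝 (z₀, (0 : ℝ)), α p ∈ S ∩ O :=
    hcα.eventually (by rw [hα0]; exact inter_mem (hSo.mem_nhds hS) (hOo.mem_nhds hz₀))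
  rw [nhds_prod_eq, eventually_prod_iff] at hSO
  obtain ⟨pa, hpa, pb, hpb, hpab⟩ := hSO
  obtain ⟨r₁, hr₁, hball⟩ := Metric.eventually_nhds_iff_ball.1 hpa
  obtain ⟨δ₁, hδ₁, hIoo⟩ := Metric.eventually_nhds_iff_ball.1 hpb
  rw [Real.ball_eq_Ioo, zero_sub, zero_add] at hIoo
  refine ⟨min δ₁ ε, lt_min hδ₁ hε, {q | q.1 ∈ (extChartAt (𝓡 n) x₀).source} ∩
    TangentBundle.coord x₀ ⁻¹' Metric.ball z₀ (min r₁ r),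
    (TangentBundle.continuousOn_coord x₀).isOpen_inter_preimage
      (TangentBundle.isOpen_preimage_source x₀) Metric.isOpen_ball,
    ⟨mem_extChartAt_source x₀, Metric.mem_ball_self (lt_min hr₁ hr')⟩,
    fun p => TangentBundle.ofCoord x₀ (α (TangentBundle.coord x₀ p.2, p.1)), ?_, ?_⟩
  · refine (TangentBundle.continuousOn_ofCoord x₀).comp (hαc.comp
      (((TangentBundle.continuousOn_coord x₀).comp continuousOn_snd fun p hp => hp.2.1).prodMk
        continuousOn_fst) ?_) ?_
    · rintro ⟨t, q⟩ ⟨ht, hq⟩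
      refine ⟨Metric.ball_subset_closedBall (Metric.ball_subset_ball (min_le_right _ _) hq.2), ?_⟩
      have h1 : t ∈ Ioo (-min δ₁ ε) (min δ₁ ε) := ht
      have h2 := min_le_right δ₁ ε
      exact ⟨by linarith [h1.1], by linarith [h1.2]⟩
    · rintro ⟨t, q⟩ ⟨ht, hq⟩
      have h1 : t ∈ Ioo (-min δ₁ ε) (min δ₁ ε) := ht
      have h2 := min_le_left δ₁ ε
      exact (hpab (hball _ (Metric.ball_subset_ball (min_le_left _ _) hq.2))
        (hIoo t ⟨by linarith [h1.1], by linarith [h1.2]⟩)).2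
  intro γ hγ hV
  set z := TangentBundle.coord x₀ (velocity (n := n) γ 0)
  have hzr : z ∈ Metric.closedBall z₀ r :=
    Metric.ball_subset_closedBall (Metric.ball_subset_ball (min_le_right _ _) hV.2)
  have hAd : ∀ t ∈ Ioo (-min δ₁ ε) (min δ₁ ε),
      HasDerivAt (fun t => α (z, t)) (F (α (z, t))) t ∧ α (z, t) ∈ S ∩ O := by
    intro t ht
    have h2 := min_le_left δ₁ ε
    have h3 := min_le_right δ₁ ε
    have h4 : -ε < t := by linarith [ht.1]
    have h5 : t < ε := by linarith [ht.2]
    refine ⟨((hα z hzr).2 t ⟨h4.le, h5.le⟩).hasDerivAt (Icc_mem_nhds h4 h5), ?_⟩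
    exact hpab (hball _ (Metric.ball_subset_ball (min_le_left _ _) hV.2))
      (hIoo t ⟨by linarith [ht.1], by linarith [ht.2]⟩)
  -- That the geodesic stays in the chart is not known in advance. Agreement with the solution at
  -- one time puts it in the chart there, and uniqueness for the differential equation extends the
  -- agreement to nearby times.
  have hloc : ∀ t ∈ Ioo (-min δ₁ ε) (min δ₁ ε), velocity (n := n) γ t = TangentBundle.ofCoord x₀ (α (z, t)) →
      ∀ᶠ s in 𝓝 t, velocity (n := n) γ s = TangentBundle.ofCoord x₀ (α (z, s)) := by
    intro t ht heq
    have hcoord : TangentBundle.coord x₀ (velocity γ t) = α (z, t) := by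
      rw [heq, TangentBundle.coord_ofCoord (hAd t ht).2.2]
    have hsrc : γ t ∈ (extChartAt (𝓡 n) x₀).source := by
      have h1 : γ t = (extChartAt (𝓡 n) x₀).symm (α (z, t)).1 :=
        congrArg Bundle.TotalSpace.proj heq
      rw [h1]
      exact (extChartAt (𝓡 n) x₀).map_target (hAd t ht).2.2
    have hev : ∀ᶠ s in 𝓝 t, s ∈ Ioo (-min δ₁ ε) (min δ₁ ε) := isOpen_Ioo.mem_nhds ht
    have huniq : (fun s => TangentBundle.coord x₀ (velocity γ s)) =ᶠ[𝓝 t] fun s => α (z, s) := by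
      refine ODE_solution_unique_of_eventually (v := fun _ => F) (s := fun _ => S)
        (K := K) (Eventually.of_forall fun _ => hlip) ?_ ?_ hcoord
      · have hmem : ∀ᶠ s in 𝓝 t, TangentBundle.coord x₀ (velocity γ s) ∈ S :=
          (hγ.hasDerivAt_coord hsrc).continuousAt.eventually
            (hSo.mem_nhds (hcoord.symm ▸ (hAd t ht).2.1 :
              TangentBundle.coord x₀ (velocity γ t) ∈ S))
        filter_upwards [hγ.eventually_source hsrc, hmem] with s hs hs2
        exact ⟨hγ.hasDerivAt_coord hs, hs2⟩
      · filter_upwards [hev] with s hs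
        exact ⟨(hAd s hs).1, (hAd s hs).2.1⟩
    filter_upwards [huniq, hγ.eventually_source hsrc] with s hs hs2
    rw [← hs]
    exact (TangentBundle.ofCoord_coord (q := velocity γ s) hs2).symm
  have hδ : 0 < min δ₁ ε := lt_min hδ₁ hε
  refine eqOn_of_eventually_eq isOpen_Ioo isPreconnected_Ioo
    hγ.continuous_velocity.continuousOn ?_ (t₀ := 0) ⟨neg_lt_zero.2 hδ, hδ⟩ ?_ hloc
  · intro t ht
    exact ((TangentBundle.continuousOn_ofCoord x₀).comp
      (fun s hs => (hAd s hs).1.continuousAt.continuousWithinAt) fun s hs => (hAd s hs).2.2) t ht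
  · change velocity γ 0 = TangentBundle.ofCoord x₀ (α (z, 0))
    rw [(hα z hzr).1]
    exact (TangentBundle.ofCoord_coord (q := velocity γ 0) hV.1).symm

/-- A geodesic is determined by its velocity at one time. -/
theorem IsGeodesic.velocity_unique [T2Space X] {γ₁ γ₂ : ℝ → X} (h₁ : g.IsGeodesic γ₁)
    (h₂ : g.IsGeodesic γ₂) (h : velocity (n := n) γ₁ 0 = velocity γ₂ 0) :
    velocity (n := n) γ₁ = velocity γ₂ := by
  have : T2Space (TangentBundle (𝓡 n) X) := TangentBundle.t2Space
  refine funext fun t => eqOn_of_eventually_eq isOpen_univ isPreconnected_univ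
    h₁.continuous_velocity.continuousOn h₂.continuous_velocity.continuousOn (mem_univ 0) h
    (fun t _ ht => ?_) (mem_univ t)
  obtain ⟨δ, hδ, V, -, hV, β, -, hβ⟩ := exists_local_flow g (velocity γ₁ t)
  have hs : ∀ᶠ s in 𝓝 t, s - t ∈ Ioo (-δ) δ := by
    have : Tendsto (fun s => s - t) (𝓝 t) (𝓝 0) := by
      simpa using (continuous_id.sub continuous_const).tendsto (x := t) (f := fun s => s - t)
    exact this.eventually (Ioo_mem_nhds (neg_lt_zero.2 hδ) hδ)
  filter_upwards [hs] with s hs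
  have e₁ := hβ _ (h₁.comp_add t) (by rwa [h₁.velocity_comp_add, zero_add]) _ hs
  have e₂ := hβ _ (h₂.comp_add t) (by rwa [h₂.velocity_comp_add, zero_add, ← ht]) _ hs
  rw [h₁.velocity_comp_add, h₁.velocity_comp_add, sub_add_cancel, zero_add] at e₁
  rw [h₂.velocity_comp_add, h₂.velocity_comp_add, sub_add_cancel, zero_add] at e₂
  rw [e₁, e₂, ht]

section Flow

variable [T2Space X]

/-- Uniqueness makes the geodesic chosen in the definition of `geodesicFlow` irrelevant; the group
property follows. -/
theorem IsGeodesic.geodesicFlow_velocity {γ : ℝ → X} (hγ : g.IsGeodesic γ) (t s : ℝ) :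
    g.geodesicFlow t (velocity γ s) = velocity γ (t + s) := by
  have h : ∃ γ' : ℝ → X, g.IsGeodesic γ' ∧ velocity γ' 0 = velocity γ s :=
    ⟨_, hγ.comp_add s, by rw [hγ.velocity_comp_add, zero_add]⟩
  rw [geodesicFlow, dif_pos h, h.choose_spec.1.velocity_unique (hγ.comp_add s)
    (by rw [h.choose_spec.2, hγ.velocity_comp_add, zero_add]), hγ.velocity_comp_add]

theorem IsComplete.exists_geodesic (hg : g.IsComplete) (q : TangentBundle (𝓡 n) X) :
    ∃ γ : ℝ → X, g.IsGeodesic γ ∧ velocity γ 0 = q ∧ ∀ t, g.geodesicFlow t q = velocity γ t := by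
  obtain ⟨γ, hγ, h⟩ := hg q
  exact ⟨γ, hγ, h, fun t => by rw [← h, hγ.geodesicFlow_velocity, add_zero]⟩

theorem IsComplete.geodesicFlow_zero (hg : g.IsComplete) (q : TangentBundle (𝓡 n) X) :
    g.geodesicFlow 0 q = q := by
  obtain ⟨γ, hγ, h, hf⟩ := hg.exists_geodesic q
  rw [hf, h]

theorem IsComplete.geodesicFlow_geodesicFlow (hg : g.IsComplete) (s t : ℝ)
    (q : TangentBundle (𝓡 n) X) :
    g.geodesicFlow s (g.geodesicFlow t q) = g.geodesicFlow (s + t) q := by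
  obtain ⟨γ, hγ, h, hf⟩ := hg.exists_geodesic q
  rw [hf, hf, hγ.geodesicFlow_velocity]

theorem IsComplete.inner_geodesicFlow (hg : g.IsComplete) (t : ℝ) (q : TangentBundle (𝓡 n) X) :
    g.inner _ (g.geodesicFlow t q).2 (g.geodesicFlow t q).2 = g.inner q.1 q.2 q.2 := by
  obtain ⟨γ, hγ, h, hf⟩ := hg.exists_geodesic q
  rw [hf]
  have := hγ.inner_velocity t
  rw [← h]
  exact this

/-- The geodesic flow of a complete metric is continuous. -/
theorem IsComplete.continuous_geodesicFlow (hg : g.IsComplete) :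
    Continuous fun p : ℝ × TangentBundle (𝓡 n) X => g.geodesicFlow p.1 p.2 := by
  set G : ℝ × TangentBundle (𝓡 n) X → TangentBundle (𝓡 n) X := fun p => g.geodesicFlow p.1 p.2
    with hG
  have hloc : ∀ q₀ : TangentBundle (𝓡 n) X, ∃ δ > 0, ∃ V : Set (TangentBundle (𝓡 n) X),
      IsOpen V ∧ q₀ ∈ V ∧ ContinuousOn G (Ioo (-δ) δ ×ˢ V) := by
    intro q₀
    obtain ⟨δ, hδ, V, hVo, hV, β, hβc, hβ⟩ := exists_local_flow g q₀
    refine ⟨δ, hδ, V, hVo, hV, hβc.congr ?_⟩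
    rintro ⟨t, q⟩ ⟨ht, hq⟩
    obtain ⟨γ, hγ, h, hf⟩ := hg.exists_geodesic q
    change g.geodesicFlow t q = _
    rw [hf, hβ γ hγ (by rw [h]; exact hq) t ht, h]
  have hat : ∀ q₀ : TangentBundle (𝓡 n) X, ∃ δ > 0, ∃ V : Set (TangentBundle (𝓡 n) X),
      IsOpen V ∧ q₀ ∈ V ∧ ∀ t ∈ Ioo (-δ) δ, ∀ q ∈ V, ContinuousAt G (t, q) := by
    intro q₀
    obtain ⟨δ, hδ, V, hVo, hV, hc⟩ := hloc q₀
    exact ⟨δ, hδ, V, hVo, hV, fun t ht q hq =>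
      hc.continuousAt (prod_mem_nhds (isOpen_Ioo.mem_nhds ht) (hVo.mem_nhds hq))⟩
  rw [continuous_iff_continuousAt]
  rintro ⟨T, q₀⟩
  set u : Set ℝ := {T | ContinuousAt G (T, q₀)} with hu
  have hcont : Continuous fun t => G (t, q₀) := by
    obtain ⟨γ, hγ, h, hf⟩ := hg.exists_geodesic q₀
    have : (fun t => G (t, q₀)) = velocity γ := funext hf
    rw [this]
    exact hγ.continuous_velocity
  -- Near `T₁` the flow at time `T''` is the flow at `T'` followed by a step of length less than `δ`
  -- starting in `V`. Continuity at one time of `W` thus spreads to all of `W`, which makes `u` both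
  -- open and closed.
  have hW : ∀ T₁, ∃ W, IsOpen W ∧ T₁ ∈ W ∧ ∀ T' ∈ W, T' ∈ u → W ⊆ u := by
    intro T₁
    obtain ⟨δ, hδ, V, hVo, hV, hc⟩ := hat (G (T₁, q₀))
    refine ⟨Ioo (T₁ - δ / 2) (T₁ + δ / 2) ∩ (fun t => G (t, q₀)) ⁻¹' V,
      isOpen_Ioo.inter (hVo.preimage hcont), ⟨⟨by linarith, by linarith⟩, hV⟩, ?_⟩
    intro T' hT' hTu T'' hT''
    have h1 : ContinuousAt (fun p : ℝ × TangentBundle (𝓡 n) X => (p.1 - T', G (T', p.2)))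
        (T'', q₀) := by
      refine (continuousAt_fst.sub continuousAt_const).prodMk ?_
      have h2 : ContinuousAt (fun p : ℝ × TangentBundle (𝓡 n) X => (T', p.2)) (T'', q₀) :=
        continuousAt_const.prodMk continuousAt_snd
      exact ContinuousAt.comp (g := G) (f := fun p : ℝ × TangentBundle (𝓡 n) X => (T', p.2))
        hTu h2
    have h3 : ContinuousAt G (T'' - T', G (T', q₀)) :=
      hc _ ⟨by linarith [hT'.1.1, hT'.1.2, hT''.1.1, hT''.1.2],
        by linarith [hT'.1.1, hT'.1.2, hT''.1.1, hT''.1.2]⟩ _ hT'.2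
    have h4 := ContinuousAt.comp (g := G)
      (f := fun p : ℝ × TangentBundle (𝓡 n) X => (p.1 - T', G (T', p.2))) h3 h1
    refine h4.congr (Eventually.of_forall fun p => ?_)
    change g.geodesicFlow (p.1 - T') (g.geodesicFlow T' p.2) = g.geodesicFlow p.1 p.2
    rw [hg.geodesicFlow_geodesicFlow, sub_add_cancel]
  have huo : IsOpen u := isOpen_iff_mem_nhds.2 fun T₁ hT₁ => by
    obtain ⟨W, hWo, hTW, h⟩ := hW T₁
    exact mem_of_superset (hWo.mem_nhds hTW) (h T₁ hTW hT₁)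
  have huc : closure u ⊆ u := fun T₁ hT₁ => by
    obtain ⟨W, hWo, hTW, h⟩ := hW T₁
    obtain ⟨T', hT'W, hT'u⟩ := mem_closure_iff.1 hT₁ W hWo hTW
    exact h T' hT'W hT'u hTW
  have h0 : (0 : ℝ) ∈ u := by
    obtain ⟨δ, hδ, V, hVo, hV, hc⟩ := hat q₀
    exact hc 0 ⟨neg_lt_zero.2 hδ, hδ⟩ q₀ hV
  exact isPreconnected_univ.subset_of_closure_inter_subset huo ⟨0, mem_univ _, h0⟩
    (inter_subset_left.trans huc) (mem_univ T)

end Flow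

end SmoothMetric

end

/-! ### Local defining functions of the obstacle. -/

noncomputable section

set_option maxSynthPendingDepth 3

open Set Filter

/-- If a linear functional `L₂ ≠ 0` is nonnegative where `L₁ ≠ 0` is positive, then they are
positive multiples of each other. -/
theorem LinearMap.exists_pos_smul_eq {V : Type*} [AddCommGroup V] [Module ℝ V] {L₁ L₂ : V →ₗ[ℝ] ℝ}
    (h₁ : L₁ ≠ 0) (h₂ : L₂ ≠ 0) (h : ∀ w, 0 < L₁ w → 0 ≤ L₂ w) :
    ∃ c : ℝ, 0 < c ∧ ∀ w, L₂ w = c * L₁ w := by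
  obtain ⟨u, hu⟩ : ∃ u, L₁ u = 1 := by
    obtain ⟨w, hw⟩ := DFunLike.ne_iff.1 h₁
    exact ⟨(L₁ w)⁻¹ • w, by simpa using inv_mul_cancel₀ hw⟩
  have hker : ∀ w, L₁ w = 0 → L₂ w = 0 := by
    intro w hw
    by_contra hne
    -- On this vector `L₁` is `1` while `L₂` is `-1`.
    have := h (u + (-(L₂ u + 1) / L₂ w) • w) (by simp [hu, hw])
    simp only [map_add, map_smul, smul_eq_mul, div_mul_cancel₀ _ hne] at this
    linarith
  have hmul : ∀ w, L₂ w = L₂ u * L₁ w := by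
    intro w
    have := hker (w - L₁ w • u) (by simp [hu])
    simp only [map_sub, map_smul, smul_eq_mul, sub_eq_zero] at this
    rw [this, mul_comm]
  refine ⟨L₂ u, lt_of_le_of_ne (h u (by rw [hu]; exact one_pos)) fun h0 => h₂ ?_, hmul⟩
  ext w
  rw [hmul, ← h0, zero_mul, LinearMap.zero_apply]

variable {n : ℕ} {X : Type*} [TopologicalSpace X] [ChartedSpace (EuclideanSpace ℝ (Fin n)) X]

theorem differential_add (f : X → ℝ) (x : X) (v w : TangentSpace (𝓡 n) x) :
    differential f x (v + w) = differential f x v + differential f x w :=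
  map_add (mfderiv (𝓡 n) 𝓘(ℝ, ℝ) f x) v w

theorem differential_smul (f : X → ℝ) (x : X) (a : ℝ) (v : TangentSpace (𝓡 n) x) :
    differential f x (a • v) = a * differential f x v :=
  map_smul (mfderiv (𝓡 n) 𝓘(ℝ, ℝ) f x) a v

theorem differential_sub (f : X → ℝ) (x : X) (v w : TangentSpace (𝓡 n) x) :
    differential f x (v - w) = differential f x v - differential f x w :=
  map_sub (mfderiv (𝓡 n) 𝓘(ℝ, ℝ) f x) v w

/-- The differential at `x`, as a linear map. -/
def differentialLM (f : X → ℝ) (x : X) : TangentSpace (𝓡 n) x →ₗ[ℝ] ℝ where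
  toFun := differential f x
  map_add' := differential_add f x
  map_smul' := differential_smul f x

theorem differentialLM_ne_zero {f : X → ℝ} {x : X} (h : mfderiv (𝓡 n) 𝓘(ℝ, ℝ) f x ≠ 0) :
    differentialLM (n := n) f x ≠ 0 := fun h0 => h <| by
  ext w
  exact LinearMap.congr_fun h0 w

theorem hasDerivAt_comp_curve {f : X → ℝ} {γ : ℝ → X} {t : ℝ}
    (hf : MDifferentiableAt (𝓡 n) 𝓘(ℝ, ℝ) f (γ t))
    (hγ : MDifferentiableAt 𝓘(ℝ, ℝ) (𝓡 n) γ t) :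
    HasDerivAt (fun s => f (γ s)) (differential f (γ t) (SmoothMetric.velocity (n := n) γ t).2) t := by
  have h1 := hf.hasMFDerivAt.comp t hγ.hasMFDerivAt
  obtain ⟨L, hL⟩ : ∃ L : ℝ →L[ℝ] ℝ, L =
    (mfderiv (𝓡 n) 𝓘(ℝ, ℝ) f (γ t)).comp (mfderiv 𝓘(ℝ, ℝ) (𝓡 n) γ t) := ⟨_, rfl⟩
  have h2 : HasFDerivAt (fun s => f (γ s)) L t := by
    rw [hL]
    exact hasMFDerivAt_iff_hasFDerivAt.1 h1
  refine h2.hasDerivAt.congr_deriv ?_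
  rw [hL]
  rfl

theorem eventually_pos_of_deriv_pos {u : ℝ → ℝ} {d t : ℝ} (hu : HasDerivAt u d t) (h0 : u t = 0)
    (hd : 0 < d) : ∀ᶠ s in 𝓝[>] t, 0 < u s := by
  have h := (hasDerivAt_iff_tendsto_slope.1 hu).mono_left
    (nhdsWithin_mono t fun s (hs : t < s) => hs.ne')
  filter_upwards [h.eventually (lt_mem_nhds hd), self_mem_nhdsWithin] with s hs hts
  rw [slope_def_field, h0, sub_zero] at hs
  exact (div_pos_iff_of_pos_right (sub_pos.2 hts)).1 hs

namespace IsLocalDefiningFunction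

variable {Ω : Set X} {f : X → ℝ}

theorem eventually_mem_iff {x : X} (hf : IsLocalDefiningFunction (n := n) Ω x f) :
    ∀ᶠ y in 𝓝 x, (y ∈ Ω ↔ f y ≤ 0) := by
  obtain ⟨-, -, U, hU, hxU, -, h⟩ := hf
  filter_upwards [hU.mem_nhds hxU] with y hy using h y hy

theorem mdifferentiableAt {x : X} (hf : IsLocalDefiningFunction (n := n) Ω x f) :
    MDifferentiableAt (𝓡 n) 𝓘(ℝ, ℝ) f x := by
  obtain ⟨-, -, U, hU, hxU, h, -⟩ := hf
  exact ((h x hxU).contMDiffAt (hU.mem_nhds hxU)).mdifferentiableAt (by norm_num)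

variable [IsManifold (𝓡 n) ∞ X]

/-- Two local defining functions have positively proportional differentials. -/
theorem exists_differential_eq {g : SmoothMetric n X} (hg : g.IsComplete) {f₂ : X → ℝ} {x : X}
    (hf : IsLocalDefiningFunction (n := n) Ω x f) (hf₂ : IsLocalDefiningFunction (n := n) Ω x f₂) :
    ∃ c : ℝ, 0 < c ∧ ∀ w : TangentSpace (𝓡 n) x, differential f₂ x w = c * differential f x w := by
  refine LinearMap.exists_pos_smul_eq (L₁ := differentialLM f x) (L₂ := differentialLM f₂ x)
    (differentialLM_ne_zero hf.2.1) (differentialLM_ne_zero hf₂.2.1) fun w hw => ?_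
  -- The geodesic serves merely as a curve with velocity `w`. If `df(w) > 0`, it leaves `Ω` at once,
  -- so `f₂` is positive along it and `df₂(w) ≥ 0`.
  obtain ⟨γ, hγ, hγ0⟩ := hg ⟨x, w⟩
  have hx : γ 0 = x := congrArg Bundle.TotalSpace.proj hγ0
  have hder : ∀ h : X → ℝ, MDifferentiableAt (𝓡 n) 𝓘(ℝ, ℝ) h x →
      HasDerivAt (fun s => h (γ s)) (differential h x w) 0 := by
    intro h hh
    have h1 := hasDerivAt_comp_curve (f := h) (by rwa [hx]) (hγ.mdifferentiable 0)
    refine h1.congr_deriv ?_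
    exact congrArg (fun q : TangentBundle (𝓡 n) X => differential h q.1 q.2) hγ0
  have hd1 := hder f hf.mdifferentiableAt
  have hd2 := hder f₂ hf₂.mdifferentiableAt
  have hcont : Tendsto γ (𝓝[>] 0) (𝓝 x) := by
    have := hγ.1.continuous.tendsto 0
    rw [hx] at this
    exact this.mono_left nhdsWithin_le_nhds
  have hev : ∀ᶠ s in 𝓝[>] (0 : ℝ), 0 < f₂ (γ s) := by
    filter_upwards [eventually_pos_of_deriv_pos hd1 (by rw [hx]; exact hf.1) hw,
      hcont.eventually hf.eventually_mem_iff, hcont.eventually hf₂.eventually_mem_iff]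
      with s h1 h2 h3
    by_contra h4
    exact absurd (h2.1 (h3.2 (not_lt.1 h4))) (not_le.2 h1)
  have h : Tendsto _ (𝓝[>] (0 : ℝ)) _ := (hasDerivAt_iff_tendsto_slope.1 hd2).mono_left
    (nhdsWithin_mono 0 fun s (hs : 0 < s) => hs.ne')
  refine ge_of_tendsto h ?_
  filter_upwards [hev, self_mem_nhdsWithin] with s hs hs0
  rw [slope_def_field, hx, hf₂.1, sub_zero, sub_zero]
  exact (div_pos hs hs0).le

end IsLocalDefiningFunction

/-! ### The unit normal and the reflection. -/

namespace GeodesicBilliard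

variable [IsManifold (𝓡 n) ∞ X] (B : GeodesicBilliard n X)

/-- The normal is the negative gradient of a defining function, divided by its length. -/
theorem exists_isInwardUnitNormal {x : X} (hx : x ∈ frontier B.Ω) :
    ∃ ν, B.IsInwardUnitNormal x ν := by
  obtain ⟨f, hf⟩ := B.obstacle.2 x hx
  obtain ⟨e, he⟩ := GeodesicEquation.exists_equiv (E := EuclideanSpace ℝ (Fin n))
    (G := B.g.inner x) (fun a ha => B.g.pos x a ha)
  obtain ⟨u, hu⟩ : ∃ u : TangentSpace (𝓡 n) x, ∀ w, B.g.inner x u w = differential f x w := by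
    refine ⟨e.symm (mfderiv (𝓡 n) 𝓘(ℝ, ℝ) f x), fun w => ?_⟩
    have h1 : e (e.symm (mfderiv (𝓡 n) 𝓘(ℝ, ℝ) f x)) = mfderiv (𝓡 n) 𝓘(ℝ, ℝ) f x :=
      e.apply_symm_apply _
    have h2 := congrArg (fun L : EuclideanSpace ℝ (Fin n) →L[ℝ] EuclideanSpace ℝ (Fin n) →L[ℝ] ℝ =>
      L (e.symm (mfderiv (𝓡 n) 𝓘(ℝ, ℝ) f x))) he
    exact congrArg (fun L : EuclideanSpace ℝ (Fin n) →L[ℝ] ℝ => L w) (h2.symm.trans h1)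
  have hu0 : u ≠ 0 := by
    rintro rfl
    refine hf.2.1 (ContinuousLinearMap.ext fun w => ?_)
    have := hu w
    rw [map_zero] at this
    exact this.symm
  have hpos := B.g.pos x u hu0
  set r := √(B.g.inner x u u) with hr
  have hr0 : 0 < r := Real.sqrt_pos.2 hpos
  have hrr : r * r = B.g.inner x u u := Real.mul_self_sqrt hpos.le
  refine ⟨(-r⁻¹) • u, ?_, f, hf, fun w hw => ?_, ?_⟩
  · simp only [map_smul, FunLike.coe_smul, Pi.smul_apply, smul_eq_mul]
    rw [← hrr]
    field_simp
  · simp only [map_smul, FunLike.coe_smul, Pi.smul_apply, smul_eq_mul]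
    rw [hu, hw, mul_zero]
  · rw [differential_smul, ← hu, ← hrr]
    have : 0 < r⁻¹ * (r * r) := by positivity
    linarith

theorem isInwardUnitNormal_normal {x : X} (hx : x ∈ frontier B.Ω) :
    B.IsInwardUnitNormal x (B.normal x) := by
  have h := B.exists_isInwardUnitNormal hx
  rw [normal, dif_pos h]
  exact h.choose_spec

/-- The normal component, in terms of the differential of any local defining function. -/
theorem exists_differential_eq_mul {x : X} (hx : x ∈ frontier B.Ω) {f : X → ℝ}
    (hf : IsLocalDefiningFunction (n := n) B.Ω x f) :
    differential f x (B.normal x) < 0 ∧ ∀ v : TangentSpace (𝓡 n) x,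
      differential f x v = differential f x (B.normal x) * B.g.inner x v (B.normal x) := by
  obtain ⟨hunit, f₁, hf₁, hker, hneg⟩ := B.isInwardUnitNormal_normal hx
  obtain ⟨c, hc, hcf⟩ := hf₁.exists_differential_eq B.complete hf
  refine ⟨by rw [hcf]; exact mul_neg_of_pos_of_neg hc hneg, fun v => ?_⟩
  set ν := B.normal x
  -- Subtracting this multiple of the normal makes `v` tangent to the boundary, hence orthogonal to
  -- the normal.
  have h1 := hker (v - (differential f₁ x v / differential f₁ x ν) • ν)
    (by rw [differential_sub, differential_smul, div_mul_cancel₀ _ hneg.ne, sub_self])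
  rw [map_sub, map_smul, smul_eq_mul, hunit, mul_one, sub_eq_zero, B.g.symm x ν v] at h1
  have hne := hneg.ne
  rw [h1, hcf, hcf]
  field_simp

theorem normalComponent_reflect {q : TangentBundle (𝓡 n) X} (hq : q.1 ∈ frontier B.Ω) :
    B.normalComponent (B.reflect q) = -B.normalComponent q := by
  have h := (B.isInwardUnitNormal_normal hq).1
  change B.g.inner q.1 (q.2 - (2 * B.normalComponent q) • B.normal q.1) (B.normal q.1) = _
  rw [map_sub, map_smul]
  change B.normalComponent q - 2 * B.normalComponent q * B.g.inner q.1 (B.normal q.1) (B.normal q.1)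
    = _
  rw [h]
  ring

theorem reflect_reflect {q : TangentBundle (𝓡 n) X} (hq : q.1 ∈ frontier B.Ω) :
    B.reflect (B.reflect q) = q := by
  have h := B.normalComponent_reflect hq
  change (⟨q.1, (q.2 - (2 * B.normalComponent q) • B.normal q.1)
    - (2 * B.normalComponent (B.reflect q)) • B.normal q.1⟩ : TangentBundle (𝓡 n) X) = q
  rw [h]
  refine Bundle.TotalSpace.ext rfl (heq_of_eq ?_)
  change (q.2 - (2 * B.normalComponent q) • B.normal q.1)
    - (2 * -B.normalComponent q) • B.normal q.1 = q.2
  rw [mul_neg, neg_smul, sub_neg_eq_add, sub_add_cancel]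

theorem inner_reflect {q : TangentBundle (𝓡 n) X} (hq : q.1 ∈ frontier B.Ω) :
    B.g.inner _ (B.reflect q).2 (B.reflect q).2 = B.g.inner q.1 q.2 q.2 := by
  have h := (B.isInwardUnitNormal_normal hq).1
  change B.g.inner q.1 (q.2 - (2 * B.normalComponent q) • B.normal q.1)
    (q.2 - (2 * B.normalComponent q) • B.normal q.1) = _
  have e1 : B.g.inner q.1 q.2 (B.normal q.1) = B.normalComponent q := rfl
  have e2 : B.g.inner q.1 (B.normal q.1) q.2 = B.normalComponent q := B.g.symm _ _ _
  simp only [map_sub, map_smul, sub_apply, FunLike.coe_smul, Pi.smul_apply, smul_eq_mul,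
    e1, e2, h]
  ring

theorem differential_reflect {q : TangentBundle (𝓡 n) X} (hq : q.1 ∈ frontier B.Ω) {f : X → ℝ}
    (hf : IsLocalDefiningFunction (n := n) B.Ω q.1 f) :
    differential f (B.reflect q).1 (B.reflect q).2 = -differential f q.1 q.2 := by
  change differential f q.1 (q.2 - (2 * B.normalComponent q) • B.normal q.1) = _
  have h := (B.exists_differential_eq_mul hq hf).2 q.2
  rw [differential_sub, differential_smul]
  rw [h]
  change _ * B.normalComponent q - _ = -(_ * B.normalComponent q)
  ring

end GeodesicBilliard

end

noncomputable section

open Set Filter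

namespace GeodesicBilliard

variable {n : ℕ} {X : Type*} [TopologicalSpace X] [ChartedSpace (EuclideanSpace ℝ (Fin n)) X]
  [IsManifold (𝓡 n) ∞ X] (B : GeodesicBilliard n X)

/-! ### Departing vectors -/

theorem mem_frontier_iff (x : X) : x ∈ frontier B.Ω ↔ x ∈ B.Ω ∧ x ∉ interior B.Ω := by
  rw [B.obstacle.1.frontier_eq]
  exact Iff.rfl

theorem mem_nonGrazing_iff (q : TangentBundle (𝓡 n) X) :
    q ∈ B.nonGrazing ↔ B.g.inner q.1 q.2 q.2 = 1 ∧ q.1 ∉ interior B.Ω ∧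
      (q.1 ∈ frontier B.Ω → B.normalComponent q ≠ 0) := by
  simp only [nonGrazing, phaseSpace, grazing, boundaryPhase, Set.mem_sdiff,
    mem_ofPred_eq]
  tauto

theorem interiorPhase_subset_nonGrazing : B.interiorPhase ⊆ B.nonGrazing := fun q hq =>
  (B.mem_nonGrazing_iff q).2 ⟨hq.1, fun h => hq.2 (interior_subset h),
    fun h => absurd ((B.mem_frontier_iff _).1 h).1 hq.2⟩

variable {B}

theorem mem_interiorPhase_of_notMem {q : TangentBundle (𝓡 n) X} (hq : q ∈ B.nonGrazing)
    (h : q.1 ∉ B.Ω) : q ∈ B.interiorPhase :=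
  ⟨((B.mem_nonGrazing_iff q).1 hq).1, h⟩

theorem mem_boundaryPhase_of_mem {q : TangentBundle (𝓡 n) X} (hq : q ∈ B.nonGrazing)
    (h : q.1 ∈ B.Ω) : q ∈ B.boundaryPhase :=
  ⟨((B.mem_nonGrazing_iff q).1 hq).1,
    (B.mem_frontier_iff _).2 ⟨h, ((B.mem_nonGrazing_iff q).1 hq).2.1⟩⟩

theorem mem_frontier_of_mem {q : TangentBundle (𝓡 n) X} (hq : q ∈ B.nonGrazing)
    (h : q.1 ∈ B.Ω) : q.1 ∈ frontier B.Ω := (mem_boundaryPhase_of_mem hq h).2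

theorem normalComponent_ne_zero {q : TangentBundle (𝓡 n) X} (hq : q ∈ B.nonGrazing)
    (h : q.1 ∈ B.Ω) : B.normalComponent q ≠ 0 :=
  ((B.mem_nonGrazing_iff q).1 hq).2.2 (mem_frontier_of_mem hq h)

theorem depart_eq_self_of_notMem (ε : ℝ) {q : TangentBundle (𝓡 n) X} (h : q.1 ∉ B.Ω) :
    B.depart ε q = q :=
  if_neg fun hb => h ((B.mem_frontier_iff _).1 hb.1.2).1

theorem depart_eq_self_of_nonpos {ε : ℝ} {q : TangentBundle (𝓡 n) X}
    (h : ε * B.normalComponent q ≤ 0) : B.depart ε q = q :=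
  if_neg fun hb => not_lt.2 h hb.2

theorem depart_eq_reflect {ε : ℝ} {q : TangentBundle (𝓡 n) X} (hq : q ∈ B.boundaryPhase)
    (h : 0 < ε * B.normalComponent q) : B.depart ε q = B.reflect q := if_pos ⟨hq, h⟩

theorem depart_eq_self_or (ε : ℝ) (q : TangentBundle (𝓡 n) X) :
    B.depart ε q = q ∨ q.1 ∈ frontier B.Ω ∧ B.depart ε q = B.reflect q := by
  by_cases h : q ∈ B.boundaryPhase ∧ 0 < ε * B.normalComponent q
  · exact Or.inr ⟨h.1.2, if_pos h⟩
  · exact Or.inl (if_neg h)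

theorem depart_proj (ε : ℝ) (q : TangentBundle (𝓡 n) X) : (B.depart ε q).1 = q.1 := by
  rcases B.depart_eq_self_or ε q with h | ⟨-, h⟩ <;> rw [h]
  rfl

theorem inner_depart (ε : ℝ) (q : TangentBundle (𝓡 n) X) :
    B.g.inner _ (B.depart ε q).2 (B.depart ε q).2 = B.g.inner q.1 q.2 q.2 := by
  rcases B.depart_eq_self_or ε q with h | ⟨hf, h⟩ <;> rw [h]
  exact B.inner_reflect hf

theorem depart_mem_nonGrazing (ε : ℝ) {q : TangentBundle (𝓡 n) X} (hq : q ∈ B.nonGrazing) :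
    B.depart ε q ∈ B.nonGrazing := by
  rcases B.depart_eq_self_or ε q with h | ⟨hf, h⟩ <;> rw [h]
  · exact hq
  · rw [mem_nonGrazing_iff] at hq ⊢
    refine ⟨(B.inner_reflect hf).trans hq.1, hq.2.1, fun _ => ?_⟩
    rw [B.normalComponent_reflect hf]
    exact neg_ne_zero.2 (hq.2.2 hf)

/-- This is the purpose of `depart`: from the boundary, the motion in time direction `ε` points out
of `Ω`. -/
theorem mul_normalComponent_depart_neg {ε : ℝ} (hε : ε * ε = 1) {q : TangentBundle (𝓡 n) X}
    (hq : q ∈ B.nonGrazing) (h : q.1 ∈ B.Ω) : ε * B.normalComponent (B.depart ε q) < 0 := by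
  have hε0 : ε ≠ 0 := by rintro rfl; simp at hε
  rcases lt_or_gt_of_ne (mul_ne_zero hε0 (normalComponent_ne_zero hq h)) with h1 | h1
  · rwa [depart_eq_self_of_nonpos h1.le]
  · rw [depart_eq_reflect (mem_boundaryPhase_of_mem hq h) h1,
      B.normalComponent_reflect (mem_frontier_of_mem hq h)]
    linarith

/-- A reflection made for one time direction is undone by the reflection for the opposite one; this
is the source of reversibility. -/
theorem depart_neg_depart {ε : ℝ} (hε : ε * ε = 1) {q : TangentBundle (𝓡 n) X}
    (hq : q ∈ B.nonGrazing) : B.depart (-ε) (B.depart ε q) = B.depart (-ε) q := by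
  by_cases h : q.1 ∈ B.Ω
  · have hε0 : ε ≠ 0 := by rintro rfl; simp at hε
    rcases lt_or_gt_of_ne (mul_ne_zero hε0 (normalComponent_ne_zero hq h)) with h1 | h1
    · rw [depart_eq_self_of_nonpos h1.le]
    · have hm := depart_mem_nonGrazing ε hq
      have hn := mul_normalComponent_depart_neg hε hq h
      rw [depart_eq_reflect (mem_boundaryPhase_of_mem hq h) h1] at hm hn ⊢
      rw [depart_eq_reflect (q := B.reflect q) (mem_boundaryPhase_of_mem hm h) (by linarith),
        B.reflect_reflect (mem_frontier_of_mem hq h),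
        depart_eq_self_of_nonpos (q := q) (by linarith)]
  · rw [depart_eq_self_of_notMem ε h]

/-- One equality of departing vectors thus controls the motion in both time directions. -/
theorem depart_neg_eq_of_depart_eq {ε : ℝ} (hε : ε * ε = 1) {q r : TangentBundle (𝓡 n) X}
    (hq : q ∈ B.nonGrazing) (hr : r ∈ B.nonGrazing) (h : B.depart ε q = B.depart ε r) :
    B.depart (-ε) q = B.depart (-ε) r := by
  rw [← depart_neg_depart hε hq, h, depart_neg_depart hε hr]

/-! ### Quantities depending on the departing vector only -/

section Congr

variable {ε : ℝ} {q r : TangentBundle (𝓡 n) X}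

theorem hitTime_congr (h : B.depart ε q = B.depart ε r) : B.hitTime ε q = B.hitTime ε r := by
  simp only [hitTime, h]

theorem hitPoint_congr (h : B.depart ε q = B.depart ε r) : B.hitPoint ε q = B.hitPoint ε r := by
  simp only [hitPoint, hitTime_congr h, h]

theorem bounces_congr (h : B.depart ε q = B.depart ε r) : B.Bounces ε q ↔ B.Bounces ε r := by
  simp only [Bounces, hitTime_congr h, hitPoint_congr h]

theorem collisionTime_congr (h : B.depart ε q = B.depart ε r) (k : ℕ) :
    B.collisionTime ε k q = B.collisionTime ε k r := by
  cases k with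
  | zero => exact hitTime_congr h
  | succ k =>
    simp only [collisionTime, hitTime_congr h, hitPoint_congr h]
    classical exact if_congr (bounces_congr h) rfl rfl

theorem maxTime_congr (h : B.depart ε q = B.depart ε r) : B.maxTime ε q = B.maxTime ε r := by
  simp only [maxTime, collisionTime_congr h]

theorem advance_congr (h : B.depart ε q = B.depart ε r) (k : ℕ) (s : ℝ) :
    B.advance ε k q s = B.advance ε k r s := by
  cases k <;> simp only [advance, hitTime_congr h, hitPoint_congr h, h]

theorem reflectionsBefore_congr (h : B.depart ε q = B.depart ε r) (s : ℝ) :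
    B.reflectionsBefore ε q s = B.reflectionsBefore ε r s := by
  simp only [reflectionsBefore, collisionTime_congr h]

end Congr

/-! ### First hits -/

variable (B) in
/-- After the elapsed time `h`, the obstacle is hit for the first time. -/
def IsFirstHit (ε : ℝ) (q : TangentBundle (𝓡 n) X) (h : ℝ) : Prop :=
  0 < h ∧ (B.g.geodesicFlow (ε * h) (B.depart ε q)).1 ∈ B.Ω ∧
    ∀ u, 0 < u → u < h → (B.g.geodesicFlow (ε * u) (B.depart ε q)).1 ∉ B.Ω

theorem ofReal_le_hitTime_iff {ε : ℝ} {q : TangentBundle (𝓡 n) X} {s : ℝ} :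
    ENNReal.ofReal s ≤ B.hitTime ε q ↔
      ∀ u, 0 < u → (B.g.geodesicFlow (ε * u) (B.depart ε q)).1 ∈ B.Ω → s ≤ u := by
  simp only [hitTime, le_iInf_iff, and_imp]
  refine forall_congr' fun u => ?_
  refine forall_congr' fun hu => ?_
  rw [ENNReal.ofReal_le_ofReal_iff hu.le]

theorem notMem_of_lt_hitTime {ε : ℝ} {q : TangentBundle (𝓡 n) X} {u : ℝ} (hu : 0 < u)
    (h : ENNReal.ofReal u < B.hitTime ε q) :
    (B.g.geodesicFlow (ε * u) (B.depart ε q)).1 ∉ B.Ω := fun hm =>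
  not_le.2 h (iInf₂_le_of_le u ⟨hu, hm⟩ le_rfl)

theorem hitTime_eq_top_iff {ε : ℝ} {q : TangentBundle (𝓡 n) X} :
    B.hitTime ε q = ⊤ ↔ ∀ u, 0 < u → (B.g.geodesicFlow (ε * u) (B.depart ε q)).1 ∉ B.Ω := by
  simp only [hitTime, iInf_eq_top, ENNReal.ofReal_ne_top, imp_false, not_and]

theorem IsFirstHit.hitTime_eq {ε h : ℝ} {q : TangentBundle (𝓡 n) X} (hq : B.IsFirstHit ε q h) :
    B.hitTime ε q = ENNReal.ofReal h := by
  refine le_antisymm (iInf₂_le_of_le h ⟨hq.1, hq.2.1⟩ le_rfl) ?_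
  rw [ofReal_le_hitTime_iff]
  intro u hu hm
  by_contra hlt
  exact hq.2.2 u hu (not_le.1 hlt) hm

theorem IsFirstHit.hitPoint_eq {ε h : ℝ} {q : TangentBundle (𝓡 n) X} (hq : B.IsFirstHit ε q h) :
    B.hitPoint ε q = B.g.geodesicFlow (ε * h) (B.depart ε q) := by
  rw [hitPoint, hq.hitTime_eq, ENNReal.toReal_ofReal hq.1.le]

variable [T2Space X]

variable (B) in
theorem continuous_path (ε : ℝ) (q : TangentBundle (𝓡 n) X) :
    Continuous fun u : ℝ => (B.g.geodesicFlow (ε * u) q).1 :=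
  TangentBundle.continuous_proj.comp (B.complete.continuous_geodesicFlow.comp
    ((continuous_const.mul continuous_id).prodMk continuous_const))

variable (B) in
theorem hasDerivAt_path {f : X → ℝ} (ε u : ℝ) (q : TangentBundle (𝓡 n) X)
    (hf : MDifferentiableAt (𝓡 n) 𝓘(ℝ, ℝ) f (B.g.geodesicFlow (ε * u) q).1) :
    HasDerivAt (fun u => f (B.g.geodesicFlow (ε * u) q).1)
      (ε * differential f (B.g.geodesicFlow (ε * u) q).1 (B.g.geodesicFlow (ε * u) q).2) u := by
  obtain ⟨γ, hγ, -, hG⟩ := B.complete.exists_geodesic q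
  have h1 : HasDerivAt (fun s => f (γ s)) _ (ε * u) :=
    hasDerivAt_comp_curve (by rw [hG] at hf; exact hf) (hγ.mdifferentiable (ε * u))
  have h2 := h1.comp u ((hasDerivAt_id u).const_mul ε)
  have h3 : (fun u => f (B.g.geodesicFlow (ε * u) q).1) =
      (fun s => f (γ s)) ∘ fun y => ε * id y := by
    funext y
    rw [hG]
    rfl
  rw [h3, hG]
  refine h2.congr_deriv ?_
  rw [mul_one, mul_comm]
  rfl

/-- On the boundary, a defining function vanishes and has positive derivative along the departing
path; off `Ω`, closedness of `Ω` suffices. -/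
theorem exists_forall_notMem {ε : ℝ} (hε : ε * ε = 1) {q : TangentBundle (𝓡 n) X}
    (hq : q ∈ B.nonGrazing) :
    ∃ δ > 0, ∀ u, 0 < u → u < δ → (B.g.geodesicFlow (ε * u) (B.depart ε q)).1 ∉ B.Ω := by
  have hc := B.continuous_path ε (B.depart ε q)
  have h0 : (B.g.geodesicFlow (ε * 0) (B.depart ε q)).1 = q.1 := by
    rw [mul_zero, B.complete.geodesicFlow_zero, depart_proj]
  suffices h : ∀ᶠ u in 𝓝[>] (0 : ℝ), (B.g.geodesicFlow (ε * u) (B.depart ε q)).1 ∉ B.Ω by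
    obtain ⟨δ, hδ, h⟩ := mem_nhdsGT_iff_exists_Ioo_subset.1 h
    exact ⟨δ, hδ, fun u hu hu' => h ⟨hu, hu'⟩⟩
  by_cases hm : q.1 ∈ B.Ω
  · have hfr := mem_frontier_of_mem hq hm
    obtain ⟨f, hf⟩ := B.obstacle.2 _ hfr
    obtain ⟨hneg, hmul⟩ := B.exists_differential_eq_mul hfr hf
    have hd := B.hasDerivAt_path (f := f) ε 0 (B.depart ε q)
      (by rw [h0]; exact hf.mdifferentiableAt)
    have hpos : 0 < ε * differential f (B.depart ε q).1 (B.depart ε q).2 := by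
      have h1 := mul_normalComponent_depart_neg hε hq hm
      rw [← depart_proj ε q] at hneg hmul
      rw [hmul]
      change 0 < ε * (_ * B.normalComponent (B.depart ε q))
      nlinarith
    have h0' : B.g.geodesicFlow (ε * 0) (B.depart ε q) = B.depart ε q := by
      rw [mul_zero, B.complete.geodesicFlow_zero]
    have hd0 : f (B.g.geodesicFlow (ε * 0) (B.depart ε q)).1 = 0 := by rw [h0]; exact hf.1
    rw [h0'] at hd
    have ht : Tendsto (fun u => (B.g.geodesicFlow (ε * u) (B.depart ε q)).1) (𝓝[>] 0)
        (𝓝 q.1) := by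
      have := hc.tendsto 0
      rw [h0] at this
      exact this.mono_left nhdsWithin_le_nhds
    filter_upwards [eventually_pos_of_deriv_pos hd hd0 hpos, ht.eventually hf.eventually_mem_iff]
      with u hu1 hu2 hu3
    exact absurd (hu2.1 hu3) (not_le.2 hu1)
  · refine Eventually.filter_mono nhdsWithin_le_nhds ?_
    exact hc.continuousAt.eventually (B.obstacle.1.isOpen_compl.mem_nhds
      (h0.symm ▸ hm : (B.g.geodesicFlow (ε * 0) (B.depart ε q)).1 ∈ B.Ωᶜ))

theorem hitTime_pos {ε : ℝ} (hε : ε * ε = 1) {q : TangentBundle (𝓡 n) X}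
    (hq : q ∈ B.nonGrazing) : 0 < B.hitTime ε q := by
  obtain ⟨δ, hδ, h⟩ := exists_forall_notMem hε hq
  refine lt_of_lt_of_le (ENNReal.ofReal_pos.2 hδ) (ofReal_le_hitTime_iff.2 fun u hu hm => ?_)
  by_contra hlt
  exact h u hu (not_le.1 hlt) hm

/-- The infimum of the hitting times is attained: they form a closed set, bounded away from the
excluded time `0`. -/
theorem exists_isFirstHit {ε : ℝ} (hε : ε * ε = 1) {q : TangentBundle (𝓡 n) X}
    (hq : q ∈ B.nonGrazing) (h : B.hitTime ε q ≠ ⊤) : ∃ t, B.IsFirstHit ε q t := by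
  obtain ⟨δ, hδ, hn⟩ := exists_forall_notMem hε hq
  rw [Ne, hitTime_eq_top_iff] at h
  push Not at h
  obtain ⟨u₀, hu₀, hm₀⟩ := h
  set S : Set ℝ := Ici δ ∩ {u | (B.g.geodesicFlow (ε * u) (B.depart ε q)).1 ∈ B.Ω} with hS
  have hmS : ∀ u, 0 < u → (B.g.geodesicFlow (ε * u) (B.depart ε q)).1 ∈ B.Ω → u ∈ S :=
    fun u hu hm => ⟨not_lt.1 fun hlt => hn u hu hlt hm, hm⟩
  have hcl : IsClosed S := isClosed_Ici.inter (B.obstacle.1.preimage (B.continuous_path ε _))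
  have hbdd : BddBelow S := ⟨δ, fun u hu => hu.1⟩
  have hmem := hcl.csInf_mem ⟨u₀, hmS u₀ hu₀ hm₀⟩ hbdd
  exact ⟨sInf S, lt_of_lt_of_le hδ hmem.1, hmem.2, fun u hu hlt hm =>
    notMem_of_lt_csInf hlt hbdd (hmS u hu hm)⟩

theorem inner_path {q : TangentBundle (𝓡 n) X} (hq : q ∈ B.nonGrazing) (ε t : ℝ) :
    B.g.inner _ (B.g.geodesicFlow t (B.depart ε q)).2 (B.g.geodesicFlow t (B.depart ε q)).2 = 1 := by
  rw [B.complete.inner_geodesicFlow, inner_depart]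
  exact ((B.mem_nonGrazing_iff q).1 hq).1

theorem IsFirstHit.mem_frontier {ε h : ℝ} {q : TangentBundle (𝓡 n) X}
    (hq : B.IsFirstHit ε q h) :
    (B.g.geodesicFlow (ε * h) (B.depart ε q)).1 ∈ frontier B.Ω := by
  refine (B.mem_frontier_iff _).2 ⟨hq.2.1, fun hi => ?_⟩
  have hev : ∀ᶠ u in 𝓝[<] h, (B.g.geodesicFlow (ε * u) (B.depart ε q)).1 ∈ interior B.Ω :=
    ((B.continuous_path ε (B.depart ε q)).continuousAt.eventually
      (isOpen_interior.mem_nhds hi)).filter_mono nhdsWithin_le_nhds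
  obtain ⟨u, hu1, hu2⟩ := (hev.and (Ioo_mem_nhdsLT hq.1)).exists
  exact hq.2.2 u hu2.1 hu2.2 (interior_subset hu1)

/-- Before the hit a defining function is positive and at the hit it vanishes, so its left
difference quotients are negative. -/
theorem IsFirstHit.normalComponent_nonneg {ε h : ℝ} {q : TangentBundle (𝓡 n) X}
    (hq : B.IsFirstHit ε q h) :
    0 ≤ ε * B.normalComponent (B.g.geodesicFlow (ε * h) (B.depart ε q)) := by
  have hfr := hq.mem_frontier
  obtain ⟨f, hf⟩ := B.obstacle.2 _ hfr
  obtain ⟨hneg, hmul⟩ := B.exists_differential_eq_mul hfr hf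
  have hd := B.hasDerivAt_path ε h (B.depart ε q) hf.mdifferentiableAt
  have hle : ε * differential f (B.g.geodesicFlow (ε * h) (B.depart ε q)).1
      (B.g.geodesicFlow (ε * h) (B.depart ε q)).2 ≤ 0 := by
    have ht : Tendsto _ (𝓝[<] h) _ := (hasDerivAt_iff_tendsto_slope.1 hd).mono_left
      (nhdsWithin_mono h fun s (hs : s < h) => hs.ne)
    refine le_of_tendsto ht ?_
    have hc : Tendsto (fun u => (B.g.geodesicFlow (ε * u) (B.depart ε q)).1) (𝓝[<] h) _ :=
      ((B.continuous_path ε (B.depart ε q)).tendsto h).mono_left nhdsWithin_le_nhds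
    filter_upwards [hc.eventually hf.eventually_mem_iff, Ioo_mem_nhdsLT hq.1] with u hu1 hu2
    have hfu := not_le.1 fun h' => hq.2.2 u hu2.1 hu2.2 (hu1.2 h')
    rw [slope_def_field, hf.1, sub_zero]
    exact (div_neg_of_pos_of_neg hfu (sub_neg.2 hu2.2)).le
  rw [hmul] at hle
  change ε * (_ * B.normalComponent _) ≤ 0 at hle
  nlinarith

end GeodesicBilliard

end

noncomputable section

open Set Filter

namespace GeodesicBilliard

variable {n : ℕ} {X : Type*} [TopologicalSpace X] [ChartedSpace (EuclideanSpace ℝ (Fin n)) X]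
  [IsManifold (𝓡 n) ∞ X] {B : GeodesicBilliard n X}

/-! ### Existence times along trajectories -/

theorem maxTime_of_bounces {ε : ℝ} {q : TangentBundle (𝓡 n) X} (h : B.Bounces ε q) :
    B.maxTime ε q = B.hitTime ε q + B.maxTime ε (B.hitPoint ε q) := by
  have h1 : ∀ k, B.collisionTime ε (k + 1) q =
      B.hitTime ε q + B.collisionTime ε k (B.hitPoint ε q) := fun k => if_pos h
  -- The collision time of index `0` is `hitTime`, which is at most the later ones, so shifting the
  -- index does not change the supremum.
  rw [maxTime, maxTime, ENNReal.add_iSup, ← sup_iSup_nat_succ]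
  simp only [h1]
  exact sup_eq_right.2 (le_iSup_of_le 0 le_self_add)

theorem maxTime_of_not_bounces {ε : ℝ} {q : TangentBundle (𝓡 n) X} (h : ¬B.Bounces ε q) :
    B.maxTime ε q = B.hitTime ε q := by
  have h1 : ∀ k, B.collisionTime ε k q = B.hitTime ε q := by
    intro k
    cases k with
    | zero => rfl
    | succ k => exact if_neg h
  simp only [maxTime, h1, iSup_const]

theorem hitTime_le_maxTime (ε : ℝ) (q : TangentBundle (𝓡 n) X) :
    B.hitTime ε q ≤ B.maxTime ε q := le_iSup_of_le (f := fun k => B.collisionTime ε k q) 0 le_rfl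

variable [T2Space X]

theorem maxTime_pos {ε : ℝ} (hε : ε * ε = 1) {q : TangentBundle (𝓡 n) X}
    (hq : q ∈ B.nonGrazing) : 0 < B.maxTime ε q :=
  (hitTime_pos hε hq).trans_le (hitTime_le_maxTime ε q)

theorem hitPoint_spec {ε : ℝ} (hε : ε * ε = 1) {q : TangentBundle (𝓡 n) X}
    (hq : q ∈ B.nonGrazing) (h : B.Bounces ε q) :
    B.hitPoint ε q ∈ B.nonGrazing ∧ (B.hitPoint ε q).1 ∈ B.Ω ∧
      0 < ε * B.normalComponent (B.hitPoint ε q) := by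
  obtain ⟨t, ht⟩ := exists_isFirstHit hε hq h.1
  have hng := h.2
  rw [ht.hitPoint_eq] at hng ⊢
  have hunit := inner_path hq ε (ε * t)
  have hfr := ht.mem_frontier
  have hne : B.normalComponent (B.g.geodesicFlow (ε * t) (B.depart ε q)) ≠ 0 := fun h0 =>
    hng ⟨⟨hunit, hfr⟩, h0⟩
  have hε0 : ε ≠ 0 := by rintro rfl; simp at hε
  refine ⟨(B.mem_nonGrazing_iff _).2 ⟨hunit, ((B.mem_frontier_iff _).1 hfr).2, fun _ => hne⟩,
    ht.2.1, lt_of_le_of_ne ht.normalComponent_nonneg (mul_ne_zero hε0 hne).symm⟩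

theorem flow_sub {ε s u : ℝ} {a b : TangentBundle (𝓡 n) X}
    (hab : b = B.g.geodesicFlow (ε * s) a) :
    B.g.geodesicFlow (ε * (u - s)) b = B.g.geodesicFlow (ε * u) a := by
  rw [hab, B.complete.geodesicFlow_geodesicFlow]
  congr 1
  ring

/-- Since the path from `a` to `b` avoids `Ω`, the first hit of `a` is that of `b`, delayed by `s`;
everything after it is common to both. -/
theorem maxTime_shift {ε : ℝ} (hε : ε * ε = 1) {a b : TangentBundle (𝓡 n) X}
    (hb : b ∈ B.nonGrazing) {s : ℝ} (hs : 0 < s)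
    (hab : B.depart ε b = B.g.geodesicFlow (ε * s) (B.depart ε a))
    (hn : ∀ u, 0 < u → u ≤ s → (B.g.geodesicFlow (ε * u) (B.depart ε a)).1 ∉ B.Ω) :
    B.maxTime ε a = ENNReal.ofReal s + B.maxTime ε b := by
  by_cases htop : B.hitTime ε b = ⊤
  · have hb' : B.maxTime ε b = ⊤ := top_le_iff.1 (htop ▸ hitTime_le_maxTime ε b)
    have ha : B.hitTime ε a = ⊤ := by
      rw [hitTime_eq_top_iff] at htop ⊢
      intro u hu
      rcases le_or_gt u s with hus | hus
      · exact hn u hu hus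
      · rw [← flow_sub hab]
        exact htop _ (sub_pos.2 hus)
    rw [hb', add_top]
    exact top_le_iff.1 (ha ▸ hitTime_le_maxTime ε a)
  · obtain ⟨h, hh⟩ := exists_isFirstHit hε hb htop
    have hsh : B.g.geodesicFlow (ε * (s + h)) (B.depart ε a) =
        B.g.geodesicFlow (ε * h) (B.depart ε b) := by
      rw [← flow_sub hab, add_sub_cancel_left]
    have ha : B.IsFirstHit ε a (s + h) := by
      refine ⟨by linarith [hh.1], by rw [hsh]; exact hh.2.1, fun u hu hlt => ?_⟩
      rcases le_or_gt u s with hus | hus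
      · exact hn u hu hus
      · rw [← flow_sub hab]
        exact hh.2.2 _ (sub_pos.2 hus) (by linarith)
    have hp : B.hitPoint ε a = B.hitPoint ε b := by rw [ha.hitPoint_eq, hh.hitPoint_eq, hsh]
    have ht : B.hitTime ε a = ENNReal.ofReal s + B.hitTime ε b := by
      rw [ha.hitTime_eq, hh.hitTime_eq, ENNReal.ofReal_add hs.le hh.1.le]
    have hbo : B.Bounces ε a ↔ B.Bounces ε b := by
      simp only [Bounces, hp, ha.hitTime_eq, hh.hitTime_eq, ne_eq, ENNReal.ofReal_ne_top]
    by_cases hbb : B.Bounces ε b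
    · rw [maxTime_of_bounces hbb, maxTime_of_bounces (hbo.2 hbb), ht, hp, add_assoc]
    · rw [maxTime_of_not_bounces hbb, maxTime_of_not_bounces (mt hbo.1 hbb), ht]

variable (B) in
/-- In the time direction `ε`, the trajectory of `q` reaches `r` after the time `s`, without being
reflected at `r` yet, and the existence times of `q` and `r` differ by `s`. -/
structure Reaches (ε : ℝ) (q : TangentBundle (𝓡 n) X) (s : ℝ) (r : TangentBundle (𝓡 n) X) :
    Prop where
  mem_nonGrazing : r ∈ B.nonGrazing
  pos : r.1 ∈ B.Ω → 0 < ε * B.normalComponent r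
  maxTime_eq : B.maxTime ε q = ENNReal.ofReal s + B.maxTime ε r
  maxTime_neg_eq : B.maxTime (-ε) r = ENNReal.ofReal s + B.maxTime (-ε) q

/-- Run backward, the motion from `r` retraces the geodesic. If `q` lies on the boundary, it hits
there first, in the departing vector of `q`; this is a bounce, after which it continues as the
backward motion of `q`. Otherwise there is no collision up to `q`, and `maxTime_shift` applies. -/
theorem maxTime_neg_path {ε : ℝ} (hε : ε * ε = 1) {q r : TangentBundle (𝓡 n) X}
    (hq : q ∈ B.nonGrazing) {s : ℝ} (hs : 0 < s)
    (hr' : B.depart (-ε) r = r) (hqr : r = B.g.geodesicFlow (ε * s) (B.depart ε q))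
    (hn : ∀ u, 0 < u → u < s → (B.g.geodesicFlow (ε * u) (B.depart ε q)).1 ∉ B.Ω) :
    B.maxTime (-ε) r = ENNReal.ofReal s + B.maxTime (-ε) q := by
  have hε' : -ε * -ε = 1 := by rw [neg_mul_neg, hε]
  have hback : ∀ u, B.g.geodesicFlow (-ε * u) r =
      B.g.geodesicFlow (ε * (s - u)) (B.depart ε q) := by
    intro u
    rw [hqr, B.complete.geodesicFlow_geodesicFlow]
    congr 1
    ring
  have hbs : B.g.geodesicFlow (-ε * s) r = B.depart ε q := by
    rw [hback, sub_self, mul_zero, B.complete.geodesicFlow_zero]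
  have hn' : ∀ u, 0 < u → u < s → (B.g.geodesicFlow (-ε * u) r).1 ∉ B.Ω := by
    intro u hu hus
    rw [hback]
    exact hn _ (sub_pos.2 hus) (by linarith)
  by_cases hm : q.1 ∈ B.Ω
  · have hh : B.IsFirstHit (-ε) r s := by
      rw [IsFirstHit, hr']
      exact ⟨hs, by rw [hbs, depart_proj]; exact hm, hn'⟩
    have hp : B.hitPoint (-ε) r = B.depart ε q := by rw [hh.hitPoint_eq, hr', hbs]
    have hb : B.Bounces (-ε) r :=
      ⟨by rw [hh.hitTime_eq]; exact ENNReal.ofReal_ne_top,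
        by rw [hp]; exact (depart_mem_nonGrazing ε hq).2⟩
    rw [maxTime_of_bounces hb, hh.hitTime_eq, hp, maxTime_congr (depart_neg_depart hε hq)]
  · refine maxTime_shift hε' hq hs ?_ ?_
    · rw [hr', hbs, depart_eq_self_of_notMem _ hm, depart_eq_self_of_notMem _ hm]
    · intro u hu hus
      rw [hr']
      rcases hus.lt_or_eq with h | rfl
      · exact hn' u hu h
      · rw [hbs, depart_proj]
        exact hm

theorem reaches_of_lt_hitTime {ε : ℝ} (hε : ε * ε = 1) {q : TangentBundle (𝓡 n) X}
    (hq : q ∈ B.nonGrazing) {s : ℝ} (hs : 0 < s) (h : ENNReal.ofReal s < B.hitTime ε q) :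
    B.Reaches ε q s (B.g.geodesicFlow (ε * s) (B.depart ε q)) := by
  have hn : ∀ u, 0 < u → u ≤ s → (B.g.geodesicFlow (ε * u) (B.depart ε q)).1 ∉ B.Ω :=
    fun u hu hus => notMem_of_lt_hitTime hu ((ENNReal.ofReal_le_ofReal hus).trans_lt h)
  have hrn := hn s hs le_rfl
  have hr : B.g.geodesicFlow (ε * s) (B.depart ε q) ∈ B.nonGrazing :=
    B.interiorPhase_subset_nonGrazing ⟨inner_path hq ε _, hrn⟩
  exact ⟨hr, fun h => absurd h hrn,
    maxTime_shift hε hr hs (depart_eq_self_of_notMem ε hrn) hn,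
    maxTime_neg_path hε hq hs (depart_eq_self_of_notMem _ hrn) rfl fun u hu hus => hn u hu hus.le⟩

theorem reaches_hitPoint {ε : ℝ} (hε : ε * ε = 1) {q : TangentBundle (𝓡 n) X}
    (hq : q ∈ B.nonGrazing) (h : B.Bounces ε q) :
    B.Reaches ε q (B.hitTime ε q).toReal (B.hitPoint ε q) := by
  obtain ⟨hr, hm, hpos⟩ := hitPoint_spec hε hq h
  obtain ⟨t, ht⟩ := exists_isFirstHit hε hq h.1
  refine ⟨hr, fun _ => hpos, ?_, ?_⟩
  · rw [ENNReal.ofReal_toReal h.1, maxTime_of_bounces h]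
  · refine maxTime_neg_path hε hq (ENNReal.toReal_pos (hitTime_pos hε hq).ne' h.1)
      (depart_eq_self_of_nonpos (by linarith)) rfl ?_
    rw [ht.hitTime_eq, ENNReal.toReal_ofReal ht.1.le]
    exact ht.2.2

omit [T2Space X] in
theorem advance_of_le (ε : ℝ) (k : ℕ) {q : TangentBundle (𝓡 n) X} {s : ℝ}
    (h : ENNReal.ofReal s ≤ B.hitTime ε q) :
    B.advance ε k q s = B.g.geodesicFlow (ε * s) (B.depart ε q) := by
  cases k with
  | zero => rfl
  | succ k => exact if_pos h

omit [T2Space X] in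
theorem advance_succ_of_lt (ε : ℝ) (k : ℕ) {q : TangentBundle (𝓡 n) X} {s : ℝ}
    (h : B.hitTime ε q < ENNReal.ofReal s) :
    B.advance ε (k + 1) q s =
      B.advance ε k (B.hitPoint ε q) (s - (B.hitTime ε q).toReal) :=
  if_neg (not_le.2 h)

theorem reaches_of_le_hitTime {ε : ℝ} (hε : ε * ε = 1) {q : TangentBundle (𝓡 n) X}
    (hq : q ∈ B.nonGrazing) {s : ℝ} (hs : 0 < s) (h : ENNReal.ofReal s < B.maxTime ε q)
    (hle : ENNReal.ofReal s ≤ B.hitTime ε q) :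
    B.Reaches ε q s (B.g.geodesicFlow (ε * s) (B.depart ε q)) := by
  rcases hle.lt_or_eq with hlt | heq
  · exact reaches_of_lt_hitTime hε hq hs hlt
  -- At the hitting time itself, a grazing hit would end the trajectory and contradict `h`.
  · have hb : B.Bounces ε q := by
      by_contra hb
      rw [maxTime_of_not_bounces hb, heq] at h
      exact lt_irrefl _ h
    have := reaches_hitPoint hε hq hb
    rw [hitPoint, ← heq, ENNReal.toReal_ofReal hs.le] at this
    exact this

/-- Induction on the number of reflections: beyond the first collision the remaining time is spent
from the hit point, and both existence-time identities add up under concatenation. -/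
theorem reaches_advance_of_le_collisionTime {ε : ℝ} (hε : ε * ε = 1) (k : ℕ) :
    ∀ {q : TangentBundle (𝓡 n) X}, q ∈ B.nonGrazing → ∀ {s : ℝ}, 0 < s →
      ENNReal.ofReal s < B.maxTime ε q → ENNReal.ofReal s ≤ B.collisionTime ε k q →
      B.Reaches ε q s (B.advance ε k q s) := by
  induction k with
  | zero => exact fun hq s hs h hk => reaches_of_le_hitTime hε hq hs h hk
  | succ k ih =>
    intro q hq s hs h hk
    rcases le_or_gt (ENNReal.ofReal s) (B.hitTime ε q) with hle | hlt
    · rw [advance_of_le ε _ hle]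
      exact reaches_of_le_hitTime hε hq hs h hle
    · have hb : B.Bounces ε q := by
        by_contra hb
        rw [maxTime_of_not_bounces hb] at h
        exact lt_asymm h hlt
      have hk' : ENNReal.ofReal s ≤ B.hitTime ε q + B.collisionTime ε k (B.hitPoint ε q) :=
        hk.trans_eq (if_pos hb)
      rw [maxTime_of_bounces hb] at h
      rw [advance_succ_of_lt ε k hlt]
      have hR := reaches_hitPoint hε hq hb
      set a := (B.hitTime ε q).toReal with ha
      have ha' : ENNReal.ofReal a = B.hitTime ε q := ENNReal.ofReal_toReal hb.1
      rw [← ha'] at h hk' hlt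
      have ha0 : 0 ≤ a := ENNReal.toReal_nonneg
      have has : a < s := (ENNReal.ofReal_lt_ofReal_iff hs).1 hlt
      have hsplit : ENNReal.ofReal s = ENNReal.ofReal a + ENNReal.ofReal (s - a) := by
        rw [← ENNReal.ofReal_add ha0 (sub_pos.2 has).le, add_sub_cancel]
      rw [hsplit] at h hk'
      have hR' := ih hR.mem_nonGrazing (sub_pos.2 has)
        ((ENNReal.add_lt_add_iff_left ENNReal.ofReal_ne_top).1 h)
        ((ENNReal.add_le_add_iff_left ENNReal.ofReal_ne_top).1 hk')
      refine ⟨hR'.mem_nonGrazing, hR'.pos, ?_, ?_⟩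
      · rw [hR.maxTime_eq, hR'.maxTime_eq, hsplit, add_assoc]
      · rw [hR'.maxTime_neg_eq, hR.maxTime_neg_eq, hsplit, ← add_assoc,
          add_comm (ENNReal.ofReal a)]

theorem reaches_advance {ε : ℝ} (hε : ε * ε = 1) {q : TangentBundle (𝓡 n) X}
    (hq : q ∈ B.nonGrazing) {s : ℝ} (hs : 0 < s) (h : ENNReal.ofReal s < B.maxTime ε q) :
    B.Reaches ε q s (B.advance ε (B.reflectionsBefore ε q s) q s) := by
  obtain ⟨k, hk⟩ := lt_iSup_iff.1 h
  exact reaches_advance_of_le_collisionTime hε _ hq hs h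
    (Nat.sInf_mem (s := {k | ENNReal.ofReal s ≤ B.collisionTime ε k q}) ⟨k, hk.le⟩)

/-! ### The billiard flow -/

omit [T2Space X] in
theorem flow_zero (q : TangentBundle (𝓡 n) X) : B.flow 0 q = q := if_pos rfl

omit [T2Space X] in
theorem flow_of_pos {t : ℝ} (ht : 0 < t) (q : TangentBundle (𝓡 n) X) :
    B.flow t q = B.advance 1 (B.reflectionsBefore 1 q t) q t := by
  rw [flow, if_neg ht.ne', if_pos ht]

omit [T2Space X] in
theorem flow_of_neg {t : ℝ} (ht : t < 0) (q : TangentBundle (𝓡 n) X) :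
    B.flow t q = B.advance (-1) (B.reflectionsBefore (-1) q (-t)) q (-t) := by
  rw [flow, if_neg ht.ne, if_neg ht.le.not_gt]

theorem reaches_flow_of_pos {t : ℝ} {q : TangentBundle (𝓡 n) X} (ht : 0 < t)
    (h : (t, q) ∈ B.flowDomain) : B.Reaches 1 q t (B.flow t q) := by
  rw [flow_of_pos ht]
  exact reaches_advance (one_mul 1) h.1 ht h.2.1

theorem reaches_flow_of_neg {t : ℝ} {q : TangentBundle (𝓡 n) X} (ht : t < 0)
    (h : (t, q) ∈ B.flowDomain) : B.Reaches (-1) q (-t) (B.flow t q) := by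
  rw [flow_of_neg ht]
  exact reaches_advance (by norm_num) h.1 (neg_pos.2 ht) h.2.2

theorem flow_mem_nonGrazing {t : ℝ} {q : TangentBundle (𝓡 n) X} (h : (t, q) ∈ B.flowDomain) :
    B.flow t q ∈ B.nonGrazing := by
  rcases lt_trichotomy t 0 with ht | rfl | ht
  · exact (reaches_flow_of_neg ht h).mem_nonGrazing
  · rw [flow_zero]
    exact h.1
  · exact (reaches_flow_of_pos ht h).mem_nonGrazing

theorem mem_flowDomain_of_pos {t : ℝ} {q : TangentBundle (𝓡 n) X} (ht : 0 < t)
    (hq : q ∈ B.nonGrazing) (h : ENNReal.ofReal t < B.maxTime 1 q) : (t, q) ∈ B.flowDomain := by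
  refine ⟨hq, h, ?_⟩
  rw [ENNReal.ofReal_of_nonpos (neg_nonpos.2 ht.le)]
  exact maxTime_pos (by norm_num) hq

theorem mem_flowDomain_of_neg {t : ℝ} {q : TangentBundle (𝓡 n) X} (ht : t < 0)
    (hq : q ∈ B.nonGrazing) (h : ENNReal.ofReal (-t) < B.maxTime (-1) q) :
    (t, q) ∈ B.flowDomain := by
  refine ⟨hq, ?_, h⟩
  rw [ENNReal.ofReal_of_nonpos ht.le]
  exact maxTime_pos (by norm_num) hq

theorem zero_mem_flowDomain {q : TangentBundle (𝓡 n) X} (hq : q ∈ B.nonGrazing) :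
    ((0 : ℝ), q) ∈ B.flowDomain := by
  refine ⟨hq, ?_, ?_⟩
  · rw [ENNReal.ofReal_zero]; exact maxTime_pos (by norm_num) hq
  · rw [neg_zero, ENNReal.ofReal_zero]; exact maxTime_pos (by norm_num) hq

/-- After being followed up to time `t > 0`, the trajectory can be followed back. -/
theorem neg_mem_flowDomain {t : ℝ} {q : TangentBundle (𝓡 n) X} (ht : 0 < t)
    (h : (t, q) ∈ B.flowDomain) : (-t, B.flow t q) ∈ B.flowDomain := by
  have hR := reaches_flow_of_pos ht h
  refine mem_flowDomain_of_neg (neg_lt_zero.2 ht) hR.mem_nonGrazing ?_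
  rw [hR.maxTime_neg_eq, neg_neg]
  exact ENNReal.lt_add_right ENNReal.ofReal_ne_top (maxTime_pos (by norm_num) h.1).ne'

/-- A trajectory which exists for all times still does so when started from another point. -/
theorem forall_mem_flowDomain_flow {q : TangentBundle (𝓡 n) X}
    (h : ∀ t, (t, q) ∈ B.flowDomain) (s t : ℝ) : (t, B.flow s q) ∈ B.flowDomain := by
  have htop : ∀ ε : ℝ, ε = 1 ∨ ε = -1 → B.maxTime ε q = ⊤ := by
    rintro ε (rfl | rfl)
    · refine ENNReal.eq_top_of_forall_nnreal_le fun r => ?_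
      have := (h r).2.1
      rw [ENNReal.ofReal_coe_nnreal] at this
      exact this.le
    · refine ENNReal.eq_top_of_forall_nnreal_le fun r => ?_
      have := (h (-r)).2.2
      simp only [neg_neg, ENNReal.ofReal_coe_nnreal] at this
      exact this.le
  suffices h' : B.maxTime 1 (B.flow s q) = ⊤ ∧ B.maxTime (-1) (B.flow s q) = ⊤ from
    ⟨flow_mem_nonGrazing (h s), by rw [h'.1]; exact ENNReal.ofReal_lt_top,
      by rw [h'.2]; exact ENNReal.ofReal_lt_top⟩
  have h1 := htop 1 (Or.inl rfl)
  have h2 := htop (-1) (Or.inr rfl)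
  rcases lt_trichotomy s 0 with hs | rfl | hs
  · have hR := reaches_flow_of_neg hs (h s)
    have e1 := hR.maxTime_eq
    have e2 := hR.maxTime_neg_eq
    rw [neg_neg, h1, add_top] at e2
    rw [h2, eq_comm, ENNReal.add_eq_top] at e1
    exact ⟨e2, e1.resolve_left ENNReal.ofReal_ne_top⟩
  · rw [flow_zero]
    exact ⟨h1, h2⟩
  · have hR := reaches_flow_of_pos hs (h s)
    have e1 := hR.maxTime_eq
    have e2 := hR.maxTime_neg_eq
    rw [h2, add_top] at e2
    rw [h1, eq_comm, ENNReal.add_eq_top] at e1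
    exact ⟨e1.resolve_left ENNReal.ofReal_ne_top, e2⟩

/-- Periodic trajectories exist for all times. -/
theorem forall_mem_flowDomain_of_isPeriod {T : ℝ} {q : TangentBundle (𝓡 n) X}
    (h : PartialFlow.IsPeriod B.flowDomain B.flow T q) (t : ℝ) : (t, q) ∈ B.flowDomain := by
  obtain ⟨hT, hd, hq⟩ := h
  have hR := reaches_flow_of_pos hT hd
  rw [hq] at hR
  -- Returning to `q` after time `T` makes each existence time equal to itself plus `T`, hence
  -- infinite.
  have key : ∀ a : ℝ≥0∞, a = ENNReal.ofReal T + a → a = ⊤ := by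
    intro a ha
    by_contra hne
    have h1 : 0 + a = ENNReal.ofReal T + a := by rwa [zero_add]
    exact (ENNReal.ofReal_pos.2 hT).ne ((ENNReal.add_left_inj hne).1 h1)
  refine ⟨hd.1, ?_, ?_⟩
  · rw [key _ hR.maxTime_eq]; exact ENNReal.ofReal_lt_top
  · rw [key _ hR.maxTime_neg_eq]; exact ENNReal.ofReal_lt_top

end GeodesicBilliard

end

noncomputable section

open Set Filter

namespace GeodesicBilliard

variable {n : ℕ} {X : Type*} [TopologicalSpace X] [ChartedSpace (EuclideanSpace ℝ (Fin n)) X]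
  [IsManifold (𝓡 n) ∞ X] {B : GeodesicBilliard n X}

/-! ### Fibres of the projection to a smooth model -/

theorem mem_flowDomain_congr {q r : TangentBundle (𝓡 n) X} (hq : q ∈ B.nonGrazing)
    (hr : r ∈ B.nonGrazing) (h : B.depart 1 q = B.depart 1 r) (t : ℝ) :
    (t, q) ∈ B.flowDomain ↔ (t, r) ∈ B.flowDomain := by
  have h' := depart_neg_eq_of_depart_eq (one_mul 1) hq hr h
  simp only [flowDomain, mem_ofPred_eq, maxTime_congr h, maxTime_congr h', hq, hr]

/-- Time zero is excluded because the flow is then the identity and still distinguishes a vector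
from its reflection. -/
theorem flow_congr {q r : TangentBundle (𝓡 n) X} (hq : q ∈ B.nonGrazing)
    (hr : r ∈ B.nonGrazing) (h : B.depart 1 q = B.depart 1 r) {t : ℝ} (ht : t ≠ 0) :
    B.flow t q = B.flow t r := by
  have h' := depart_neg_eq_of_depart_eq (one_mul 1) hq hr h
  rcases lt_or_gt_of_ne ht with ht | ht
  · rw [flow_of_neg ht, flow_of_neg ht, reflectionsBefore_congr h', advance_congr h']
  · rw [flow_of_pos ht, flow_of_pos ht, reflectionsBefore_congr h, advance_congr h]

variable [T2Space X]

/-- For short positive times, the billiard flow is the geodesic flow of the departing vector, and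
runs in the interior. -/
theorem exists_forall_flow_eq {q : TangentBundle (𝓡 n) X} (hq : q ∈ B.nonGrazing) :
    ∃ δ > 0, ∀ t, 0 < t → t < δ → (t, q) ∈ B.flowDomain ∧ B.flow t q ∈ B.interiorPhase ∧
      B.flow t q = B.g.geodesicFlow t (B.depart 1 q) := by
  obtain ⟨δ, hδ, h⟩ := exists_forall_notMem (one_mul 1) hq
  refine ⟨δ, hδ, fun t ht htδ => ?_⟩
  have hle : ENNReal.ofReal δ ≤ B.hitTime 1 q := by
    rw [ofReal_le_hitTime_iff]
    intro u hu hm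
    by_contra hlt
    exact h u hu (not_le.1 hlt) hm
  have hlt : ENNReal.ofReal t < B.hitTime 1 q :=
    ((ENNReal.ofReal_lt_ofReal_iff hδ).2 htδ).trans_le hle
  have hflow : B.flow t q = B.g.geodesicFlow t (B.depart 1 q) := by
    rw [flow_of_pos ht, advance_of_le _ _ hlt.le, one_mul]
  refine ⟨mem_flowDomain_of_pos ht hq (hlt.trans_le (hitTime_le_maxTime 1 q)), ?_, hflow⟩
  rw [hflow]
  refine ⟨inner_path hq 1 t, ?_⟩
  have := h t ht htδ
  rwa [one_mul] at this

namespace IsSmoothModel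

variable {m : ℕ} {N : Type*} [TopologicalSpace N] [ChartedSpace (EuclideanSpace ℝ (Fin m)) N]
  {π : TangentBundle (𝓡 n) X → N} {φ : ℝ → N → N} (hM : B.IsSmoothModel (m := m) π φ)
include hM

omit [T2Space X] in
theorem eq_of_mem_interiorPhase {q r : TangentBundle (𝓡 n) X} (hq : q ∈ B.interiorPhase)
    (hr : r ∈ B.interiorPhase) (h : π q = π r) : q = r := by
  obtain ⟨σ, -, hσ⟩ := hM.diffeo
  rw [← hσ q hq, h, hσ r hr]

omit [T2Space X] in
theorem continuousAt_flow {t : ℝ} {p : N} (h : (t, p) ∈ B.modelDomain π) :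
    ContinuousAt (fun p : ℝ × N => φ p.1 p.2) (t, p) :=
  (hM.smooth_flow (t, p) h).continuousWithinAt.continuousAt (hM.isOpen_domain.mem_nhds h)

/-- Shortly after time zero both trajectories are in the interior, where `π` is injective, so they
coincide; the geodesic flow then transports the equality back to the departing vectors. -/
theorem depart_eq {q r : TangentBundle (𝓡 n) X} (hq : q ∈ B.nonGrazing) (hr : r ∈ B.nonGrazing)
    (h : π q = π r) : B.depart 1 q = B.depart 1 r := by
  obtain ⟨δ₁, hδ₁, h₁⟩ := exists_forall_flow_eq hq
  obtain ⟨δ₂, hδ₂, h₂⟩ := exists_forall_flow_eq hr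
  have hδ : 0 < min δ₁ δ₂ := lt_min hδ₁ hδ₂
  obtain ⟨t, ht0, ht⟩ := exists_between hδ
  obtain ⟨d₁, i₁, e₁⟩ := h₁ t ht0 (ht.trans_le (min_le_left _ _))
  obtain ⟨d₂, i₂, e₂⟩ := h₂ t ht0 (ht.trans_le (min_le_right _ _))
  have heq := hM.eq_of_mem_interiorPhase i₁ i₂
    (by rw [← hM.intertwines t q d₁, ← hM.intertwines t r d₂, h])
  rw [e₁, e₂] at heq
  have := congrArg (B.g.geodesicFlow (-t)) heq
  rwa [B.complete.geodesicFlow_geodesicFlow, B.complete.geodesicFlow_geodesicFlow, neg_add_cancel,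
    B.complete.geodesicFlow_zero, B.complete.geodesicFlow_zero] at this

omit [T2Space X] in
theorem exists_eq (p : N) : ∃ q ∈ B.nonGrazing, π q = p := by
  have : p ∈ π '' B.nonGrazing := hM.surjective ▸ mem_univ p
  exact this

/-- Membership in the model domain provides only some vector of the fibre; the existence times do
not depend on which one. -/
theorem mem_modelDomain_iff {q : TangentBundle (𝓡 n) X} (hq : q ∈ B.nonGrazing) (t : ℝ) :
    (t, π q) ∈ B.modelDomain π ↔ (t, q) ∈ B.flowDomain := by
  refine ⟨?_, fun h => ⟨(t, q), h, rfl⟩⟩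
  rintro ⟨⟨t', r⟩, hr, heq⟩
  obtain ⟨rfl, h2⟩ := Prod.mk.inj heq
  exact (mem_flowDomain_congr hr.1 hq (hM.depart_eq hr.1 hq h2) _).1 hr

/-- The interior is saturated, since vectors of one fibre depart equally and so share their base
point. -/
theorem mem_interiorPhase {q : TangentBundle (𝓡 n) X} (hq : q ∈ B.nonGrazing)
    (h : π q ∈ π '' B.interiorPhase) : q ∈ B.interiorPhase := by
  obtain ⟨r, hr, he⟩ := h
  have := hM.depart_eq (B.interiorPhase_subset_nonGrazing hr) hq he
  refine mem_interiorPhase_of_notMem hq ?_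
  rw [← depart_proj 1 q, ← this, depart_proj]
  exact hr.2

/-- In a smooth model, the motion can be reversed. -/
theorem proj_flow_neg {q : TangentBundle (𝓡 n) X} {t : ℝ} (ht : 0 < t)
    (h : (t, q) ∈ B.flowDomain) : π (B.flow (-t) (B.flow t q)) = π q := by
  have hd := neg_mem_flowDomain ht h
  rw [← hM.intertwines _ _ hd, ← hM.intertwines _ _ h,
    hM.flow_add t (-t) (π q) ⟨_, h, rfl⟩ ?_ ?_, neg_add_cancel, hM.flow_zero]
  · rw [hM.intertwines _ _ h]
    exact ⟨_, hd, rfl⟩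
  · rw [neg_add_cancel]
    exact ⟨_, zero_mem_flowDomain h.1, rfl⟩

/-- The flow property of the model, along trajectories existing for all times. -/
theorem flow_flow {q : TangentBundle (𝓡 n) X} (h : ∀ t, (t, q) ∈ B.flowDomain) (s t : ℝ) :
    φ t (φ s (π q)) = φ (t + s) (π q) := by
  refine hM.flow_add s t _ ⟨_, h s, rfl⟩ ?_ ⟨_, h _, rfl⟩
  rw [hM.intertwines _ _ (h s)]
  exact ⟨_, forall_mem_flowDomain_flow h s t, rfl⟩

end IsSmoothModel

end GeodesicBilliard

end

noncomputable section

set_option maxSynthPendingDepth 3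

open Set Filter

variable {n : ℕ} {X : Type*} [TopologicalSpace X] [ChartedSpace (EuclideanSpace ℝ (Fin n)) X]

/-! ### Compact sets of unit tangent vectors -/

namespace SmoothMetric

variable [IsManifold (𝓡 n) ∞ X] (g : SmoothMetric n X)

/-- The unit tangent vectors over a compact set in a chart domain form a compact set. -/
theorem isCompact_unit (x₀ : X) {K : Set (EuclideanSpace ℝ (Fin n))} (hK : IsCompact K)
    (hKt : K ⊆ (extChartAt (𝓡 n) x₀).target) :
    IsCompact {q : TangentBundle (𝓡 n) X | q.1 ∈ (extChartAt (𝓡 n) x₀).source ∧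
      extChartAt (𝓡 n) x₀ q.1 ∈ K ∧ g.inner q.1 q.2 q.2 = 1} := by
  have hcont : ContinuousOn (fun p : EuclideanSpace ℝ (Fin n) × EuclideanSpace ℝ (Fin n) =>
      g.gram x₀ p.1 p.2 p.2) {p | p.1 ∈ K} := by
    have h1 : ContinuousOn (fun p : EuclideanSpace ℝ (Fin n) × EuclideanSpace ℝ (Fin n) =>
        g.gram x₀ p.1) {p | p.1 ∈ K} :=
      (g.contDiffOn_gram x₀).continuousOn.comp continuousOn_fst fun p hp => hKt hp
    exact (h1.clm_apply continuousOn_snd).clm_apply continuousOn_snd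
  -- By homogeneity, a positive lower bound of the metric on coordinate unit vectors over `K` bounds
  -- the coordinates of metric unit vectors.
  obtain ⟨l, hl, hlb⟩ := (hK.prod (isCompact_sphere (0 : EuclideanSpace ℝ (Fin n)) 1)).exists_forall_le'
    (hcont.mono fun p hp => hp.1) (a := 0) (by
      rintro ⟨z, v⟩ ⟨hz, hv⟩
      refine g.gram_pos (hKt hz) ?_
      rintro rfl
      simp at hv)
  have hbound : ∀ z ∈ K, ∀ v, g.gram x₀ z v v = 1 → ‖v‖ ≤ 1 / l + 1 := by
    intro z hz v hv
    have hv0 : v ≠ 0 := by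
      rintro rfl
      simp at hv
    have hnv : 0 < ‖v‖ := norm_pos_iff.2 hv0
    have h1 := hlb (z, ‖v‖⁻¹ • v) ⟨hz, by simp [norm_smul, hnv.ne']⟩
    simp only [map_smul, FunLike.coe_smul, Pi.smul_apply, smul_eq_mul, hv, mul_one] at h1
    have h2 : l * ‖v‖ ^ 2 ≤ 1 := by
      have h3 : (‖v‖⁻¹ * ‖v‖⁻¹) * ‖v‖ ^ 2 = 1 := by field_simp
      nlinarith [sq_nonneg ‖v‖]
    have h4 : ‖v‖ ^ 2 ≤ 1 / l := by rwa [le_div_iff₀' hl]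
    -- The inequality `2‖v‖ ≤ ‖v‖² + 1` avoids a square root, which is why the bound is `1 / l + 1`.
    nlinarith [sq_nonneg (‖v‖ - 1)]
  have hcomp : IsCompact {p : EuclideanSpace ℝ (Fin n) × EuclideanSpace ℝ (Fin n) |
      p.1 ∈ K ∧ g.gram x₀ p.1 p.2 p.2 = 1} := by
    have hS := hK.prod (isCompact_closedBall (0 : EuclideanSpace ℝ (Fin n)) (1 / l + 1))
    have hcS := hcont.mono (fun p hp => hp.1 :
      K ×ˢ Metric.closedBall (0 : EuclideanSpace ℝ (Fin n)) (1 / l + 1) ⊆ {p | p.1 ∈ K})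
    have hcl := hcS.preimage_isClosed_of_isClosed hS.isClosed (isClosed_singleton (x := (1 : ℝ)))
    refine hS.of_isClosed_subset (s := _) ?_ (t := _) (fun p hp => ⟨hp.1, ?_⟩)
    · convert hcl using 1
      ext p
      refine ⟨fun hp => ⟨⟨hp.1, ?_⟩, hp.2⟩, fun hp => ⟨hp.1.1, hp.2⟩⟩
      simpa using hbound _ hp.1 _ hp.2
    · simpa using hbound _ hp.1 _ hp.2
  convert hcomp.image_of_continuousOn ((TangentBundle.continuousOn_ofCoord x₀).mono
    fun p hp => hKt hp.1) using 1
  ext q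
  constructor
  · rintro ⟨hq, hqK, hq1⟩
    exact ⟨TangentBundle.coord x₀ q, ⟨hqK, by rw [← g.inner_eq_gram hq, hq1]⟩,
      TangentBundle.ofCoord_coord hq⟩
  · rintro ⟨p, ⟨hpK, hp1⟩, rfl⟩
    have hpt := hKt hpK
    have hs : (TangentBundle.ofCoord x₀ p).1 ∈ (extChartAt (𝓡 n) x₀).source :=
      (extChartAt (𝓡 n) x₀).map_target hpt
    have he : extChartAt (𝓡 n) x₀ (TangentBundle.ofCoord x₀ p).1 = p.1 :=
      (extChartAt (𝓡 n) x₀).right_inv hpt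
    refine ⟨hs, by rw [he]; exact hpK, ?_⟩
    rw [g.inner_eq_gram hs, TangentBundle.coord_ofCoord hpt, hp1]

end SmoothMetric

theorem continuousOn_differential [IsManifold (𝓡 n) ∞ X] {f : X → ℝ} {U : Set X} (hU : IsOpen U)
    (hf : ContMDiffOn (𝓡 n) 𝓘(ℝ, ℝ) ∞ f U) :
    ContinuousOn (fun q : TangentBundle (𝓡 n) X => differential f q.1 q.2) {q | q.1 ∈ U} := by
  have h := hf.continuousOn_tangentMapWithin (by norm_num) hU.uniqueMDiffOn
  have h2 := ((contMDiff_snd_tangentBundle_modelSpace ℝ 𝓘(ℝ, ℝ)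
    (n := 0)).continuous).comp_continuousOn h
  refine h2.congr fun q hq => ?_
  change _ = mfderivWithin (𝓡 n) 𝓘(ℝ, ℝ) f U q.1 q.2
  rw [mfderivWithin_of_isOpen hU hq]
  rfl

namespace GeodesicBilliard

variable [IsManifold (𝓡 n) ∞ X] {B : GeodesicBilliard n X}

omit [IsManifold (𝓡 n) ∞ X] in
theorem apply_eq_zero_of_mem_frontier {Ω U : Set X} {f : X → ℝ} (hΩ : IsClosed Ω) (hU : IsOpen U)
    (hf : ContMDiffOn (𝓡 n) 𝓘(ℝ, ℝ) ∞ f U) (hfΩ : ∀ y ∈ U, (y ∈ Ω ↔ f y ≤ 0)) {y : X}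
    (hyU : y ∈ U) (hy : y ∈ frontier Ω) : f y = 0 := by
  rw [hΩ.frontier_eq] at hy
  refine le_antisymm ((hfΩ y hyU).1 hy.1) (not_lt.1 fun hlt => hy.2 ?_)
  refine mem_interior_iff_mem_nhds.2 ?_
  filter_upwards [hU.mem_nhds hyU,
    ((hf.continuousOn.continuousAt (hU.mem_nhds hyU)).eventually (gt_mem_nhds hlt))] with z hz hz'
  exact (hfΩ z hz).2 hz'.le

/-! ### Vectors transversal to the boundary. -/

section NearBoundary

variable (B) in
/-- On the open set `U`, the smooth function `f` defines the obstacle, and `U` contains the closed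
ball of radius `ρ` in the chart at `x₀`. -/
structure IsBoundaryChart (f : X → ℝ) (x₀ : X) (U : Set X) (ρ : ℝ) : Prop where
  isOpen : IsOpen U
  contMDiffOn : ContMDiffOn (𝓡 n) 𝓘(ℝ, ℝ) ∞ f U
  mem_iff : ∀ y ∈ U, (y ∈ B.Ω ↔ f y ≤ 0)
  subset_target : Metric.closedBall (extChartAt (𝓡 n) x₀ x₀) ρ ⊆ (extChartAt (𝓡 n) x₀).target
  mem_of_mem : ∀ y ∈ (extChartAt (𝓡 n) x₀).source,
    extChartAt (𝓡 n) x₀ y ∈ Metric.closedBall (extChartAt (𝓡 n) x₀ x₀) ρ → y ∈ U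

variable (B) in
/-- The unit tangent vectors with base point at distance at most `ρ` from `x₀` in the chart
at `x₀`, on which the differential of `f` is at least `c` in absolute value. -/
def transversal (f : X → ℝ) (x₀ : X) (ρ c : ℝ) : Set (TangentBundle (𝓡 n) X) :=
  {q | (q.1 ∈ (extChartAt (𝓡 n) x₀).source ∧
    extChartAt (𝓡 n) x₀ q.1 ∈ Metric.closedBall (extChartAt (𝓡 n) x₀ x₀) ρ ∧
    B.g.inner q.1 q.2 q.2 = 1) ∧ c ≤ |differential f q.1 q.2|}

variable (n) in
/-- The tangent vectors with base point at distance less than `ρ` from `x₀` in the chart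
at `x₀`, on which the differential of `f` is larger than `c` in absolute value. -/
def openTransversal (f : X → ℝ) (x₀ : X) (ρ c : ℝ) : Set (TangentBundle (𝓡 n) X) :=
  {q | (q.1 ∈ (extChartAt (𝓡 n) x₀).source ∧
    extChartAt (𝓡 n) x₀ q.1 ∈ Metric.ball (extChartAt (𝓡 n) x₀ x₀) ρ) ∧
    c < |differential f q.1 q.2|}

variable {f : X → ℝ} {x₀ : X} {U : Set X} {ρ c : ℝ}

theorem mem_transversal_of_mem_openTransversal {q : TangentBundle (𝓡 n) X}
    (hq : q ∈ openTransversal n f x₀ ρ c) (h : B.g.inner q.1 q.2 q.2 = 1) :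
    q ∈ B.transversal f x₀ ρ c :=
  ⟨⟨hq.1.1, Metric.ball_subset_closedBall hq.1.2, h⟩, hq.2.le⟩

variable (B) in
theorem transversal_mono {ρ' c' : ℝ} (hρ : ρ ≤ ρ') (hc : c' ≤ c) :
    B.transversal f x₀ ρ c ⊆ B.transversal f x₀ ρ' c' := fun _ hq =>
  ⟨⟨hq.1.1, Metric.closedBall_subset_closedBall hρ hq.1.2.1, hq.1.2.2⟩, hc.trans hq.2⟩

namespace IsBoundaryChart

theorem mono (h : B.IsBoundaryChart f x₀ U ρ) {ρ' : ℝ} (hρ : ρ' ≤ ρ) :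
    B.IsBoundaryChart f x₀ U ρ' :=
  ⟨h.isOpen, h.contMDiffOn, h.mem_iff,
    (Metric.closedBall_subset_closedBall hρ).trans h.subset_target,
    fun y hy hy' => h.mem_of_mem y hy (Metric.closedBall_subset_closedBall hρ hy')⟩

variable (h : B.IsBoundaryChart f x₀ U ρ)
include h

theorem isOpen_openTransversal (c : ℝ) : IsOpen (openTransversal n f x₀ ρ c) := by
  have h1 : IsOpen {q : TangentBundle (𝓡 n) X | q.1 ∈ (extChartAt (𝓡 n) x₀).source ∧
      extChartAt (𝓡 n) x₀ q.1 ∈ Metric.ball (extChartAt (𝓡 n) x₀ x₀) ρ} :=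
    ((continuousOn_extChartAt x₀).isOpen_inter_preimage (isOpen_extChartAt_source x₀)
      Metric.isOpen_ball).preimage TangentBundle.continuous_proj
  have h2 : ContinuousOn (fun q : TangentBundle (𝓡 n) X => differential f q.1 q.2)
      {q : TangentBundle (𝓡 n) X | q.1 ∈ (extChartAt (𝓡 n) x₀).source ∧
        extChartAt (𝓡 n) x₀ q.1 ∈ Metric.ball (extChartAt (𝓡 n) x₀ x₀) ρ} := by
    refine (continuousOn_differential h.isOpen h.contMDiffOn).mono ?_
    intro q hq
    exact h.mem_of_mem q.1 hq.1 (Metric.ball_subset_closedBall hq.2)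
  have h3 := h2.isOpen_inter_preimage h1
    (isOpen_lt (continuous_const (y := c)) (continuous_abs (G := ℝ)))
  exact h3

theorem isCompact_transversal [T2Space X] (c : ℝ) : IsCompact (B.transversal f x₀ ρ c) := by
  have : T2Space (TangentBundle (𝓡 n) X) := TangentBundle.t2Space
  have hK := B.g.isCompact_unit x₀ (isCompact_closedBall (extChartAt (𝓡 n) x₀ x₀) ρ) h.subset_target
  have h2 : ContinuousOn (fun q : TangentBundle (𝓡 n) X => differential f q.1 q.2)
      {q : TangentBundle (𝓡 n) X | q.1 ∈ (extChartAt (𝓡 n) x₀).source ∧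
        extChartAt (𝓡 n) x₀ q.1 ∈ Metric.closedBall (extChartAt (𝓡 n) x₀ x₀) ρ ∧
        B.g.inner q.1 q.2 q.2 = 1} := by
    refine (continuousOn_differential h.isOpen h.contMDiffOn).mono ?_
    intro q hq
    exact h.mem_of_mem q.1 hq.1 hq.2.1
  have h3 := h2.preimage_isClosed_of_isClosed hK.isClosed
    (isClosed_le (continuous_const (y := c)) (continuous_abs (G := ℝ)))
  exact hK.of_isClosed_subset h3 inter_subset_left

theorem mem_of_mem_transversal {q : TangentBundle (𝓡 n) X} (hq : q ∈ B.transversal f x₀ ρ c) :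
    q.1 ∈ U := h.mem_of_mem q.1 hq.1.1 hq.1.2.1

theorem mdifferentiableAt {y : X} (hy : y ∈ U) : MDifferentiableAt (𝓡 n) 𝓘(ℝ, ℝ) f y :=
  ((h.contMDiffOn y hy).contMDiffAt (h.isOpen.mem_nhds hy)).mdifferentiableAt (by norm_num)

theorem isLocalDefiningFunction (hc : 0 < c) {q : TangentBundle (𝓡 n) X}
    (hq : q ∈ B.transversal f x₀ ρ c) (hfr : q.1 ∈ frontier B.Ω) :
    IsLocalDefiningFunction (n := n) B.Ω q.1 f := by
  have hU := h.mem_of_mem_transversal hq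
  refine ⟨apply_eq_zero_of_mem_frontier B.obstacle.1 h.isOpen h.contMDiffOn h.mem_iff hU hfr,
    fun h0 => ?_, U, h.isOpen, hU, h.contMDiffOn, h.mem_iff⟩
  have h1 := hc.trans_le hq.2
  rw [differential, h0] at h1
  exact h1.ne' abs_zero

/-- The reflection only changes the sign of `df`, hence the absolute value in `transversal`. -/
theorem reflect_mem_transversal (hc : 0 < c) {q : TangentBundle (𝓡 n) X}
    (hq : q ∈ B.transversal f x₀ ρ c) (hfr : q.1 ∈ frontier B.Ω) :
    B.reflect q ∈ B.transversal f x₀ ρ c := by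
  refine ⟨⟨hq.1.1, hq.1.2.1, (B.inner_reflect hfr).trans hq.1.2.2⟩, ?_⟩
  rw [B.differential_reflect hfr (h.isLocalDefiningFunction hc hq hfr), abs_neg]
  exact hq.2

theorem depart_mem_transversal (hc : 0 < c) (ε : ℝ) {q : TangentBundle (𝓡 n) X}
    (hq : q ∈ B.transversal f x₀ ρ c) : B.depart ε q ∈ B.transversal f x₀ ρ c := by
  rcases B.depart_eq_self_or ε q with h' | ⟨hfr, h'⟩ <;> rw [h']
  · exact hq
  · exact h.reflect_mem_transversal hc hq hfr

theorem mem_transversal_of_depart_mem (hc : 0 < c) (ε : ℝ) {q : TangentBundle (𝓡 n) X}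
    (hq : B.depart ε q ∈ B.transversal f x₀ ρ c) : q ∈ B.transversal f x₀ ρ c := by
  rcases B.depart_eq_self_or ε q with h' | ⟨hfr, h'⟩ <;> rw [h'] at hq
  · exact hq
  · rw [← B.reflect_reflect hfr]
    exact h.reflect_mem_transversal hc hq hfr

/-- Over the boundary `df` is a multiple of the normal component, so it would vanish on a grazing
vector. Compact sets inside `nonGrazing` arise this way. -/
theorem mem_nonGrazing (hc : 0 < c) {q : TangentBundle (𝓡 n) X}
    (hq : q ∈ B.transversal f x₀ ρ c) (hi : q.1 ∉ interior B.Ω) : q ∈ B.nonGrazing := by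
  refine (B.mem_nonGrazing_iff q).2 ⟨hq.1.2.2, hi, fun hfr h0 => ?_⟩
  have h1 := (B.exists_differential_eq_mul hfr (h.isLocalDefiningFunction hc hq hfr)).2 q.2
  have h2 : B.g.inner q.1 q.2 (B.normal q.1) = 0 := h0
  rw [h2, mul_zero] at h1
  have h3 := hc.trans_le hq.2
  rw [h1] at h3
  exact h3.ne' abs_zero

/-- A trajectory starting transversally on the boundary does not return while it remains
transversal. -/
theorem le_hitTime [T2Space X] {ε : ℝ} (hε : ε * ε = 1) (hc : 0 < c) {q : TangentBundle (𝓡 n) X}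
    (hq : q ∈ B.nonGrazing) (hqΩ : q.1 ∈ frontier B.Ω) {t : ℝ}
    (ht : ∀ u, 0 ≤ u → u < t → B.g.geodesicFlow (ε * u) (B.depart ε q) ∈ B.transversal f x₀ ρ c) :
    ENNReal.ofReal t ≤ B.hitTime ε q := by
  have hε0 : ε ≠ 0 := by rintro rfl; simp at hε
  rw [ofReal_le_hitTime_iff]
  intro u hu hm
  by_contra hlt
  have htop : B.hitTime ε q ≠ ⊤ := fun h => hitTime_eq_top_iff.1 h u hu hm
  obtain ⟨w, hw⟩ := exists_isFirstHit hε hq htop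
  have hwu : w ≤ u := by
    by_contra hlt'
    exact hw.2.2 u hu (not_le.1 hlt') hm
  have hwt : w < t := hwu.trans_lt (not_le.1 hlt)
  have hU : ∀ u, 0 ≤ u → u < t → (B.g.geodesicFlow (ε * u) (B.depart ε q)).1 ∈ U :=
    fun u hu hut => h.mem_of_mem_transversal (ht u hu hut)
  have hder : ∀ u, 0 ≤ u → u < t → HasDerivAt (fun u => f (B.g.geodesicFlow (ε * u) (B.depart ε q)).1)
      (ε * differential f (B.g.geodesicFlow (ε * u) (B.depart ε q)).1
        (B.g.geodesicFlow (ε * u) (B.depart ε q)).2) u :=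
    fun u hu hut => B.hasDerivAt_path ε u _ (h.mdifferentiableAt (hU u hu hut))
  have hz : ∀ u, 0 ≤ u → u < t → (B.g.geodesicFlow (ε * u) (B.depart ε q)).1 ∈ frontier B.Ω →
      f (B.g.geodesicFlow (ε * u) (B.depart ε q)).1 = 0 := fun u hu hut hfr =>
    apply_eq_zero_of_mem_frontier B.obstacle.1 h.isOpen h.contMDiffOn h.mem_iff (hU u hu hut) hfr
  have h0 := hz 0 le_rfl (hw.1.trans hwt)
    (by rw [mul_zero, B.complete.geodesicFlow_zero, depart_proj]; exact hqΩ)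
  have h1 := hz w hw.1.le hwt hw.mem_frontier
  -- Rolle: `f` vanishes at the start and at the first return, so its derivative along the path
  -- vanishes in between, contrary to transversality.
  obtain ⟨v, hv, hv0⟩ := exists_hasDerivAt_eq_zero hw.1
    (fun v hv => (hder v hv.1 (hv.2.trans_lt hwt)).continuousAt.continuousWithinAt)
    (h0.trans h1.symm) (fun v hv => hder v hv.1.le (hv.2.trans hwt))
  have h2 := hc.trans_le (ht v hv.1.le (hv.2.trans hwt)).2
  rw [(mul_eq_zero.1 hv0).resolve_left hε0] at h2
  exact h2.ne' abs_zero

end IsBoundaryChart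

variable (B) in
theorem exists_isBoundaryChart (hx₀ : x₀ ∈ frontier B.Ω) :
    ∃ f : X → ℝ, ∃ U, ∃ ρ > 0, IsLocalDefiningFunction (n := n) B.Ω x₀ f ∧
      B.IsBoundaryChart f x₀ U ρ := by
  obtain ⟨f, hf⟩ := B.obstacle.2 x₀ hx₀
  obtain ⟨U, hU, hxU, hfU, hΩ⟩ := hf.2.2
  have hopen : IsOpen ((extChartAt (𝓡 n) x₀).target ∩ (extChartAt (𝓡 n) x₀).symm ⁻¹' U) :=
    (continuousOn_extChartAt_symm x₀).isOpen_inter_preimage (isOpen_extChartAt_target x₀) hU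
  obtain ⟨ρ, hρ, hball⟩ := Metric.nhds_basis_closedBall.mem_iff.1 (hopen.mem_nhds
    (x := extChartAt (𝓡 n) x₀ x₀) ⟨mem_extChartAt_target x₀, by
      rw [mem_preimage, extChartAt_to_inv]; exact hxU⟩)
  refine ⟨f, U, ρ, hρ, hf, hU, hfU, hΩ, hball.trans inter_subset_left, fun y hy hy' => ?_⟩
  have := (hball hy').2
  rwa [mem_preimage, (extChartAt (𝓡 n) x₀).left_inv hy] at this

end NearBoundary

end GeodesicBilliard

end

noncomputable section

open Set Filter

variable {n : ℕ} {X : Type*} [TopologicalSpace X] [ChartedSpace (EuclideanSpace ℝ (Fin n)) X]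

/-! ### Properness of the projection to a smooth model -/

namespace GeodesicBilliard

variable [IsManifold (𝓡 n) ∞ X] {B : GeodesicBilliard n X} [T2Space X]

/-- Compactness makes the time for which the flow stays in `O` uniform over `A`. -/
theorem exists_forall_geodesicFlow_mem {A O : Set (TangentBundle (𝓡 n) X)} (hA : IsCompact A)
    (hO : IsOpen O) (hAO : A ⊆ O) : ∃ δ > 0, ∀ t : ℝ, |t| < δ → ∀ q ∈ A, B.g.geodesicFlow t q ∈ O := by
  have h : ∀ᶠ t in 𝓝 (0 : ℝ), ∀ q ∈ A, B.g.geodesicFlow t q ∈ O := by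
    refine hA.eventually_forall_of_forall_eventually fun q hq => ?_
    refine B.complete.continuous_geodesicFlow.continuousAt.eventually_mem (hO.mem_nhds ?_)
    rw [B.complete.geodesicFlow_zero]
    exact hAO hq
  obtain ⟨δ, hδ, h⟩ := Metric.eventually_nhds_iff.1 h
  exact ⟨δ, hδ, fun t ht => h (by rwa [Real.dist_eq, sub_zero])⟩

/-- A backward billiard trajectory whose geodesic path is transversal has at most one collision,
and hence remains transversal. -/
theorem IsBoundaryChart.flow_neg_mem_transversal {f : X → ℝ} {x₀ : X} {U : Set X} {ρ ρ' c c' δ : ℝ}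
    (h : B.IsBoundaryChart f x₀ U ρ) (hρ : ρ' ≤ ρ) (hc : 0 < c) (hcc : c ≤ c')
    (hδ : ∀ u, |u| < δ → ∀ q ∈ B.transversal f x₀ ρ' c',
      B.g.geodesicFlow u q ∈ B.transversal f x₀ ρ c)
    {t : ℝ} (ht : 0 < t) (htδ : t < δ) {r : TangentBundle (𝓡 n) X} (hr : r ∈ B.interiorPhase)
    (hd : (-t, r) ∈ B.flowDomain)
    (hpath : ∀ s ∈ Icc 0 t, B.g.geodesicFlow (-s) r ∈ B.transversal f x₀ ρ' c') :
    B.flow (-t) r ∈ B.transversal f x₀ ρ c := by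
  have hε : (-1 : ℝ) * -1 = 1 := by norm_num
  have h' := h.mono hρ
  have hdr : B.depart (-1) r = r := depart_eq_self_of_notMem (-1) hr.2
  rw [flow_of_neg (neg_lt_zero.2 ht), neg_neg]
  rcases le_or_gt (ENNReal.ofReal t) (B.hitTime (-1) r) with hle | hlt
  · rw [advance_of_le _ _ hle, hdr, neg_one_mul]
    exact transversal_mono B hρ hcc (hpath t ⟨ht.le, le_rfl⟩)
  have htop : B.hitTime (-1) r ≠ ⊤ := hlt.ne_top
  obtain ⟨τ, hτ⟩ := exists_isFirstHit hε hd.1 htop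
  have hmax : ENNReal.ofReal t < B.maxTime (-1) r := by
    have := hd.2.2
    rwa [neg_neg] at this
  have hb : B.Bounces (-1) r := by
    by_contra hb
    rw [maxTime_of_not_bounces hb] at hmax
    exact lt_asymm hmax hlt
  obtain ⟨hpn, hpΩ, -⟩ := hitPoint_spec hε hd.1 hb
  rw [hτ.hitTime_eq, ENNReal.ofReal_lt_ofReal_iff ht] at hlt
  have hpA : B.hitPoint (-1) r ∈ B.transversal f x₀ ρ' c' := by
    rw [hτ.hitPoint_eq, hdr, neg_one_mul]
    exact hpath τ ⟨hτ.1.le, hlt.le⟩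
  have hdA := h'.depart_mem_transversal (hc.trans_le hcc) (-1) hpA
  -- After the first collision the reflected vector is still in the smaller transversal set, so for
  -- the remaining time, less than `δ`, its geodesic stays in the larger one. `le_hitTime` then
  -- excludes a second collision.
  have hpath' : ∀ u, 0 ≤ u → u ≤ t - τ →
      B.g.geodesicFlow (-1 * u) (B.depart (-1) (B.hitPoint (-1) r)) ∈ B.transversal f x₀ ρ c := by
    intro u hu hut
    refine hδ _ ?_ _ hdA
    rw [neg_one_mul, abs_neg, abs_of_nonneg hu]
    linarith [hτ.1]
  have hle := h.le_hitTime hε hc hpn (mem_frontier_of_mem hpn hpΩ)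
    fun u hu hut => hpath' u hu hut.le
  have hk : B.reflectionsBefore (-1) r t ≠ 0 := by
    intro h0
    obtain ⟨k, hk⟩ := lt_iSup_iff.1 hmax
    have hm := Nat.sInf_mem (s := {k | ENNReal.ofReal t ≤ B.collisionTime (-1) k r}) ⟨k, hk.le⟩
    change ENNReal.ofReal t ≤ B.collisionTime (-1) (B.reflectionsBefore (-1) r t) r at hm
    rw [h0] at hm
    change ENNReal.ofReal t ≤ B.hitTime (-1) r at hm
    rw [hτ.hitTime_eq, ENNReal.ofReal_le_ofReal_iff hτ.1.le] at hm
    linarith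
  -- The exact count does not matter: once the first reflection is used, no further hit occurs, and
  -- `advance` is the geodesic flow for any `k`.
  obtain ⟨k, hk⟩ := Nat.exists_eq_succ_of_ne_zero hk
  rw [hk, Nat.succ_eq_add_one, advance_succ_of_lt _ _
    (by rw [hτ.hitTime_eq]; exact (ENNReal.ofReal_lt_ofReal_iff ht).2 hlt),
    hτ.hitTime_eq, ENNReal.toReal_ofReal hτ.1.le, advance_of_le _ _ hle]
  exact hpath' _ (sub_nonneg.2 hlt.le) le_rfl

namespace IsSmoothModel

variable {m : ℕ} {N : Type*} [TopologicalSpace N] [ChartedSpace (EuclideanSpace ℝ (Fin m)) N]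
  {π : TangentBundle (𝓡 n) X → N} {φ : ℝ → N → N} (hM : B.IsSmoothModel (m := m) π φ)
include hM

omit [T2Space X] in
/-- A neighborhood of an interior point gives a neighborhood of its image. -/
theorem exists_mem_nhds {q₀ : TangentBundle (𝓡 n) X} (hq₀ : q₀ ∈ B.interiorPhase)
    {R : Set (TangentBundle (𝓡 n) X)} (hR : R ∈ 𝓝 q₀) :
    ∃ V ∈ 𝓝 (π q₀), ∀ p ∈ V, ∃ r ∈ B.interiorPhase, π r = p ∧ r ∈ R := by
  obtain ⟨σ, hσ, hσπ⟩ := hM.diffeo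
  have hmem : π '' B.interiorPhase ∈ 𝓝 (π q₀) := hM.isOpen_image.mem_nhds ⟨q₀, hq₀, rfl⟩
  refine ⟨π '' B.interiorPhase ∩ σ ⁻¹' R, inter_mem hmem
    ((hσ.continuousOn.continuousAt hmem).preimage_mem_nhds (by rwa [hσπ q₀ hq₀])), ?_⟩
  rintro _ ⟨⟨r, hr, rfl⟩, hrR⟩
  refine ⟨r, hr, rfl, ?_⟩
  rwa [mem_preimage, hσπ r hr] at hrR

theorem exists_nhds_isCompact_of_notMem {q₀ : TangentBundle (𝓡 n) X} (hq₀ : q₀ ∈ B.interiorPhase) :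
    ∃ V ∈ 𝓝 (π q₀), ∃ C, IsCompact C ∧ C ⊆ B.nonGrazing ∧ ∀ q ∈ B.nonGrazing, π q ∈ V → q ∈ C := by
  set e := extChartAt (𝓡 n) q₀.1 with he
  have hopen : IsOpen (e.target ∩ e.symm ⁻¹' B.Ωᶜ) :=
    (continuousOn_extChartAt_symm q₀.1).isOpen_inter_preimage (isOpen_extChartAt_target q₀.1)
      B.obstacle.1.isOpen_compl
  obtain ⟨ρ, hρ, hball⟩ := Metric.nhds_basis_closedBall.mem_iff.1 (hopen.mem_nhds
    (x := e q₀.1) ⟨mem_extChartAt_target q₀.1, by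
      rw [mem_preimage, extChartAt_to_inv]; exact hq₀.2⟩)
  have hC := B.g.isCompact_unit q₀.1 (isCompact_closedBall (e q₀.1) ρ)
    (hball.trans inter_subset_left)
  have hR : {q : TangentBundle (𝓡 n) X | q.1 ∈ e.source ∧ e q.1 ∈ Metric.ball (e q₀.1) ρ} ∈ 𝓝 q₀ :=
    (((continuousOn_extChartAt q₀.1).isOpen_inter_preimage (isOpen_extChartAt_source q₀.1)
      Metric.isOpen_ball).preimage TangentBundle.continuous_proj).mem_nhds
      ⟨mem_extChartAt_source q₀.1, Metric.mem_ball_self hρ⟩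
  obtain ⟨V, hV, hVR⟩ := hM.exists_mem_nhds hq₀ hR
  refine ⟨V, hV, _, hC, fun q hq => ?_, fun q hq hqV => ?_⟩
  · refine B.interiorPhase_subset_nonGrazing ⟨hq.2.2, ?_⟩
    have := (hball hq.2.1).2
    rwa [mem_preimage, e.left_inv hq.1] at this
  · obtain ⟨r, hr, hrq, hrR⟩ := hVR _ hqV
    have hqi := hM.mem_interiorPhase hq ⟨r, hr, hrq⟩
    obtain rfl := hM.eq_of_mem_interiorPhase hr hqi hrq
    exact ⟨hrR.1, Metric.ball_subset_closedBall hrR.2, hr.1⟩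

/-- If `π q` is near `π q₀`, continuity of the model flow puts `B.flow t q` near the interior point
`B.flow t q₀`. Flowing back from there by the billiard gives a transversal vector which departs like
`q`. -/
theorem exists_nhds_isCompact_of_mem {q₀ : TangentBundle (𝓡 n) X} (hq₀ : q₀ ∈ B.nonGrazing)
    (hΩ : q₀.1 ∈ B.Ω) :
    ∃ V ∈ 𝓝 (π q₀), ∃ C, IsCompact C ∧ C ⊆ B.nonGrazing ∧ ∀ q ∈ B.nonGrazing, π q ∈ V → q ∈ C := by
  have hT : T2Space (TangentBundle (𝓡 n) X) := TangentBundle.t2Space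
  have hd₀ := depart_mem_nonGrazing 1 hq₀
  have hdΩ : (B.depart 1 q₀).1 ∈ B.Ω := by rw [depart_proj]; exact hΩ
  have hfr := mem_frontier_of_mem hd₀ hdΩ
  obtain ⟨f, U, ρ, hρ, hf, h⟩ := B.exists_isBoundaryChart hfr
  obtain ⟨δ₀, hδ₀, hflow⟩ := exists_forall_flow_eq hq₀
  have hunit : ∀ t, B.g.inner _ (B.g.geodesicFlow t (B.depart 1 q₀)).2
    (B.g.geodesicFlow t (B.depart 1 q₀)).2 = 1 := inner_path hq₀ 1
  generalize hq' : B.depart 1 q₀ = q' at *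
  set a := |differential f q'.1 q'.2| with ha
  have ha0 : 0 < a := by
    obtain ⟨hneg, hmul⟩ := B.exists_differential_eq_mul hfr hf
    rw [ha, hmul]
    exact abs_pos.2 (mul_ne_zero hneg.ne (normalComponent_ne_zero hd₀ hdΩ))
  have h2 := h.mono (half_le_self hρ.le)
  set O := openTransversal n f q'.1 (ρ / 2) (a / 2) with hO
  have hOo : IsOpen O := h2.isOpen_openTransversal _
  have hq'O : q' ∈ O := ⟨⟨mem_extChartAt_source q'.1, Metric.mem_ball_self (half_pos hρ)⟩,
    half_lt_self ha0⟩
  -- Passing from `(ρ / 2, a / 2)` to `(ρ, a / 4)` leaves room for the geodesic motion after a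
  -- possible reflection.
  obtain ⟨δ₁, hδ₁, hstep⟩ := exists_forall_geodesicFlow_mem (B := B)
    (h2.isCompact_transversal (a / 2)) (h.isOpen_openTransversal (a / 4)) fun q hq =>
      ⟨⟨hq.1.1, Metric.closedBall_subset_ball (half_lt_self hρ) hq.1.2.1⟩,
        lt_of_lt_of_le (by linarith) hq.2⟩
  have hstep' : ∀ u, |u| < δ₁ → ∀ q ∈ B.transversal f q'.1 (ρ / 2) (a / 2),
      B.g.geodesicFlow u q ∈ B.transversal f q'.1 ρ (a / 4) := fun u hu q hq =>
    mem_transversal_of_mem_openTransversal (hstep u hu q hq)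
      ((B.complete.inner_geodesicFlow u q).trans hq.1.2.2)
  obtain ⟨δ₂, hδ₂, hstart⟩ := exists_forall_geodesicFlow_mem (B := B)
    (isCompact_singleton (x := q')) hOo (singleton_subset_iff.2 hq'O)
  obtain ⟨t, ht, htδ⟩ := exists_between (lt_min hδ₀ (lt_min hδ₁ hδ₂))
  rw [lt_min_iff, lt_min_iff] at htδ
  obtain ⟨hd, hi, hG⟩ := hflow t ht htδ.1
  -- The backward geodesic of `B.flow t q₀` is the geodesic of `q'`, which stays in `O` up to time
  -- `t`; compactness of the time interval makes this an open condition on `r`.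
  have hR : ∀ᶠ r in 𝓝 (B.flow t q₀), ∀ s ∈ Icc 0 t, B.g.geodesicFlow (-s) r ∈ O := by
    refine isCompact_Icc.eventually_forall_of_forall_eventually fun s hs => ?_
    have hc : Continuous fun z : TangentBundle (𝓡 n) X × ℝ => B.g.geodesicFlow (-z.2) z.1 :=
      B.complete.continuous_geodesicFlow.comp (continuous_snd.neg.prodMk continuous_fst)
    refine hc.continuousAt.eventually_mem (hOo.mem_nhds ?_)
    change B.g.geodesicFlow (-s) (B.flow t q₀) ∈ O
    rw [hG, B.complete.geodesicFlow_geodesicFlow]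
    refine hstart _ ?_ _ rfl
    rw [abs_of_nonneg (by linarith [hs.2])]
    linarith [hs.1, htδ.2.2]
  obtain ⟨V, hV, hVR⟩ := hM.exists_mem_nhds hi hR
  have hdm : (t, π q₀) ∈ B.modelDomain π := ⟨_, hd, rfl⟩
  have hcm : Continuous fun p : N => (t, p) := by fun_prop
  have hV' : {p | (t, p) ∈ B.modelDomain π ∧ φ t p ∈ V} ∈ 𝓝 (π q₀) := by
    refine inter_mem (hcm.continuousAt.preimage_mem_nhds (hM.isOpen_domain.mem_nhds hdm)) ?_
    have h3 : ContinuousAt (fun p => φ t p) (π q₀) :=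
      ContinuousAt.comp (f := fun p : N => (t, p)) (hM.continuousAt_flow hdm) hcm.continuousAt
    refine h3.preimage_mem_nhds ?_
    rwa [hM.intertwines _ _ hd]
  have hA := h.isCompact_transversal (a / 4)
  refine ⟨_, hV', B.transversal f q'.1 ρ (a / 4) ∩ {q | q.1 ∉ interior B.Ω},
    hA.inter_right (isOpen_interior.isClosed_compl.preimage TangentBundle.continuous_proj),
    fun q hq => h.mem_nonGrazing (by positivity) hq.1 hq.2, ?_⟩
  rintro q hq ⟨hqd, hqV⟩
  rw [hM.mem_modelDomain_iff hq] at hqd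
  rw [hM.intertwines _ _ hqd] at hqV
  obtain ⟨r, hr, hrq, hrR⟩ := hVR _ hqV
  have hri := hM.mem_interiorPhase (flow_mem_nonGrazing hqd) ⟨r, hr, hrq⟩
  obtain rfl := hM.eq_of_mem_interiorPhase hr hri hrq
  have hback := neg_mem_flowDomain ht hqd
  have hmem := h.flow_neg_mem_transversal (half_le_self hρ.le) (by positivity : 0 < a / 4)
    (by linarith : a / 4 ≤ a / 2) hstep' ht htδ.2.1 hr hback fun s hs =>
      mem_transversal_of_mem_openTransversal (hrR s hs)
        ((B.complete.inner_geodesicFlow _ _).trans hr.1)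
  -- Going forward and back recovers `q` only up to reflection, under which the transversal set is
  -- invariant.
  have hdep := hM.depart_eq (flow_mem_nonGrazing hback) hq (hM.proj_flow_neg ht hqd)
  have hmem' := h.depart_mem_transversal (by positivity) 1 hmem
  rw [hdep] at hmem'
  exact ⟨h.mem_transversal_of_depart_mem (by positivity) 1 hmem',
    ((B.mem_nonGrazing_iff q).1 hq).2.1⟩

/-- The projection to a smooth model is proper. -/
theorem exists_nhds_isCompact {q₀ : TangentBundle (𝓡 n) X} (hq₀ : q₀ ∈ B.nonGrazing) :
    ∃ V ∈ 𝓝 (π q₀), ∃ C, IsCompact C ∧ C ⊆ B.nonGrazing ∧ ∀ q ∈ B.nonGrazing, π q ∈ V → q ∈ C := by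
  by_cases h : q₀.1 ∈ B.Ω
  · exact hM.exists_nhds_isCompact_of_mem hq₀ h
  · exact hM.exists_nhds_isCompact_of_notMem (mem_interiorPhase_of_notMem hq₀ h)

end IsSmoothModel

end GeodesicBilliard

end

noncomputable section

open Set Filter

variable {n : ℕ} {X : Type*} [TopologicalSpace X] [ChartedSpace (EuclideanSpace ℝ (Fin n)) X]

/-! ### Trapped sets and closed trajectories of smooth models -/

namespace GeodesicBilliard

variable [IsManifold (𝓡 n) ∞ X] {B : GeodesicBilliard n X}

/-- Two vectors which both are incoming if they lie on the boundary agree if they depart equally. -/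
theorem eq_of_depart_eq {ε : ℝ} (hε : ε * ε = 1) {q r : TangentBundle (𝓡 n) X}
    (hq : q ∈ B.nonGrazing) (hr : r ∈ B.nonGrazing) (hqε : q.1 ∈ B.Ω → 0 < ε * B.normalComponent q)
    (hrε : r.1 ∈ B.Ω → 0 < ε * B.normalComponent r) (h : B.depart ε q = B.depart ε r) : q = r := by
  have hself : ∀ {p : TangentBundle (𝓡 n) X}, (p.1 ∈ B.Ω → 0 < ε * B.normalComponent p) →
      B.depart (-ε) p = p := by
    intro p hp
    by_cases hΩ : p.1 ∈ B.Ω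
    · exact depart_eq_self_of_nonpos (by linarith [hp hΩ])
    · exact depart_eq_self_of_notMem _ hΩ
  rw [← hself hqε, depart_neg_eq_of_depart_eq hε hq hr h, hself hrε]

variable [T2Space X]

namespace IsSmoothModel

variable {m : ℕ} {N : Type*} [TopologicalSpace N] [ChartedSpace (EuclideanSpace ℝ (Fin m)) N]
  {π : TangentBundle (𝓡 n) X → N} {φ : ℝ → N → N} (hM : B.IsSmoothModel (m := m) π φ)
include hM

/-- A compact set of the model is covered by finitely many neighborhoods as in
`exists_nhds_isCompact`, so its preimage lies in a compact set. Conversely, `π` maps compact sets to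
compact sets. -/
theorem proj_mem_modelTrapped_iff {q : TangentBundle (𝓡 n) X} (hq : q ∈ B.nonGrazing) :
    π q ∈ B.modelTrapped π φ ↔ q ∈ B.trapped := by
  constructor
  · rintro ⟨-, hd, W, hW, -, hφ⟩
    have hd' : ∀ t, (t, q) ∈ B.flowDomain := fun t => (hM.mem_modelDomain_iff hq t).1 (hd t)
    have hcov : ∀ p ∈ W, ∃ V ∈ 𝓝[W] p, ∃ C, IsCompact C ∧ C ⊆ B.nonGrazing ∧
        ∀ q ∈ B.nonGrazing, π q ∈ V → q ∈ C := by
      intro p _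
      obtain ⟨r, hr, rfl⟩ := hM.exists_eq p
      obtain ⟨V, hV, h⟩ := hM.exists_nhds_isCompact hr
      exact ⟨V, mem_nhdsWithin_of_mem_nhds hV, h⟩
    obtain ⟨C, hC, hCn, hCW⟩ : ∃ C, IsCompact C ∧ C ⊆ B.nonGrazing ∧
        ∀ q ∈ B.nonGrazing, π q ∈ W → q ∈ C := by
      refine hW.induction_on (p := fun V => ∃ C, IsCompact C ∧ C ⊆ B.nonGrazing ∧
        ∀ q ∈ B.nonGrazing, π q ∈ V → q ∈ C) ⟨∅, isCompact_empty, empty_subset _, by simp⟩ ?_ ?_ hcov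
      · rintro s t hst ⟨C, hC, hCn, h⟩
        exact ⟨C, hC, hCn, fun q hq hqs => h q hq (hst hqs)⟩
      · rintro s t ⟨C, hC, hCn, h⟩ ⟨C', hC', hCn', h'⟩
        exact ⟨C ∪ C', hC.union hC', union_subset hCn hCn', fun q hq hqs =>
          hqs.imp (h q hq) (h' q hq)⟩
    refine ⟨hq, hd', C, hC, hCn, fun t => hCW _ (flow_mem_nonGrazing (hd' t)) ?_⟩
    rw [← hM.intertwines _ _ (hd' t)]
    exact hφ t
  · rintro ⟨-, hd, W, hW, hWn, hf⟩
    refine ⟨mem_univ _, fun t => ⟨_, hd t, rfl⟩, π '' W,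
      hW.image_of_continuousOn (hM.smooth_proj.continuousOn.mono hWn), subset_univ _, fun t => ?_⟩
    rw [hM.intertwines _ _ (hd t)]
    exact mem_image_of_mem _ (hf t)

theorem trajectory_proj {q : TangentBundle (𝓡 n) X} (hq : q ∈ B.nonGrazing) :
    PartialFlow.trajectory (B.modelDomain π) φ (π q) =
      π '' PartialFlow.trajectory B.flowDomain B.flow q := by
  ext p
  constructor
  · rintro ⟨t, hd, rfl⟩
    have hd' := (hM.mem_modelDomain_iff hq t).1 hd
    exact ⟨_, ⟨t, hd', rfl⟩, (hM.intertwines _ _ hd').symm⟩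
  · rintro ⟨_, ⟨t, hd, rfl⟩, rfl⟩
    exact ⟨t, ⟨_, hd, rfl⟩, hM.intertwines _ _ hd⟩

omit [T2Space X] in
theorem isPeriod_proj {T : ℝ} {q : TangentBundle (𝓡 n) X}
    (h : PartialFlow.IsPeriod B.flowDomain B.flow T q) :
    PartialFlow.IsPeriod (B.modelDomain π) φ T (π q) :=
  ⟨h.1, ⟨_, h.2.1, rfl⟩, by rw [hM.intertwines _ _ h.2.1, h.2.2]⟩

/-- An arbitrary lift `q` may return only to its reflection. The vector `r` reached at time `T`
departs like `q`, so the flow for time `T` takes `r` to where it takes `q`, namely to `r`. -/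
theorem exists_isPeriod {T : ℝ} {p : N} (h : PartialFlow.IsPeriod (B.modelDomain π) φ T p) :
    ∃ q ∈ B.nonGrazing, PartialFlow.IsPeriod B.flowDomain B.flow T q ∧ π q = p := by
  obtain ⟨hT, hd, hp⟩ := h
  obtain ⟨q, hq, rfl⟩ := hM.exists_eq p
  rw [hM.mem_modelDomain_iff hq] at hd
  rw [hM.intertwines _ _ hd] at hp
  have hr := flow_mem_nonGrazing hd
  have hdep := hM.depart_eq hr hq hp
  exact ⟨_, hr, ⟨hT, (mem_flowDomain_congr hr hq hdep T).2 hd, flow_congr hr hq hdep hT.ne'⟩, hp⟩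

theorem periodic {T : ℝ} {q : TangentBundle (𝓡 n) X}
    (h : PartialFlow.IsPeriod B.flowDomain B.flow T q) :
    Function.Periodic (fun t => φ t (π q)) T := fun t => by
  change φ (t + T) (π q) = φ t (π q)
  rw [← hM.flow_flow (forall_mem_flowDomain_of_isPeriod h), (hM.isPeriod_proj h).2.2]

/-- The orbit is the image of one period under a continuous curve. The argument takes place in the
model because billiard trajectories jump at collisions. -/
theorem proj_mem_modelTrapped {T : ℝ} {q : TangentBundle (𝓡 n) X}
    (h : PartialFlow.IsPeriod B.flowDomain B.flow T q) : π q ∈ B.modelTrapped π φ := by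
  have hd : ∀ t, (t, π q) ∈ B.modelDomain π := fun t =>
    ⟨_, forall_mem_flowDomain_of_isPeriod h t, rfl⟩
  have hc : Continuous fun t => φ t (π q) := continuous_iff_continuousAt.2 fun t =>
    ContinuousAt.comp (f := fun t : ℝ => (t, π q)) (hM.continuousAt_flow (hd t)) (by fun_prop)
  refine ⟨mem_univ _, hd, _, isCompact_Icc.image hc (s := Icc 0 (0 + T)), subset_univ _, fun t => ?_⟩
  obtain ⟨s, hs, he⟩ := (hM.periodic h).exists_mem_Ico h.1 t 0
  exact ⟨s, Ico_subset_Icc_self hs, he.symm⟩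

/-- A closed trajectory contains all points with projection on its projection. -/
theorem mem_trajectory {T : ℝ} {q r : TangentBundle (𝓡 n) X}
    (h : PartialFlow.IsPeriod B.flowDomain B.flow T q) (hr : r ∈ B.nonGrazing)
    (hmem : π r ∈ PartialFlow.trajectory (B.modelDomain π) φ (π q)) :
    r ∈ PartialFlow.trajectory B.flowDomain B.flow q := by
  have hall := forall_mem_flowDomain_of_isPeriod h
  obtain ⟨u, -, hu⟩ := hmem
  -- Outward boundary vectors are reached at negative times, all other vectors at positive times;
  -- periodicity lets the time be chosen with the required sign.
  by_cases hn : r.1 ∈ B.Ω ∧ B.normalComponent r < 0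
  · obtain ⟨v, hv, he⟩ := (hM.periodic h).exists_mem_Ico h.1 u (-T)
    have hv0 : v < 0 := by linarith [hv.2]
    have hR := reaches_flow_of_neg hv0 (hall v)
    have hp : π (B.flow v q) = π r := by
      rw [← hM.intertwines _ _ (hall v)]
      exact he.symm.trans hu
    exact ⟨v, hall v, eq_of_depart_eq (ε := -1) (by norm_num) hR.mem_nonGrazing hr hR.pos
      (fun _ => by linarith [hn.2]) (depart_neg_eq_of_depart_eq (one_mul 1) hR.mem_nonGrazing hr
        (hM.depart_eq hR.mem_nonGrazing hr hp))⟩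
  · obtain ⟨v, hv, he⟩ := (hM.periodic h).exists_mem_Ioc h.1 u 0
    have hR := reaches_flow_of_pos hv.1 (hall v)
    have hp : π (B.flow v q) = π r := by
      rw [← hM.intertwines _ _ (hall v)]
      exact he.symm.trans hu
    refine ⟨v, hall v, eq_of_depart_eq (one_mul 1) hR.mem_nonGrazing hr hR.pos
      (fun hΩ => ?_) (hM.depart_eq hR.mem_nonGrazing hr hp)⟩
    rw [one_mul]
    exact (normalComponent_ne_zero hr hΩ).lt_or_gt.resolve_left fun hlt => hn ⟨hΩ, hlt⟩

theorem trajectory_subset {T : ℝ} {q r : TangentBundle (𝓡 n) X}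
    (h : PartialFlow.IsPeriod B.flowDomain B.flow T q)
    (heq : π '' PartialFlow.trajectory B.flowDomain B.flow r =
      π '' PartialFlow.trajectory B.flowDomain B.flow q) :
    PartialFlow.trajectory B.flowDomain B.flow r ⊆
      PartialFlow.trajectory B.flowDomain B.flow q := by
  rintro _ ⟨t, hd, rfl⟩
  refine hM.mem_trajectory h (flow_mem_nonGrazing hd) ?_
  rw [hM.trajectory_proj h.2.1.1, ← heq]
  exact ⟨_, ⟨t, hd, rfl⟩, rfl⟩

/-- An earlier return in the model would be a return up to reflection. Both `B.flow t q` and `q =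
B.flow T q` are reached in positive time, so both are inward if on the boundary, and equal departure
makes them equal. -/
theorem isPrimitivePeriod_proj {T : ℝ} {q : TangentBundle (𝓡 n) X}
    (h : PartialFlow.IsPrimitivePeriod B.flowDomain B.flow T q) :
    PartialFlow.IsPrimitivePeriod (B.modelDomain π) φ T (π q) := by
  refine ⟨hM.isPeriod_proj h.1, fun t ht he => h.2 t ht ?_⟩
  have hall := forall_mem_flowDomain_of_isPeriod h.1
  rw [hM.intertwines _ _ (hall t)] at he
  have hR := reaches_flow_of_pos ht.1 (hall t)
  have hR' := reaches_flow_of_pos h.1.1 h.1.2.1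
  rw [h.1.2.2] at hR'
  exact eq_of_depart_eq (one_mul 1) hR.mem_nonGrazing hR'.mem_nonGrazing hR.pos hR'.pos
    (hM.depart_eq hR.mem_nonGrazing hR'.mem_nonGrazing he)

theorem exists_isPrimitivePeriod {T : ℝ} {p : N}
    (h : PartialFlow.IsPrimitivePeriod (B.modelDomain π) φ T p) :
    ∃ q ∈ B.nonGrazing, PartialFlow.IsPrimitivePeriod B.flowDomain B.flow T q ∧ π q = p := by
  obtain ⟨q, hq, hqT, rfl⟩ := hM.exists_isPeriod h.1
  refine ⟨q, hq, ⟨hqT, fun t ht he => h.2 t ht ?_⟩, rfl⟩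
  rw [hM.intertwines _ _ (forall_mem_flowDomain_of_isPeriod hqT t), he]

/-- By `mem_trajectory`, a closed trajectory is the full preimage of its projection within
`nonGrazing`. -/
theorem injOn_closedTrajectories :
    InjOn (fun c : ℝ × Set (TangentBundle (𝓡 n) X) => (c.1, π '' c.2))
      (PartialFlow.closedTrajectories B.flowDomain B.flow) := by
  rintro ⟨T, γ⟩ ⟨q, hq, hγ⟩ ⟨T', γ'⟩ ⟨r, hr, hγ'⟩ heq
  obtain ⟨h1, h2⟩ := Prod.mk.inj heq
  simp only at h1 hγ hγ' h2 hq hr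
  subst h1 hγ hγ'
  exact Prod.ext rfl ((hM.trajectory_subset hr h2).antisymm (hM.trajectory_subset hq h2.symm))

end IsSmoothModel

end GeodesicBilliard

end

theorem mainTheorem10 {n : ℕ} (hn : 1 ≤ n) {X : Type*} [TopologicalSpace X] [T2Space X]
    [SecondCountableTopology X] [ConnectedSpace X]
    [ChartedSpace (EuclideanSpace ℝ (Fin n)) X] [IsManifold (𝓡 n) ∞ X]
    (B : GeodesicBilliard n X)
    {m : ℕ} {N : Type*} [TopologicalSpace N] [T2Space N] [SecondCountableTopology N]
    [ChartedSpace (EuclideanSpace ℝ (Fin m)) N] [IsManifold (𝓡 m) ∞ N]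
    (π : TangentBundle (𝓡 n) X → N) (φ : ℝ → N → N) (hmodel : B.IsSmoothModel (m := m) π φ) :
    -- the trapped sets correspond to each other
    B.modelTrapped π φ = π '' B.trapped ∧
    B.nonGrazing ∩ π ⁻¹' B.modelTrapped π φ = B.trapped ∧
    -- closed trajectories, with their periods, correspond to each other
    Set.BijOn (fun c : ℝ × Set (TangentBundle (𝓡 n) X) => (c.1, π '' c.2))
      (PartialFlow.closedTrajectories B.flowDomain B.flow)
      (PartialFlow.closedTrajectories (B.modelDomain π) φ) ∧
    -- so do closed trajectories with their primitive periods
    Set.BijOn (fun c : ℝ × Set (TangentBundle (𝓡 n) X) => (c.1, π '' c.2))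
      (PartialFlow.primitiveClosedTrajectories B.flowDomain B.flow)
      (PartialFlow.primitiveClosedTrajectories (B.modelDomain π) φ) ∧
    -- primitive periodic points of the model flow lift to the billiard flow
    (∀ (p : N) (T : ℝ), PartialFlow.IsPrimitivePeriod (B.modelDomain π) φ T p →
      ∃ q ∈ B.nonGrazing, PartialFlow.IsPrimitivePeriod B.flowDomain B.flow T q ∧ π q = p) ∧
    -- primitive periodic points of the billiard flow project to the model flow
    (∀ q ∈ B.nonGrazing, ∀ T : ℝ, PartialFlow.IsPrimitivePeriod B.flowDomain B.flow T q →
      π q ∈ B.modelTrapped π φ ∧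
      PartialFlow.IsPrimitivePeriod (B.modelDomain π) φ T (π q)) := by
  refine ⟨?_, ?_, ⟨?_, hmodel.injOn_closedTrajectories, ?_⟩, ⟨?_, ?_, ?_⟩,
    fun p T h => hmodel.exists_isPrimitivePeriod h,
    fun q _ T h => ⟨hmodel.proj_mem_modelTrapped h.1, hmodel.isPrimitivePeriod_proj h⟩⟩
  · ext p
    constructor
    · intro hp
      obtain ⟨q, hq, rfl⟩ := hmodel.exists_eq p
      exact ⟨q, (hmodel.proj_mem_modelTrapped_iff hq).1 hp, rfl⟩
    · rintro ⟨q, hq, rfl⟩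
      exact (hmodel.proj_mem_modelTrapped_iff hq.1).2 hq
  · ext q
    exact ⟨fun hq => (hmodel.proj_mem_modelTrapped_iff hq.1).1 hq.2,
      fun hq => ⟨hq.1, (hmodel.proj_mem_modelTrapped_iff hq.1).2 hq⟩⟩
  · rintro ⟨T, γ⟩ ⟨q, hq, hγ⟩
    exact ⟨π q, hmodel.isPeriod_proj hq, by
      rw [hmodel.trajectory_proj hq.2.1.1, ← hγ]⟩
  · rintro ⟨T, γ⟩ ⟨p, hp, hγ⟩
    obtain ⟨q, hq, hqT, rfl⟩ := hmodel.exists_isPeriod hp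
    exact ⟨(T, _), ⟨q, hqT, rfl⟩, Prod.ext rfl ((hmodel.trajectory_proj hq).symm.trans hγ.symm)⟩
  · rintro ⟨T, γ⟩ ⟨q, hq, hγ⟩
    exact ⟨π q, hmodel.isPrimitivePeriod_proj hq, by
      rw [hmodel.trajectory_proj hq.1.2.1.1, ← hγ]⟩
  · refine hmodel.injOn_closedTrajectories.mono ?_
    rintro c ⟨q, hq, hγ⟩
    exact ⟨q, hq.1, hγ⟩
  · rintro ⟨T, γ⟩ ⟨p, hp, hγ⟩
    obtain ⟨q, hq, hqT, rfl⟩ := hmodel.exists_isPrimitivePeriod hp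
    exact ⟨(T, _), ⟨q, hqT, rfl⟩, Prod.ext rfl ((hmodel.trajectory_proj hq).symm.trans hγ.symm)⟩
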